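/- Let $\mu\ge 1$, let $F_\mu$ be the free group on $z_1,\dots,z_\mu$, let $W$ be a connected finite $CW$ complex and let $p\colon\widetilde W\to W$ be an $F_\mu$-cover (a regular covering with group of covering translations $F_\mu$) with $\widetilde W$ connected and equipped with the lifted cell structure. Definitions. Given spaces $Y_1,\dots,Y_\mu,Z$ and maps $\alpha_i^{\pm}\colon Y_i\to Z$, let $Y=\bigsqcup_i Y_i$ and let $X=Y\times[-1,1]\cup_{Y\times\{-1,1\}}Z$ be the space obtained from $Y\times[-1,1]\sqcup Z$ by identifying $(y,\pm1)$ with $\alpha_i^{\pm}(y)$ for $y\in Y_i$. A homotopy $F_\mu$-splitting $(X,Y,Z,h)$ of $W$ is such an $X$ with a homotopy equivalence $h\colon X\to W$. It is simple if $X$ is a finite $CW$ complex in which $Y_i=Y_i\times\{0\}$ $(1\le i\le\mu)$ and $Z$ are subcomplexes and $h$ is a simple homotopy equivalence (homotopic to a finite composite of elementary expansions, elementary collapses and $CW$ isomorphisms). A fundamental domain of an $F_\mu$-cover $\widetilde X\to X$ is a closed subset $U\subseteq\widetilde X$ with $F_\mu U=\widetilde X$ such that $gU\cap kU$ $(g,k\in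 F_\mu)$ is $gV_i$ if $g=kz_i$, is $kV_i$ if $g=kz_i^{-1}$, and is empty if $g\notin\{k,kz_1^{\pm1},\dots,kz_\mu^{\pm1}\}$, where $V_i=U\cap z_i^{-1}U$. Let $I_\mu\subset\mathbb R^\mu$ be the union of the segments $[e_i^-,e_i^+]$, where $e_i^{\pm}$ is $\pm$ the $i$-th standard basis vector. For $V\subseteq\widetilde W$ let $X(V)$ be the space obtained as above from $$Y(V)_i=V\cap z_i^{-1}V,\qquad Z(V)=V\times I_\mu,\qquad \alpha(V)_i^+(x)=(z_ix,e_i^+),\qquad \alpha(V)_i^-(x)=(x,e_i^-),$$ and let $h(V)\colon X(V)\to W$ be induced by $p$. For $V=\widetilde W$ write $(X(\infty),Y(\infty),Z(\infty),h(\infty))$. Theorem (Combinatorial transversality). (1) The quadruple $(X(\infty),Y(\infty),Z(\infty),h(\infty))$ is a homotopy $F_\mu$-splitting of $W$ (the canonical one). (2) There is a collection $\{V\}$ of finite subcomplexes $V\subset\widetilde W$ with $p(V)=W$ for each $V$ and $\bigcup_{\{V\}}V=\widetilde W$, such that each $(X(V),Y(V),Z(V),h(V))$ is a simple homotopy $F_\mu$-splitting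 of $W$, the natural map $X(V)\to X(\infty)$ is a closed embedding through which $h(V)$ is the restriction of $h(\infty)$, and $$(X(\infty),Y(\infty),Z(\infty),h(\infty))=\bigcup_{\{V\}}(X(V),Y(V),Z(V),h(V)).$$ Moreover, for each of these $V$ the finite $CW$ structure on $X(V)$ can be chosen such that in addition the pullback $F_\mu$-cover $h(V)^*\widetilde W\to X(V)$ has a fundamental domain which is a finite subcomplex. (3) In particular, there exist simple homotopy $F_\mu$-splittings $(X,Y,Z,h)$ of $W$ for which $h^*\widetilde W\to X$ has a fundamental domain which is a finite subcomplex. -/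

import Mathlib

open Set Metric Topology
open scoped Pointwise

universe u

/-! ### Finite CW complexes and simple homotopy equivalences -/

/-- The structure of a finite CW complex (in particular Hausdorff) on a topological space `X`. -/
structure FiniteCW (X : Type u) [TopologicalSpace X] where
  t2 : T2Space X
  cw : CWComplex (univ : Set X)
  fin : CWComplex.Finite (univ : Set X)

namespace FiniteCW

variable {X : Type u} [TopologicalSpace X] (K : FiniteCW X)

/-- The index type of the `n`-cells. -/
def cell (n : ℕ) : Type u :=
  letI := K.cw
  RelCWComplex.cell (univ : Set X) n

/-- The characteristic map of an `n`-cell, defined on the cube `[-1, 1]ⁿ`, which is the closed unit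
ball of `Fin n → ℝ` for the sup norm; its values outside of this cube carry no information. -/
def charMap {n : ℕ} (i : K.cell n) : (Fin n → ℝ) → X :=
  letI := K.cw
  RelCWComplex.map (C := (univ : Set X)) n i

/-- The open cell with index `i`. -/
def openCell {n : ℕ} (i : K.cell n) : Set X :=
  letI := K.cw
  RelCWComplex.openCell (C := (univ : Set X)) n i

/-- The `n`-skeleton. -/
def skeleton (n : ℕ) : Set X :=
  letI := K.cw
  haveI := K.t2
  (RelCWComplex.skeleton (univ : Set X) n : Set X)

/-- The union of all cells of dimension less than `n`. -/
def skeletonLT (n : ℕ) : Set X :=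
  letI := K.cw
  haveI := K.t2
  (RelCWComplex.skeletonLT (univ : Set X) n : Set X)

/-- A subset is a subcomplex if it underlies a subcomplex in the sense of Mathlib, that is, if it is
closed and a union of open cells. -/
def IsSubcomplex (A : Set X) : Prop :=
  letI := K.cw
  ∃ E : RelCWComplex.Subcomplex (univ : Set X), (E : Set X) = A

/-- `φ`, restricted to the closed cube, is a characteristic map for the `n`-cell `i`: it is
continuous, sends the open cube bijectively (hence, by compactness, homeomorphically) to the open
cell, and sends the boundary to the union of the cells of lower dimension. -/
structure IsCharMap {n : ℕ} (i : K.cell n) (φ : (Fin n → ℝ) → X) : Prop where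
  continuousOn : ContinuousOn φ (closedBall 0 1)
  injOn : InjOn φ (ball 0 1)
  image_ball : φ '' ball 0 1 = K.openCell i
  mapsTo_sphere : MapsTo φ (sphere 0 1) (K.skeletonLT n)

end FiniteCW

section SimpleHomotopy

variable {X Y : Type u} [TopologicalSpace X] [TopologicalSpace Y]

/-- A CW isomorphism: a homeomorphism that sends every open cell onto an open cell. -/
structure IsCWIso (K : FiniteCW X) (L : FiniteCW Y) (f : C(X, Y)) : Prop where
  isHomeomorph : IsHomeomorph f
  image_cell : ∀ (n : ℕ) (i : K.cell n), ∃ j : L.cell n, f '' K.openCell i = L.openCell j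

/-- `f` is an elementary expansion: it is an isomorphism of `K` onto a subcomplex of `L`, and `L` has
exactly two further cells `a` and `b`, of dimensions `n` and `n + 1`, such that some characteristic
map `φ` of `b` restricts on the top face `[-1, 1]ⁿ × {1}` of the cube to a characteristic map of `a`
and sends the union of the other faces of the cube to the part of the `n`-skeleton of `L` that lies
in the image of `f`. -/
structure IsElementaryExpansion (K : FiniteCW X) (L : FiniteCW Y) (f : C(X, Y)) : Prop where
  isEmbedding : IsEmbedding f
  image_cell : ∀ (n : ℕ) (i : K.cell n), ∃ j : L.cell n, f '' K.openCell i = L.openCell j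
  exists_cells : ∃ (n : ℕ) (a : L.cell n) (b : L.cell (n + 1)) (φ : (Fin (n + 1) → ℝ) → Y),
    (range f)ᶜ = L.openCell a ∪ L.openCell b ∧
    L.IsCharMap b φ ∧
    L.IsCharMap a (fun x : Fin n → ℝ ↦ φ (Fin.snoc x (1 : ℝ) : Fin (n + 1) → ℝ)) ∧
    MapsTo φ
      (sphere 0 1 \ (fun x : Fin n → ℝ ↦ (Fin.snoc x (1 : ℝ) : Fin (n + 1) → ℝ)) '' ball 0 1)
      (range f ∩ L.skeleton n)

end SimpleHomotopy

/-- Formal deformations between finite CW complexes: finite composites of elementary expansions,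
elementary collapses (retractions left inverse to an elementary expansion) and CW isomorphisms. -/
inductive IsFormalDeformation : ∀ {X Y : Type u} [TopologicalSpace X] [TopologicalSpace Y],
    FiniteCW X → FiniteCW Y → C(X, Y) → Prop
  | iso {X Y : Type u} [TopologicalSpace X] [TopologicalSpace Y]
      {K : FiniteCW X} {L : FiniteCW Y} {f : C(X, Y)} (hf : IsCWIso K L f) :
      IsFormalDeformation K L f
  | expansion {X Y : Type u} [TopologicalSpace X] [TopologicalSpace Y]
      {K : FiniteCW X} {L : FiniteCW Y} {f : C(X, Y)} (hf : IsElementaryExpansion K L f) :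
      IsFormalDeformation K L f
  | collapse {X Y : Type u} [TopologicalSpace X] [TopologicalSpace Y]
      {K : FiniteCW X} {L : FiniteCW Y} {f : C(X, Y)} (hf : IsElementaryExpansion K L f)
      {r : C(Y, X)} (hr : r.comp f = ContinuousMap.id X) :
      IsFormalDeformation L K r
  | comp {X Y Z : Type u} [TopologicalSpace X] [TopologicalSpace Y] [TopologicalSpace Z]
      {K : FiniteCW X} {L : FiniteCW Y} {M : FiniteCW Z} {f : C(X, Y)} {g : C(Y, Z)}
      (hf : IsFormalDeformation K L f) (hg : IsFormalDeformation L M g) :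
      IsFormalDeformation K M (g.comp f)

/-- A simple homotopy equivalence of finite CW complexes is a map that is homotopic to a formal
deformation. -/
def IsSimpleHomotopyEquiv {X Y : Type u} [TopologicalSpace X] [TopologicalSpace Y]
    (K : FiniteCW X) (L : FiniteCW Y) (f : C(X, Y)) : Prop :=
  ∃ g : C(X, Y), IsFormalDeformation K L g ∧ f.Homotopic g

/-- A homotopy equivalence of spaces. -/
def IsHomotopyEquiv {X Y : Type u} [TopologicalSpace X] [TopologicalSpace Y] (f : C(X, Y)) : Prop :=
  ∃ e : ContinuousMap.HomotopyEquiv X Y, e.toFun = f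

/-! ### `F_μ`-covers, fundamental domains -/

/-- An `F_μ`-cover `proj : E → W` of a space `W`: a regular covering with the free group `F_μ` as
group of covering translations, that is, a covering with an action of `F_μ` by homeomorphisms of `E`
that is free and transitive on the fibres. -/
structure FCover (μ : ℕ) (W : Type u) [TopologicalSpace W] where
  E : Type u
  [top : TopologicalSpace E]
  [act : MulAction (FreeGroup (Fin μ)) E]
  proj : E → W
  isCover : IsQuotientCoveringMap proj (FreeGroup (Fin μ))

attribute [instance] FCover.top FCover.act

namespace FCover

variable {μ : ℕ} {W : Type u} [TopologicalSpace W] (P : FCover μ W)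

lemma continuous_smul (g : FreeGroup (Fin μ)) : Continuous (fun x : P.E ↦ g • x) :=
  P.isCover.toContinuousConstSMul.continuous_const_smul g

lemma continuous_proj : Continuous P.proj := P.isCover.isCoveringMap.continuous

lemma proj_smul (g : FreeGroup (Fin μ)) (x : P.E) : P.proj (g • x) = P.proj x :=
  P.isCover.map_smul g

/-- The underlying space of the pullback of an `F_μ`-cover along `h : X → W`. -/
def PullbackE {X : Type u} [TopologicalSpace X] (h : C(X, W)) : Type u :=
  {q : X × P.E // h q.1 = P.proj q.2}

instance {X : Type u} [TopologicalSpace X] (h : C(X, W)) : TopologicalSpace (P.PullbackE h) :=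
  inferInstanceAs (TopologicalSpace {q : X × P.E // h q.1 = P.proj q.2})

instance {X : Type u} [TopologicalSpace X] (h : C(X, W)) :
    MulAction (FreeGroup (Fin μ)) (P.PullbackE h) where
  smul g q := ⟨(q.1.1, g • q.1.2), by rw [P.proj_smul]; exact q.2⟩
  one_smul q := Subtype.ext (Prod.ext rfl (one_smul _ _))
  mul_smul g k q := Subtype.ext (Prod.ext rfl (mul_smul g k _))

lemma isQuotientCoveringMap_pullback {X : Type u} [TopologicalSpace X] (h : C(X, W)) :
    IsQuotientCoveringMap (fun q : P.PullbackE h ↦ q.1.1) (FreeGroup (Fin μ)) := by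
  have hc : Continuous (fun q : P.PullbackE h ↦ q.1.1) :=
    continuous_fst.comp continuous_subtype_val
  have hs : Function.Surjective (fun q : P.PullbackE h ↦ q.1.1) := fun x ↦ by
    obtain ⟨e, he⟩ := P.isCover.surjective (h x)
    exact ⟨⟨(x, e), he.symm⟩, rfl⟩
  have ho : IsOpenMap (fun q : P.PullbackE h ↦ q.1.1) := by
    rintro _ ⟨O, hO, rfl⟩
    rw [isOpen_iff_mem_nhds]
    rintro _ ⟨⟨⟨x, e⟩, hxe⟩, hq, rfl⟩
    obtain ⟨A, B, hA, hB, hxA, heB, hAB⟩ := isOpen_prod_iff.1 hO x e hq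
    have hB' := P.isCover.isOpenQuotientMap.isOpenMap B hB
    refine Filter.mem_of_superset
      ((hA.inter (hB'.preimage h.continuous)).mem_nhds ⟨hxA, ⟨e, heB, hxe.symm⟩⟩) ?_
    rintro y ⟨hyA, e', heB', hye⟩
    exact ⟨⟨(y, e'), hye.symm⟩, hAB ⟨hyA, heB'⟩, rfl⟩
  exact
    { toIsQuotientMap := ho.isQuotientMap hc hs
      continuous_const_smul := fun g ↦
        ((continuous_fst.comp continuous_subtype_val).prodMk
          ((P.continuous_smul g).comp (continuous_snd.comp continuous_subtype_val))).subtype_mk _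
      apply_eq_iff_mem_orbit := by
        rintro ⟨⟨x, e⟩, hq⟩ ⟨⟨x', e'⟩, hq'⟩
        constructor
        · intro hxx
          obtain rfl : x = x' := hxx
          obtain ⟨g, hg⟩ := P.isCover.apply_eq_iff_mem_orbit.1 (hq.symm.trans hq')
          exact ⟨g, Subtype.ext (Prod.ext rfl hg)⟩
        · rintro ⟨g, hg⟩
          exact (congrArg (fun q : P.PullbackE h ↦ q.1.1) hg).symm
      disjoint := by
        rintro ⟨⟨x, e⟩, hq⟩
        obtain ⟨U, hU, hd⟩ := P.isCover.disjoint e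
        refine ⟨(fun q : P.PullbackE h ↦ q.1.2) ⁻¹' U,
          (continuous_snd.comp continuous_subtype_val).continuousAt.preimage_mem_nhds hU, ?_⟩
        rintro g ⟨_, ⟨q, hqU, rfl⟩, hq'⟩
        exact hd g ⟨g • q.1.2, ⟨q.1.2, hqU, rfl⟩, hq'⟩ }

/-- The pullback `h^* E = {(x, e) | h x = proj e} → X` of an `F_μ`-cover along `h : X → W`. -/
def pullback {X : Type u} [TopologicalSpace X] (h : C(X, W)) : FCover μ X where
  E := P.PullbackE h
  proj q := q.1.1
  isCover := P.isQuotientCoveringMap_pullback h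

/-- A fundamental domain of an `F_μ`-cover: a closed subset `U` whose translates cover `E`, such that
`gU ∩ kU` is `gV_i` if `g = k z_i`, `kV_i` if `g = k z_i⁻¹`, and empty if `g` is none of
`k`, `k z_i`, `k z_i⁻¹`, where `V_i = U ∩ z_i⁻¹ U`. -/
structure IsFundamentalDomain (U : Set P.E) : Prop where
  isClosed : IsClosed U
  cover : ⋃ g : FreeGroup (Fin μ), g • U = univ
  inter_right : ∀ (g k : FreeGroup (Fin μ)) (i : Fin μ), g = k * FreeGroup.of i →
    g • U ∩ k • U = g • (U ∩ (FreeGroup.of i)⁻¹ • U)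
  inter_left : ∀ (g k : FreeGroup (Fin μ)) (i : Fin μ), g = k * (FreeGroup.of i)⁻¹ →
    g • U ∩ k • U = k • (U ∩ (FreeGroup.of i)⁻¹ • U)
  inter_empty : ∀ g k : FreeGroup (Fin μ), g ≠ k →
    (∀ i, g ≠ k * FreeGroup.of i) → (∀ i, g ≠ k * (FreeGroup.of i)⁻¹) → g • U ∩ k • U = ∅

/-- A cell of the total space of an `F_μ`-cover of a finite CW complex: a lift `map` of the
characteristic map of a cell of the base. These are the cells of the CW structure lifted to `E`. -/
structure LiftedCell (K : FiniteCW W) where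
  n : ℕ
  i : K.cell n
  map : C(closedBall (0 : Fin n → ℝ) 1, P.E)
  proj_map : ∀ x, P.proj (map x) = K.charMap i x

/-- The open cell of a lifted cell. -/
def LiftedCell.openCell {P : FCover μ W} {K : FiniteCW W} (c : P.LiftedCell K) : Set P.E :=
  c.map '' {x | (x : Fin c.n → ℝ) ∈ ball 0 1}

/-- The closed cell of a lifted cell. -/
def LiftedCell.closedCell {P : FCover μ W} {K : FiniteCW W} (c : P.LiftedCell K) : Set P.E :=
  range c.map

/-- A finite subcomplex of the total space of an `F_μ`-cover of a finite CW complex, for the lifted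
CW structure: a finite union of open cells that contains the corresponding closed cells. -/
def IsFiniteSubcomplex (K : FiniteCW W) (V : Set P.E) : Prop :=
  ∃ S : Set (P.LiftedCell K), S.Finite ∧ V = (⋃ c ∈ S, c.openCell) ∧ V = (⋃ c ∈ S, c.closedCell)

end FCover

/-! ### `F_μ`-splittings -/

/-- The data of a decomposition `X = Y × [-1, 1] ∪_{Y × {-1, 1}} Z` with `Y = Y_1 ⊔ ... ⊔ Y_μ`:
spaces `Y_i` and `Z`, and maps `α_i⁻, α_i⁺ : Y_i → Z`, along which `Y_i × {-1}` and `Y_i × {1}`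
are attached. -/
structure FSplitting (μ : ℕ) where
  Y : Fin μ → Type u
  Z : Type u
  [topY : ∀ i, TopologicalSpace (Y i)]
  [topZ : TopologicalSpace Z]
  αminus : ∀ i, C(Y i, Z)
  αplus : ∀ i, C(Y i, Z)

attribute [instance] FSplitting.topY FSplitting.topZ

namespace FSplitting

variable {μ : ℕ} (S : FSplitting.{u} μ)

/-- The disjoint union of `Y × [-1, 1]` and `Z`. -/
abbrev Pre : Type u := ((Σ i, S.Y i) × Icc (-1 : ℝ) 1) ⊕ S.Z

/-- The relation `(y, -1) ∼ α_i⁻(y)`, `(y, 1) ∼ α_i⁺(y)` for `y ∈ Y_i`. -/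
inductive Rel : S.Pre → S.Pre → Prop
  | minus (i : Fin μ) (y : S.Y i) :
      Rel (Sum.inl (⟨i, y⟩, ⟨-1, by norm_num⟩)) (Sum.inr (S.αminus i y))
  | plus (i : Fin μ) (y : S.Y i) :
      Rel (Sum.inl (⟨i, y⟩, ⟨1, by norm_num⟩)) (Sum.inr (S.αplus i y))

/-- The space `X = Y × [-1, 1] ∪_{Y × {-1, 1}} Z`, with the quotient topology. -/
def X : Type u := Quot S.Rel

instance : TopologicalSpace S.X := inferInstanceAs (TopologicalSpace (Quot S.Rel))

/-- The point of `X` given by `(y, t) ∈ Y_i × [-1, 1]`. -/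
def tube (i : Fin μ) (y : S.Y i) (t : Icc (-1 : ℝ) 1) : S.X := Quot.mk _ (Sum.inl (⟨i, y⟩, t))

/-- The map `Z → X`. -/
def base (z : S.Z) : S.X := Quot.mk _ (Sum.inr z)

/-- `Y_i = Y_i × {0}` as a subset of `X`. -/
def YSet (i : Fin μ) : Set S.X := range fun y ↦ S.tube i y ⟨0, by norm_num⟩

/-- `Z` as a subset of `X`. -/
def ZSet : Set S.X := range S.base

/-- The map out of `X` determined by compatible maps on `Y × [-1, 1]` and on `Z`. -/
def desc {T : Type u} [TopologicalSpace T] (f : C((Σ i, S.Y i) × Icc (-1 : ℝ) 1, T)) (k : C(S.Z, T))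
    (hm : ∀ i y, f (⟨i, y⟩, ⟨-1, by norm_num⟩) = k (S.αminus i y))
    (hp : ∀ i y, f (⟨i, y⟩, ⟨1, by norm_num⟩) = k (S.αplus i y)) : C(S.X, T) where
  toFun := Quot.lift (Sum.elim f k) (by
    rintro _ _ (⟨i, y⟩ | ⟨i, y⟩)
    · exact hm i y
    · exact hp i y)
  continuous_toFun := continuous_quot_lift _ (f.continuous.sumElim k.continuous)

/-- `(X, Y, Z, h)` is a homotopy `F_μ`-splitting of `W`. -/
def IsHomotopySplitting {W : Type u} [TopologicalSpace W] (h : C(S.X, W)) : Prop :=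
  IsHomotopyEquiv h

/-- `(X, Y, Z, h)`, with the given finite CW structure `K` on `X`, is a simple homotopy
`F_μ`-splitting of the finite CW complex `W`. -/
structure IsSimpleHomotopySplitting {W : Type u} [TopologicalSpace W] (L : FiniteCW W)
    (K : FiniteCW S.X) (h : C(S.X, W)) : Prop where
  isHomotopySplitting : S.IsHomotopySplitting h
  Y_subcomplex : ∀ i, K.IsSubcomplex (S.YSet i)
  Z_subcomplex : K.IsSubcomplex S.ZSet
  simple : IsSimpleHomotopyEquiv K L h

end FSplitting

/-- `I_μ ⊆ ℝ^μ`, the union of the segments from `e_i⁻ = -e_i` to `e_i⁺ = e_i`. -/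
abbrev Imu (μ : ℕ) : Type :=
  {x : Fin μ → ℝ // ∃ i, x ∈ segment ℝ (-Pi.single i (1 : ℝ)) (Pi.single i (1 : ℝ))}

/-- The end point `e_i⁺` of `I_μ`. -/
def ePlus {μ : ℕ} (i : Fin μ) : Imu μ := ⟨Pi.single i 1, i, right_mem_segment _ _ _⟩

/-- The end point `e_i⁻` of `I_μ`. -/
def eMinus {μ : ℕ} (i : Fin μ) : Imu μ := ⟨-Pi.single i 1, i, left_mem_segment _ _ _⟩

namespace FCover

variable {μ : ℕ} {W : Type u} [TopologicalSpace W] (P : FCover μ W)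

/-- The canonical splitting data `Y(∞)_i = E`, `Z(∞) = E × I_μ`, `α(∞)_i⁺ x = (z_i x, e_i⁺)`,
`α(∞)_i⁻ x = (x, e_i⁻)`; the resulting space `X(∞)` is a model of the Borel construction
`E ×_{F_μ} G_μ` with the Cayley tree `G_μ` of `F_μ`. -/
def canonical : FSplitting.{u} μ where
  Y _ := P.E
  Z := P.E × Imu μ
  αminus i := ⟨fun x ↦ (x, eMinus i), continuous_id.prodMk continuous_const⟩
  αplus i := ⟨fun x ↦ (FreeGroup.of i • x, ePlus i),
    (P.continuous_smul _).prodMk continuous_const⟩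

/-- The map `h(∞) : X(∞) → W`, `(x, t) ↦ proj x`. -/
def canonicalMap : C(P.canonical.X, W) :=
  P.canonical.desc
    ⟨fun q ↦ P.proj q.1.2, P.continuous_proj.comp
      ((continuous_sigma fun _ ↦ continuous_id : Continuous fun s : (Σ _ : Fin μ, P.E) ↦ s.2).comp
        continuous_fst)⟩
    ⟨fun z ↦ P.proj z.1, P.continuous_proj.comp continuous_fst⟩
    (fun _ _ ↦ rfl) (fun _ _ ↦ (P.proj_smul _ _).symm)

variable (V : Set P.E)

/-- `Y(V)_i = V ∩ z_i⁻¹ V`. -/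
def ySet (i : Fin μ) : Set P.E := V ∩ (FreeGroup.of i)⁻¹ • V

variable {P} {V} in
lemma mem_of_ySet {i : Fin μ} (x : P.ySet V i) : FreeGroup.of i • (x : P.E) ∈ V :=
  mem_inv_smul_set_iff.1 x.2.2

/-- The splitting data `Y(V)_i = V ∩ z_i⁻¹ V`, `Z(V) = V × I_μ`, `α(V)_i⁺ x = (z_i x, e_i⁺)`,
`α(V)_i⁻ x = (x, e_i⁻)` of a subspace `V` of `E`. -/
def splitting : FSplitting.{u} μ where
  Y i := P.ySet V i
  Z := V × Imu μ
  αminus i := ⟨fun x ↦ (⟨x, x.2.1⟩, eMinus i),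
    (continuous_subtype_val.subtype_mk _).prodMk continuous_const⟩
  αplus i := ⟨fun x ↦ (⟨FreeGroup.of i • (x : P.E), mem_of_ySet x⟩, ePlus i),
    (((P.continuous_smul _).comp continuous_subtype_val).subtype_mk _).prodMk continuous_const⟩

/-- The inclusion `X(V) → X(∞)`. -/
def incl : C((P.splitting V).X, P.canonical.X) :=
  (P.splitting V).desc
    ⟨fun q ↦ P.canonical.tube q.1.1 q.1.2.1 q.2,
      continuous_quot_mk.comp (continuous_inl.comp
        (((continuous_sigma fun _ ↦ continuous_sigmaMk.comp continuous_subtype_val :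
          Continuous fun s : (Σ i, P.ySet V i) ↦ (⟨s.1, s.2.1⟩ : Σ _ : Fin μ, P.E)).comp
            continuous_fst).prodMk continuous_snd))⟩
    ⟨fun z ↦ P.canonical.base (z.1, z.2),
      continuous_quot_mk.comp (continuous_inr.comp
        ((continuous_subtype_val.comp continuous_fst).prodMk continuous_snd))⟩
    (fun i y ↦ Quot.sound (FSplitting.Rel.minus (S := P.canonical) i (y : P.ySet V i).1))
    (fun i y ↦ Quot.sound (FSplitting.Rel.plus (S := P.canonical) i (y : P.ySet V i).1))

/-- The map `h(V) : X(V) → W`, the restriction of `h(∞)` to `X(V)`. -/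
def splittingMap : C((P.splitting V).X, W) := P.canonicalMap.comp (P.incl V)

end FCover

-- Over an open cell `c` of `W` the space `X(V)` is a product `c × T`, where `T` is a subdivided
-- piece of the Cayley tree of `F_μ`: the cells `(c, g)` of `V` give stars, and the tubes join the
-- star at `g` to the star at `z_i g`. Everything rests on choosing `V` so that these pieces are
-- finite trees, and on contracting them coherently.
--
-- Choice of `V`. Lifted cells are pairs `(c, g)`. `V` consists of the pairs with `norm g ≤ R c`.
-- Only finitely many translates of compact cells meet (`finite_setOf_smul_mem`), so passing to a
-- face changes the norm by at most some `N`. If `R c` grows by `N` whenever the dimension of `c`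
-- drops, `V` is a subcomplex (`exists_isBound`). Its tree over `c` is the ball of radius `R c` with
-- every edge cut into four, with free tips where the neighbour lies outside the ball.
--
-- Simplicity of `h(V)`. The mapping cylinder of a cellular map expands from its codomain
-- (`isFormalInclusion_cylinderInr`). It also expands from its domain when all fibres over open
-- cells are trees (`isFormalInclusion_cylinderInl`): a cell `d` of `W` is matched with the cylinder
-- on the root over `d`, and each tree edge is matched with its end farther from the root. Both
-- expansions are instances of `isFormalPair_of_matching`. Hence `h(V)` is homotopic to an expansion
-- followed by a collapse (`isSimpleHomotopyEquiv_of_cylinder`). The matching of edges with far ends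
-- comes from reduced words: every `g ≠ 1` has exactly one direction that shortens it. That a formal
-- deformation is a homotopy equivalence follows from `IsElementaryExpansion.exists_retraction`.
--
-- Fundamental domain. `Z(V) = V × I_μ` lifts by its projection to `V`, and each half of a tube is
-- lifted so as to continue the lift of the end at which it is attached. The two lifts of the middle
-- of a tube differ by `z_i`, so distinct translates meet only for neighbours. Subdividing the tubes
-- at `0` makes this set a subcomplex.
--
-- The map `h(∞)`. Its fibres are whole trees, and they are contracted by fibre-preserving maps
-- homotopic to the identity. First the stars shrink to their centres. Then, over an evenly covered
-- open set, every point slides along the geodesic to the vertex on one chosen sheet, damped by a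
-- bump function (`exists_mem_nhds_collapses`). Compactness of `W` lets finitely many such maps be
-- composed to one that is constant on all fibres. It factors through `h(∞)` and gives a homotopy
-- inverse that is a section (`isHomotopyEquiv_of_collapses`).

universe v

/-! ### Cubes -/

section Cube

variable {n : ℕ}

lemma mem_ball_cube {x : Fin n → ℝ} : x ∈ ball (0 : Fin n → ℝ) 1 ↔ ∀ k, |x k| < 1 := by
  rw [mem_ball_zero_iff, pi_norm_lt_iff one_pos]; rfl

lemma mem_closedBall_cube {x : Fin n → ℝ} :
    x ∈ closedBall (0 : Fin n → ℝ) 1 ↔ ∀ k, |x k| ≤ 1 := by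
  rw [mem_closedBall_zero_iff, pi_norm_le_iff_of_nonneg zero_le_one]; rfl

lemma mem_sphere_cube {x : Fin n → ℝ} :
    x ∈ sphere (0 : Fin n → ℝ) 1 ↔ x ∈ closedBall 0 1 ∧ x ∉ ball 0 1 := by
  simp only [mem_sphere_zero_iff_norm, mem_closedBall_zero_iff, mem_ball_zero_iff, not_lt]
  exact ⟨fun h ↦ ⟨h.le, h.ge⟩, fun h ↦ le_antisymm h.1 h.2⟩

/-- The retraction of `ℝⁿ` onto the cube `[-1, 1]ⁿ`. -/
def cubeClamp (n : ℕ) : C(Fin n → ℝ, Fin n → ℝ) where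
  toFun x k := max (-1) (min 1 (x k))
  continuous_toFun := by fun_prop

lemma cubeClamp_mem (x : Fin n → ℝ) : cubeClamp n x ∈ closedBall (0 : Fin n → ℝ) 1 := by
  rw [mem_closedBall_cube]
  intro k
  rw [abs_le]
  exact ⟨le_max_left _ _, max_le (by norm_num) (min_le_left _ _)⟩

lemma cubeClamp_of_mem {x : Fin n → ℝ} (hx : x ∈ closedBall (0 : Fin n → ℝ) 1) :
    cubeClamp n x = x := by
  rw [mem_closedBall_cube] at hx
  funext k
  have := abs_le.1 (hx k)
  simp [cubeClamp, this.1, this.2]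

end Cube

/-! ### Cell structures -/

/-- A decomposition of a space into open cells, given by characteristic maps such that the boundary
of every cell lies in the union of the open cells of lower dimension. -/
structure CellStructure (X : Type u) [TopologicalSpace X] where
  ι : Type u
  dim : ι → ℕ
  map : ∀ i, C(Fin (dim i) → ℝ, X)
  injOn : ∀ i, InjOn (map i) (ball 0 1)
  eq_of_mem : ∀ {i j p}, p ∈ map i '' ball 0 1 → p ∈ map j '' ball 0 1 → i = j
  cover : ∀ p, ∃ i, p ∈ map i '' ball 0 1
  boundary : ∀ i, ∀ x ∈ sphere (0 : Fin (dim i) → ℝ) 1, ∃ j, dim j < dim i ∧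
    map i x ∈ map j '' ball 0 1

namespace CellStructure

variable {X : Type u} [TopologicalSpace X] (C : CellStructure X)

/-- The open cell with index `i`. -/
def openCell (i : C.ι) : Set X := C.map i '' ball 0 1

/-- The closed cell with index `i`. -/
def closedCell (i : C.ι) : Set X := C.map i '' closedBall 0 1

lemma openCell_subset_closedCell (i : C.ι) : C.openCell i ⊆ C.closedCell i :=
  image_mono ball_subset_closedBall

lemma map_mem_openCell {i : C.ι} {x : Fin (C.dim i) → ℝ} (hx : x ∈ ball 0 1) :
    C.map i x ∈ C.openCell i := mem_image_of_mem _ hx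

lemma eq_of_mem_openCell {i j : C.ι} {p : X} (hi : p ∈ C.openCell i) (hj : p ∈ C.openCell j) :
    i = j := C.eq_of_mem hi hj

lemma exists_mem_openCell (p : X) : ∃ i, p ∈ C.openCell i := C.cover p

lemma exists_openCell_of_mem_closedBall (i : C.ι) {x : Fin (C.dim i) → ℝ}
    (hx : x ∈ closedBall 0 1) : ∃ j, C.dim j ≤ C.dim i ∧ C.map i x ∈ C.openCell j := by
  by_cases hx' : x ∈ ball 0 1
  · exact ⟨i, le_rfl, C.map_mem_openCell hx'⟩
  · obtain ⟨j, hj, h⟩ := C.boundary i x (mem_sphere_cube.2 ⟨hx, hx'⟩)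
    exact ⟨j, hj.le, h⟩

lemma isCompact_closedCell (i : C.ι) : IsCompact (C.closedCell i) :=
  (isCompact_closedBall _ _).image (C.map i).continuous

lemma closedCell_subset_closure (i : C.ι) : C.closedCell i ⊆ closure (C.openCell i) := by
  rw [closedCell, ← closure_ball (0 : Fin (C.dim i) → ℝ) one_ne_zero]
  exact image_closure_subset_closure_image (C.map i).continuous

lemma map_not_mem_openCell_of_mem_sphere {i : C.ι} {x : Fin (C.dim i) → ℝ}
    (hx : x ∈ sphere 0 1) : C.map i x ∉ C.openCell i := by
  intro h
  obtain ⟨j, hj, h'⟩ := C.boundary i x hx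
  obtain rfl := C.eq_of_mem_openCell h h'
  exact lt_irrefl _ hj

lemma compactSpace [Finite C.ι] : CompactSpace X := by
  refine ⟨?_⟩
  have : (univ : Set X) = ⋃ i, C.closedCell i := by
    refine (eq_univ_of_forall fun p ↦ ?_).symm
    obtain ⟨i, hi⟩ := C.exists_mem_openCell p
    exact mem_iUnion.2 ⟨i, C.openCell_subset_closedCell i hi⟩
  rw [this]
  exact isCompact_iUnion fun i ↦ C.isCompact_closedCell i

section ToFiniteCW

/-- The characteristic map of a cell of dimension `n`. -/
def mapOfDim (n : ℕ) (i : {i // C.dim i = n}) (x : Fin n → ℝ) : X :=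
  C.map i.1 fun k ↦ x (Fin.cast i.2 k)

/-- The characteristic map carries closed subsets of the closed cube to compact, hence closed, sets.
Boundary points of the cube never land in the open cell, so the trace of such an image on the open
cell is the preimage under the inverse. -/
lemma continuousOn_invFunOn_map [T2Space X] (i : C.ι) :
    ContinuousOn (Function.invFunOn (C.map i) (ball 0 1)) (C.map i '' ball 0 1) := by
  set B : Set (Fin (C.dim i) → ℝ) := ball 0 1
  set g := Function.invFunOn (C.map i) B
  have hg : ∀ x ∈ B, g (C.map i x) = x := fun x hx ↦
    (C.injOn i).leftInvOn_invFunOn hx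
  rw [continuousOn_iff_isClosed]
  intro t ht
  refine ⟨C.map i '' (t ∩ closedBall 0 1),
    (((isCompact_closedBall _ _).inter_left ht).image (C.map i).continuous).isClosed, ?_⟩
  ext p
  constructor
  · rintro ⟨hp, x, hx, rfl⟩
    refine ⟨⟨x, ⟨?_, ball_subset_closedBall hx⟩, rfl⟩, x, hx, rfl⟩
    simpa [hg x hx] using hp
  · rintro ⟨⟨x, ⟨hxt, hx⟩, rfl⟩, hp⟩
    have hxB : x ∈ B := by
      by_contra hxB
      exact C.map_not_mem_openCell_of_mem_sphere (mem_sphere_cube.2 ⟨hx, hxB⟩) hp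
    exact ⟨by simpa [hg x hxB] using hxt, hp⟩

/-- The finite CW complex given by a finite cell structure on a Hausdorff space. -/
noncomputable def toFiniteCW [T2Space X] [Finite C.ι] : FiniteCW X := by
  have finite_cell : ∀ n : ℕ, Finite {i // C.dim i = n} := fun n ↦ inferInstance
  have eventually_isEmpty : ∀ᶠ n in Filter.atTop, IsEmpty {i // C.dim i = n} := by
    obtain ⟨N, hN⟩ := (finite_range C.dim).bddAbove
    filter_upwards [Filter.eventually_gt_atTop N] with n hn
    exact ⟨fun i ↦ (hn.trans_le (i.2 ▸ hN (mem_range_self i.1))).false⟩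
  have bij : ∀ (n : ℕ) (i : {i // C.dim i = n}),
      BijOn (C.mapOfDim n i) (ball 0 1) (C.mapOfDim n i '' ball 0 1) := by
    rintro n ⟨i, rfl⟩
    exact (C.injOn i).bijOn_image
  have cont : ∀ (n : ℕ) (i : {i // C.dim i = n}),
      ContinuousOn ((bij n i).toPartialEquiv) (closedBall 0 1) := by
    rintro n ⟨i, rfl⟩
    exact (C.map i).continuous.continuousOn
  have cont_symm : ∀ (n : ℕ) (i : {i // C.dim i = n}),
      ContinuousOn (bij n i).toPartialEquiv.symm (bij n i).toPartialEquiv.target := by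
    rintro n ⟨i, rfl⟩
    exact C.continuousOn_invFunOn_map i
  have disj : (univ : Set (Σ n, {i // C.dim i = n})).PairwiseDisjoint
      (fun ni ↦ (bij ni.1 ni.2).toPartialEquiv '' ball 0 1) := by
    rintro ⟨_, i, rfl⟩ - ⟨_, j, rfl⟩ - hij
    rw [Function.onFun, disjoint_left]
    intro p hi hj
    obtain rfl := C.eq_of_mem_openCell (p := p) hi hj
    exact hij rfl
  have mapsTo : ∀ (n : ℕ) (i : {i // C.dim i = n}),
      MapsTo ((bij n i).toPartialEquiv) (sphere 0 1)
        (⋃ (m < n) (j : {i // C.dim i = m}), (bij m j).toPartialEquiv '' closedBall 0 1) := by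
    rintro _ ⟨i, rfl⟩ x hx
    obtain ⟨j, hj, h⟩ := C.boundary i x hx
    simp only [mem_iUnion]
    exact ⟨_, hj, ⟨j, rfl⟩, C.openCell_subset_closedCell j h⟩
  have union' : ⋃ (n : ℕ) (j : {i // C.dim i = n}),
      (bij n j).toPartialEquiv '' closedBall 0 1 = univ := by
    refine eq_univ_of_forall fun p ↦ ?_
    obtain ⟨i, hi⟩ := C.exists_mem_openCell p
    simp only [mem_iUnion]
    exact ⟨_, ⟨i, rfl⟩, C.openCell_subset_closedCell i hi⟩
  exact
    { t2 := inferInstance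
      cw := CWComplex.mkFinite univ (fun n ↦ {i // C.dim i = n})
        (fun n i ↦ (bij n i).toPartialEquiv) eventually_isEmpty finite_cell (fun _ _ ↦ rfl)
        cont cont_symm disj mapsTo union'
      fin := CWComplex.finite_mkFinite univ (fun n ↦ {i // C.dim i = n})
        (fun n i ↦ (bij n i).toPartialEquiv) eventually_isEmpty finite_cell (fun _ _ ↦ rfl)
        cont cont_symm disj mapsTo union' }

end ToFiniteCW

end CellStructure

/-! ### From finite CW complexes to cell structures -/

namespace FiniteCW

variable {X : Type u} [TopologicalSpace X] (K : FiniteCW X)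

lemma mem_skeletonLT {n : ℕ} {p : X} :
    p ∈ K.skeletonLT n ↔ ∃ m < n, ∃ j : K.cell m, p ∈ K.openCell j := by
  let _ := K.cw
  have _ := K.t2
  have := CWComplex.mem_skeletonLT_iff (C := (univ : Set X)) (n := (n : ℕ∞)) (x := p)
  simp only [Nat.cast_lt, exists_prop] at this
  exact this

lemma mem_skeleton {n : ℕ} {p : X} :
    p ∈ K.skeleton n ↔ ∃ m ≤ n, ∃ j : K.cell m, p ∈ K.openCell j := by
  let _ := K.cw
  have _ := K.t2
  have := CWComplex.mem_skeleton_iff (C := (univ : Set X)) (n := (n : ℕ∞)) (x := p)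
  simp only [Nat.cast_le, exists_prop] at this
  exact this

lemma eq_of_mem_openCell {m n : ℕ} {i : K.cell m} {j : K.cell n} {p : X} (hi : p ∈ K.openCell i)
    (hj : p ∈ K.openCell j) : (⟨m, i⟩ : Σ n, K.cell n) = ⟨n, j⟩ := by
  let _ := K.cw
  by_contra h
  exact disjoint_left.1 (RelCWComplex.disjoint_openCell_of_ne h) hi hj

lemma exists_mem_openCell (p : X) : ∃ (n : ℕ) (i : K.cell n), p ∈ K.openCell i := by
  let _ := K.cw
  have h : p ∈ ⋃ (n : ℕ) (j : RelCWComplex.cell (univ : Set X) n), RelCWComplex.openCell n j :=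
    (CWComplex.iUnion_openCell_eq_complex (C := (univ : Set X))).symm ▸ mem_univ p
  simp only [mem_iUnion] at h
  exact h

lemma continuousOn_charMap {n : ℕ} (i : K.cell n) : ContinuousOn (K.charMap i) (closedBall 0 1) :=
  let _ := K.cw
  RelCWComplex.continuousOn (C := (univ : Set X)) n i

lemma injOn_charMap {n : ℕ} (i : K.cell n) : InjOn (K.charMap i) (ball 0 1) := by
  let _ := K.cw
  have h := (RelCWComplex.map (C := (univ : Set X)) n i).injOn
  rwa [show (RelCWComplex.map (C := (univ : Set X)) n i).source = ball 0 1 from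
    RelCWComplex.source_eq n i] at h

lemma mapsTo_charMap_sphere {n : ℕ} (i : K.cell n) :
    MapsTo (K.charMap i) (sphere 0 1) (K.skeletonLT n) := fun _ hx ↦
  let _ := K.cw
  have _ := K.t2
  RelCWComplex.cellFrontier_subset_skeletonLT (C := (univ : Set X)) n i (mem_image_of_mem _ hx)

/-- The characteristic map of a cell, extended continuously to `ℝⁿ`. -/
noncomputable def charMapExt {n : ℕ} (i : K.cell n) : C(Fin n → ℝ, X) :=
  ⟨K.charMap i ∘ cubeClamp n,
    (K.continuousOn_charMap i).comp_continuous (cubeClamp n).continuous cubeClamp_mem⟩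

lemma charMapExt_apply {n : ℕ} (i : K.cell n) {x : Fin n → ℝ} (hx : x ∈ closedBall 0 1) :
    K.charMapExt i x = K.charMap i x :=
  congrArg (K.charMap i) (cubeClamp_of_mem hx)

lemma charMapExt_image {n : ℕ} (i : K.cell n) : K.charMapExt i '' ball 0 1 = K.openCell i :=
  image_congr fun _ hx ↦ K.charMapExt_apply i (ball_subset_closedBall hx)

/-- The cell structure underlying a finite CW complex. -/
noncomputable abbrev toCells : CellStructure X where
  ι := Σ n, K.cell n
  dim := Sigma.fst
  map i := K.charMapExt i.2
  injOn i x hx y hy h := K.injOn_charMap i.2 hx hy <| by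
    rwa [K.charMapExt_apply i.2 (ball_subset_closedBall hx),
      K.charMapExt_apply i.2 (ball_subset_closedBall hy)] at h
  eq_of_mem := by
    rintro ⟨m, i⟩ ⟨n, j⟩ p hi hj
    rw [charMapExt_image] at hi hj
    exact K.eq_of_mem_openCell hi hj
  cover p := by
    obtain ⟨n, i, h⟩ := K.exists_mem_openCell p
    exact ⟨⟨n, i⟩, (K.charMapExt_image i).symm ▸ h⟩
  boundary := by
    rintro ⟨n, i⟩ x hx
    obtain ⟨m, hm, j, h⟩ := K.mem_skeletonLT.1 (K.mapsTo_charMap_sphere i hx)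
    refine ⟨⟨m, j⟩, hm, ?_⟩
    rw [charMapExt_image, K.charMapExt_apply i (sphere_subset_closedBall hx)]
    exact h

lemma toCells_openCell {n : ℕ} (i : K.cell n) : K.toCells.openCell ⟨n, i⟩ = K.openCell i :=
  K.charMapExt_image i

instance : Finite K.toCells.ι := by
  let _ := K.cw
  have _ := K.fin
  exact CWComplex.finite_cells_of_finite (C := (univ : Set X))

lemma compactSpace (K : FiniteCW X) : CompactSpace X := CellStructure.compactSpace K.toCells

lemma isSubcomplex_of_isClosed {A : Set X} (hA : IsClosed A)
    (h : ∀ n (i : K.cell n), ∀ p ∈ K.openCell i, p ∈ A → K.openCell i ⊆ A) : K.IsSubcomplex A := by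
  let _ := K.cw
  have _ := K.t2
  refine ⟨{ carrier := A, I := fun n ↦ {i | K.openCell i ⊆ A}, closed' := hA, union' := ?_ }, rfl⟩
  rw [empty_union]
  refine subset_antisymm (iUnion_subset fun n ↦ iUnion_subset fun i ↦ i.2) fun p hp ↦ ?_
  obtain ⟨⟨n, i⟩, hi⟩ := K.toCells.exists_mem_openCell p
  rw [toCells_openCell] at hi
  exact mem_iUnion₂.2 ⟨n, ⟨i, h n i p hi hp⟩, hi⟩

end FiniteCW

/-! ### Comparison with the given CW structure, and restriction to subcomplexes -/

namespace CellStructure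

variable {X : Type u} [TopologicalSpace X] (C : CellStructure X)

/-- Passing to cells and back changes index types and characteristic maps but not the open cells.
The given structure is therefore reached by an isomorphism rather than by an equality. -/
lemma isCWIso_toFiniteCW_toCells (K : FiniteCW X) [T2Space X] :
    IsCWIso K.toCells.toFiniteCW K (ContinuousMap.id X) where
  isHomeomorph := IsHomeomorph.id
  image_cell := by
    rintro _ ⟨⟨n, i⟩, rfl⟩
    exact ⟨i, by rw [ContinuousMap.coe_id, image_id]; exact (K.toCells_openCell i)⟩

/-- The restriction of a cell structure to a closed union of open cells. -/
abbrev restrict (A : Set X) (I : Set C.ι) (hA : ∀ p, p ∈ A ↔ ∃ i ∈ I, p ∈ C.openCell i)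
    (hI : ∀ i ∈ I, C.closedCell i ⊆ A) : CellStructure A where
  ι := I
  dim i := C.dim i
  -- Outside of the cube `C.map i` may leave `A`; clamping keeps the restricted map in `A` on all of
  -- `ℝⁿ`.
  map i := ⟨fun x ↦ ⟨C.map i (cubeClamp _ x), hI i i.2 ⟨_, cubeClamp_mem x, rfl⟩⟩, by fun_prop⟩
  injOn i x hx y hy h := by
    have := congrArg Subtype.val h
    simp only [ContinuousMap.coe_mk, cubeClamp_of_mem (ball_subset_closedBall hx),
      cubeClamp_of_mem (ball_subset_closedBall hy)] at this
    exact C.injOn i hx hy this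
  eq_of_mem := by
    rintro i j p ⟨x, hx, rfl⟩ ⟨y, hy, hxy⟩
    have := congrArg Subtype.val hxy
    simp only [ContinuousMap.coe_mk, cubeClamp_of_mem (ball_subset_closedBall hx),
      cubeClamp_of_mem (ball_subset_closedBall hy)] at this
    exact Subtype.ext (C.eq_of_mem_openCell (C.map_mem_openCell hx)
      (this ▸ C.map_mem_openCell hy))
  cover p := by
    obtain ⟨i, hi, x, hx, h⟩ := (hA p).1 p.2
    refine ⟨⟨i, hi⟩, x, hx, Subtype.ext ?_⟩
    simpa only [ContinuousMap.coe_mk, cubeClamp_of_mem (ball_subset_closedBall hx)] using h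
  boundary i x hx := by
    obtain ⟨j, hj, y, hy, h⟩ := C.boundary i x hx
    have hx' := sphere_subset_closedBall hx
    obtain ⟨k, hk, hk'⟩ := (hA _).1 (hI i i.2 ⟨x, hx', rfl⟩)
    obtain rfl := C.eq_of_mem_openCell hk' ⟨y, hy, h⟩
    refine ⟨⟨k, hk⟩, hj, y, hy, Subtype.ext ?_⟩
    simpa only [ContinuousMap.coe_mk, cubeClamp_of_mem (ball_subset_closedBall hy),
      cubeClamp_of_mem hx'] using h

lemma coe_image_openCell_restrict (A : Set X) (I : Set C.ι)
    (hA : ∀ p, p ∈ A ↔ ∃ i ∈ I, p ∈ C.openCell i) (hI : ∀ i ∈ I, C.closedCell i ⊆ A) (i : I) :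
    Subtype.val '' (C.restrict A I hA hI).openCell i = C.openCell i := by
  rw [openCell, openCell, image_image]
  exact image_congr fun x hx ↦ congrArg _ (cubeClamp_of_mem (ball_subset_closedBall hx))

end CellStructure

/-! ### Elementary expansions are homotopy equivalences -/

section PushCube

variable {n : ℕ}

lemma mem_closedBall_cube_succ {z : Fin (n + 1) → ℝ} :
    z ∈ closedBall (0 : Fin (n + 1) → ℝ) 1 ↔
      Fin.init z ∈ closedBall (0 : Fin n → ℝ) 1 ∧ |z (Fin.last n)| ≤ 1 := by
  simp only [mem_closedBall_cube, Fin.forall_fin_succ', Fin.init]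

lemma mem_ball_cube_succ {z : Fin (n + 1) → ℝ} :
    z ∈ ball (0 : Fin (n + 1) → ℝ) 1 ↔
      Fin.init z ∈ ball (0 : Fin n → ℝ) 1 ∧ |z (Fin.last n)| < 1 := by
  simp only [mem_ball_cube, Fin.forall_fin_succ', Fin.init]

/-- The open top face of the cube `[-1, 1]ⁿ⁺¹`. -/
def cubeTop (n : ℕ) : Set (Fin (n + 1) → ℝ) :=
  (fun x : Fin n → ℝ ↦ (Fin.snoc x (1 : ℝ) : Fin (n + 1) → ℝ)) '' ball 0 1

lemma snoc_mem_closedBall {x : Fin n → ℝ} {t : ℝ} :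
    (Fin.snoc x t : Fin (n + 1) → ℝ) ∈ closedBall (0 : Fin (n + 1) → ℝ) 1 ↔
      x ∈ closedBall (0 : Fin n → ℝ) 1 ∧ |t| ≤ 1 := by
  rw [mem_closedBall_cube_succ, Fin.init_snoc, Fin.snoc_last]

lemma snoc_mem_ball {x : Fin n → ℝ} {t : ℝ} :
    (Fin.snoc x t : Fin (n + 1) → ℝ) ∈ ball (0 : Fin (n + 1) → ℝ) 1 ↔
      x ∈ ball (0 : Fin n → ℝ) 1 ∧ |t| < 1 := by
  rw [mem_ball_cube_succ, Fin.init_snoc, Fin.snoc_last]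

lemma mem_cubeTop {z : Fin (n + 1) → ℝ} :
    z ∈ cubeTop n ↔ Fin.init z ∈ ball (0 : Fin n → ℝ) 1 ∧ z (Fin.last n) = 1 := by
  constructor
  · rintro ⟨x, hx, rfl⟩
    simpa using hx
  · rintro ⟨hx, h⟩
    exact ⟨Fin.init z, hx, by simp [← h]⟩

lemma mem_sphere_diff_cubeTop {z : Fin (n + 1) → ℝ} : z ∈ sphere 0 1 \ cubeTop n ↔
    Fin.init z ∈ closedBall (0 : Fin n → ℝ) 1 ∧ |z (Fin.last n)| ≤ 1 ∧
      (‖(Fin.init z : Fin n → ℝ)‖ = 1 ∨ z (Fin.last n) = -1) := by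
  rw [mem_sdiff, mem_sphere_cube, mem_closedBall_cube_succ, mem_ball_cube_succ, mem_cubeTop]
  simp only [mem_closedBall_zero_iff, mem_ball_zero_iff]
  constructor
  · rintro ⟨⟨⟨h1, h2⟩, h3⟩, h4⟩
    refine ⟨h1, h2, ?_⟩
    by_contra! h
    have h5 := lt_of_le_of_ne h1 h.1
    have h6 : |z (Fin.last n)| = 1 := le_antisymm h2 (not_lt.1 fun h6 ↦ h3 ⟨h5, h6⟩)
    rcases (abs_eq zero_le_one).1 h6 with h7 | h7
    · exact h4 ⟨h5, h7⟩
    · exact h.2 h7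
  · rintro ⟨h1, h2, h3 | h3⟩
    · exact ⟨⟨⟨h1, h2⟩, fun h ↦ h.1.ne h3⟩, fun h ↦ h.1.ne h3⟩
    · refine ⟨⟨⟨h1, h2⟩, fun h ↦ ?_⟩, fun h ↦ ?_⟩
      · rw [h3] at h; norm_num at h
      · rw [h3] at h; norm_num at h

/-- The scaling factor of the projection from the point `(0, 3)`. -/
noncomputable def pushScale (z : Fin (n + 1) → ℝ) : ℝ :=
  -- The ray from `(0, 3)` through `z` meets the bottom `-1`, at vertical distance `4`, for the
  -- scale `(3 - z_last) / 4`, and the side faces for the scale `‖init z‖`. The maximum selects the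
  -- first exit.
  max ((3 - z (Fin.last n)) / 4) ‖(Fin.init z : Fin n → ℝ)‖

/-- The retraction of the cube `[-1, 1]ⁿ⁺¹` onto the union of all faces but the top one, given by
projection from the point `(0, 3)`. -/
noncomputable def pushCube (z : Fin (n + 1) → ℝ) : Fin (n + 1) → ℝ :=
  Fin.snoc ((pushScale z)⁻¹ • (Fin.init z : Fin n → ℝ))
    (3 - (pushScale z)⁻¹ * (3 - z (Fin.last n)))

lemma pushScale_pos {z : Fin (n + 1) → ℝ} (hz : z ∈ closedBall (0 : Fin (n + 1) → ℝ) 1) :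
    0 < pushScale z := by
  have := (abs_le.1 (mem_closedBall_cube_succ.1 hz).2).2
  exact lt_max_of_lt_left (by linarith)

lemma continuous_init : Continuous fun z : Fin (n + 1) → ℝ ↦ (Fin.init z : Fin n → ℝ) :=
  continuous_pi fun k ↦ continuous_apply k.castSucc

lemma continuousOn_pushCube :
    ContinuousOn (pushCube (n := n)) (closedBall 0 1) := by
  have h : ContinuousOn (fun z : Fin (n + 1) → ℝ ↦ (pushScale z)⁻¹) (closedBall 0 1) := by
    refine ContinuousOn.inv₀ (Continuous.continuousOn ?_) fun z hz ↦ (pushScale_pos hz).ne'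
    have := continuous_init (n := n)
    unfold pushScale
    fun_prop
  rw [continuousOn_pi]
  intro k
  refine Fin.lastCases ?_ (fun k ↦ ?_) k
  · simp only [pushCube, Fin.snoc_last]
    exact continuousOn_const.sub (h.mul (by fun_prop))
  · simp only [pushCube, Fin.snoc_castSucc, Pi.smul_apply, smul_eq_mul, Fin.init]
    exact h.mul (by fun_prop)

lemma pushCube_mem {z : Fin (n + 1) → ℝ} (hz : z ∈ closedBall (0 : Fin (n + 1) → ℝ) 1) :
    pushCube z ∈ sphere 0 1 \ cubeTop n := by
  have hm := pushScale_pos hz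
  obtain ⟨h1, h2⟩ := mem_closedBall_cube_succ.1 hz
  rw [mem_closedBall_zero_iff] at h1
  rw [abs_le] at h2
  have hl : (3 - z (Fin.last n)) / 4 ≤ pushScale z := le_max_left _ _
  have hr : ‖(Fin.init z : Fin n → ℝ)‖ ≤ pushScale z := le_max_right _ _
  have hm1 : pushScale z ≤ 1 := max_le (by linarith) h1
  rw [mem_sphere_diff_cubeTop]
  simp only [pushCube, Fin.init_snoc, Fin.snoc_last, mem_closedBall_zero_iff, norm_smul, norm_inv,
    Real.norm_of_nonneg hm.le]
  -- The bottom and the top of the cube lie at distances `4` and `2` below the height `3` of the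
  -- projection point, so these two bounds place the new height in `[-1, 1]`.
  have h4 : (pushScale z)⁻¹ * (3 - z (Fin.last n)) ≤ 4 := by
    rw [inv_mul_le_iff₀ hm]; linarith
  have h5 : 2 ≤ (pushScale z)⁻¹ * (3 - z (Fin.last n)) := by
    rw [le_inv_mul_iff₀ hm]; linarith
  refine ⟨?_, ?_, ?_⟩
  · rw [inv_mul_le_iff₀ hm]; linarith
  · rw [abs_le]; constructor <;> linarith
  · rcases max_choice ((3 - z (Fin.last n)) / 4) ‖(Fin.init z : Fin n → ℝ)‖ with h | h
    · right
      have : 3 - z (Fin.last n) = 4 * pushScale z := by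
        have : pushScale z = (3 - z (Fin.last n)) / 4 := h
        linarith
      rw [this]; field_simp; norm_num
    · left
      have : ‖(Fin.init z : Fin n → ℝ)‖ = pushScale z := h.symm
      rw [this]; exact inv_mul_cancel₀ hm.ne'

lemma pushCube_of_mem {z : Fin (n + 1) → ℝ} (hz : z ∈ sphere 0 1 \ cubeTop n) :
    pushCube z = z := by
  obtain ⟨h1, h2, h3⟩ := mem_sphere_diff_cubeTop.1 hz
  rw [mem_closedBall_zero_iff] at h1
  rw [abs_le] at h2
  have : pushScale z = 1 := by
    rcases h3 with h3 | h3
    · rw [pushScale, h3]; exact max_eq_right (by linarith)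
    · rw [pushScale, h3, max_eq_left] <;> linarith
  simp [pushCube, this]

end PushCube

section SimpleHomotopy

variable {X Y : Type u} [TopologicalSpace X] [TopologicalSpace Y]

open unitInterval in
-- `Y` is a quotient of `X ⊔ cube`, by `f` and `φ`. The straight homotopy of the cube from the
-- identity to `pushCube` fixes every point that `φ` sends into the image of `f`, and elsewhere `φ`
-- is injective. So, with the constant homotopy on `X`, it descends to a deformation of `Y` into the
-- image of `f`.
theorem IsElementaryExpansion.exists_retraction {K : FiniteCW X} {L : FiniteCW Y} {f : C(X, Y)}
    (hf : IsElementaryExpansion K L f) : ∃ r : C(Y, X), r.comp f = ContinuousMap.id X ∧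
      (ContinuousMap.id Y).Homotopic (f.comp r) := by
  have := K.compactSpace
  have := L.t2
  obtain ⟨n, a, b, φ, hab, hb, ha, hφ⟩ := hf.exists_cells
  change MapsTo φ (sphere 0 1 \ cubeTop n) _ at hφ
  have hbr : ∀ z ∈ ball (0 : Fin (n + 1) → ℝ) 1, φ z ∈ L.openCell b := fun z hz ↦
    hb.image_ball ▸ mem_image_of_mem _ hz
  have har : ∀ z ∈ cubeTop n, φ z ∈ L.openCell a := by
    rintro _ ⟨x, hx, rfl⟩
    exact ha.image_ball ▸ mem_image_of_mem _ hx
  have hdisj : ∀ p, p ∈ L.openCell a → p ∈ L.openCell b → False := fun p hpa hpb ↦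
    absurd (congrArg Sigma.fst (L.eq_of_mem_openCell hpa hpb)) (by simp)
  have hrange : ∀ z ∈ closedBall (0 : Fin (n + 1) → ℝ) 1, φ z ∈ range f →
      z ∈ sphere 0 1 \ cubeTop n := by
    intro z hz hzf
    refine ⟨mem_sphere_cube.2 ⟨hz, fun h ↦ ?_⟩, fun h ↦ ?_⟩
    · exact (hab.symm ▸ Or.inr (hbr z h) : φ z ∈ (range f)ᶜ) hzf
    · exact (hab.symm ▸ Or.inl (har z h) : φ z ∈ (range f)ᶜ) hzf
  have hinj : ∀ z ∈ closedBall (0 : Fin (n + 1) → ℝ) 1, ∀ z' ∈ closedBall (0 : Fin (n + 1) → ℝ) 1,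
      φ z = φ z' → φ z ∉ range f → z = z' := by
    intro z hz z' hz' h hzf
    have key : ∀ w ∈ closedBall (0 : Fin (n + 1) → ℝ) 1, φ w ∉ range f →
        w ∈ ball 0 1 ∨ w ∈ cubeTop n := by
      intro w hw hwf
      by_contra! hw'
      exact hwf (hφ ⟨mem_sphere_cube.2 ⟨hw, hw'.1⟩, hw'.2⟩).1
    rcases key z hz hzf with h1 | h1 <;> rcases key z' hz' (h ▸ hzf) with h2 | h2
    · exact hb.injOn h1 h2 h
    · exact (hdisj _ (har _ h2) (h ▸ hbr _ h1)).elim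
    · exact (hdisj _ (har _ h1) (h ▸ hbr _ h2)).elim
    · obtain ⟨x, hx, rfl⟩ := h1
      obtain ⟨y, hy, rfl⟩ := h2
      rw [ha.injOn hx hy h]
  let B := closedBall (0 : Fin (n + 1) → ℝ) 1
  let q : C(X ⊕ B, Y) := ⟨Sum.elim f (fun z ↦ φ z),
    f.continuous.sumElim (continuousOn_iff_continuous_domRestrict.1 hb.continuousOn)⟩
  have hqs : Function.Surjective q := by
    intro y
    by_cases hy : y ∈ range f
    · obtain ⟨x, rfl⟩ := hy
      exact ⟨Sum.inl x, rfl⟩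
    · have : y ∈ (range f)ᶜ := hy
      rw [hab] at this
      rcases this with h | h
      · rw [← ha.image_ball] at h
        obtain ⟨x, hx, rfl⟩ := h
        exact ⟨Sum.inr ⟨Fin.snoc x 1, snoc_mem_closedBall.2
          ⟨ball_subset_closedBall hx, by simp⟩⟩, rfl⟩
      · rw [← hb.image_ball] at h
        obtain ⟨z, hz, rfl⟩ := h
        exact ⟨Sum.inr ⟨z, ball_subset_closedBall hz⟩, rfl⟩
  have : CompactSpace B := isCompact_iff_compactSpace.1 (isCompact_closedBall _ _)
  have hq : IsQuotientMap q := IsQuotientMap.of_surjective_continuous hqs q.continuous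
  have hpush : Continuous fun p : B × I ↦ (1 - p.2 : ℝ) • (p.1 : Fin (n + 1) → ℝ) +
      (p.2 : ℝ) • pushCube (p.1 : Fin (n + 1) → ℝ) := by
    have : Continuous fun z : B ↦ pushCube (z : Fin (n + 1) → ℝ) :=
      continuousOn_iff_continuous_domRestrict.1 continuousOn_pushCube
    have := this.comp (continuous_fst : Continuous (Prod.fst : B × I → B))
    have h2 : Continuous fun p : B × I ↦ (p.2 : ℝ) := by fun_prop
    exact ((continuous_const.sub h2).smul (continuous_subtype_val.comp continuous_fst)).add
      (h2.smul this)
  have hpushB : ∀ p : B × I, (1 - p.2 : ℝ) • (p.1 : Fin (n + 1) → ℝ) +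
      (p.2 : ℝ) • pushCube (p.1 : Fin (n + 1) → ℝ) ∈ B := fun p ↦
    (convex_closedBall (0 : Fin (n + 1) → ℝ) 1) p.1.2
      (sphere_subset_closedBall (pushCube_mem p.1.2).1) (sub_nonneg.2 p.2.2.2) p.2.2.1 (by ring)
  let Φ : C(B × I, Y) := ⟨fun p ↦ φ ((1 - p.2 : ℝ) • (p.1 : Fin (n + 1) → ℝ) +
      (p.2 : ℝ) • pushCube (p.1 : Fin (n + 1) → ℝ)), hb.continuousOn.comp_continuous hpush hpushB⟩
  -- Written as a map into the path space, the homotopy descends along `q` itself, and the product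
  -- of a quotient map with the interval does not occur.
  let H₀ : C(X ⊕ B, C(I, Y)) := ⟨Sum.elim (fun x ↦ ContinuousMap.const I (f x)) Φ.curry,
    ((ContinuousMap.const'.comp f).continuous).sumElim Φ.curry.continuous⟩
  have hconst : ∀ z : B, φ z ∈ range f → H₀ (Sum.inr z) = ContinuousMap.const I (φ z) := by
    intro z hz
    ext t
    change φ ((1 - t : ℝ) • (z : Fin (n + 1) → ℝ) + (t : ℝ) • pushCube (z : Fin (n + 1) → ℝ)) = φ z
    rw [pushCube_of_mem (hrange z z.2 hz), ← add_smul]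
    simp
  have hH₀ : ∀ d d', q d = q d' → H₀ d = H₀ d' := by
    have mixed : ∀ (x : X) (z : B), f x = φ z → H₀ (Sum.inl x) = H₀ (Sum.inr z) := by
      intro x z h
      rw [hconst z ⟨x, h⟩, ← h]
      rfl
    rintro (x | z) (x' | z') h
    · rw [hf.isEmbedding.injective h]
    · exact mixed x z' h
    · exact (mixed x' z h.symm).symm
    · change φ z = φ z' at h
      by_cases hz : φ z ∈ range f
      · rw [hconst z hz, hconst z' (h ▸ hz), h]
      · rw [Subtype.ext (hinj z z.2 z' z'.2 h hz)]
  let H : C(Y, C(I, Y)) := hq.lift H₀ hH₀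
  have hHq : ∀ d, H (q d) = H₀ d := fun d ↦ by
    have := hq.lift_comp H₀ hH₀
    exact DFunLike.congr_fun this d
  have hH0 : ∀ y, H y 0 = y := by
    intro y
    obtain ⟨d, rfl⟩ := hqs y
    rw [hHq]
    rcases d with x | z
    · rfl
    · change φ ((1 - (0 : ℝ)) • (z : Fin (n + 1) → ℝ) + (0 : ℝ) • pushCube _) = φ z
      simp
  have hH1 : ∀ y, H y 1 ∈ range f := by
    intro y
    obtain ⟨d, rfl⟩ := hqs y
    rw [hHq]
    rcases d with x | z
    · exact ⟨x, rfl⟩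
    · change φ ((1 - (1 : ℝ)) • (z : Fin (n + 1) → ℝ) + (1 : ℝ) • pushCube _) ∈ range f
      simpa using (hφ (pushCube_mem z.2)).1
  have hHf : ∀ x, H (f x) 1 = f x := fun x ↦ by
    rw [show f x = q (Sum.inl x) from rfl, hHq]; rfl
  let e := hf.isEmbedding.toHomeomorph
  let r : C(Y, X) := ⟨fun y ↦ e.symm ⟨H y 1, hH1 y⟩, by
    refine e.symm.continuous.comp (Continuous.subtype_mk ?_ _)
    exact (continuous_eval_const (1 : I)).comp H.continuous⟩
  have hfr : ∀ y, f (r y) = H y 1 := fun y ↦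
    congrArg Subtype.val (e.apply_symm_apply ⟨H y 1, hH1 y⟩)
  refine ⟨r, ?_, ⟨⟨⟨fun p ↦ H p.2 p.1, ?_⟩, fun y ↦ hH0 y, fun y ↦ (hfr y).symm⟩⟩⟩
  · ext x
    exact hf.isEmbedding.injective ((hfr _).trans (hHf x))
  · exact (ContinuousMap.continuous_uncurry_of_continuous H).comp continuous_swap

lemma isHomotopyEquiv_of_inverse {f : C(X, Y)} (g : C(Y, X))
    (h₁ : (g.comp f).Homotopic (ContinuousMap.id X))
    (h₂ : (f.comp g).Homotopic (ContinuousMap.id Y)) : IsHomotopyEquiv f :=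
  ⟨⟨f, g, h₁, h₂⟩, rfl⟩

lemma IsHomotopyEquiv.congr {f g : C(X, Y)} (hf : IsHomotopyEquiv f) (h : f.Homotopic g) :
    IsHomotopyEquiv g := by
  obtain ⟨e, rfl⟩ := hf
  exact isHomotopyEquiv_of_inverse e.invFun
    (((ContinuousMap.Homotopic.refl _).comp h.symm).trans e.left_inv)
    ((h.symm.comp (ContinuousMap.Homotopic.refl _)).trans e.right_inv)

lemma IsFormalDeformation.isHomotopyEquiv {X Y : Type u} [TopologicalSpace X] [TopologicalSpace Y]
    {K : FiniteCW X} {L : FiniteCW Y} {f : C(X, Y)}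
    (h : IsFormalDeformation K L f) : IsHomotopyEquiv f := by
  induction h with
  | @iso X Y _ _ K L f hf =>
    exact ⟨(hf.isHomeomorph.homeomorph f).toHomotopyEquiv, rfl⟩
  | expansion hf =>
    obtain ⟨r, h₁, h₂⟩ := hf.exists_retraction
    exact isHomotopyEquiv_of_inverse r (h₁ ▸ .refl _) h₂.symm
  | @collapse X Y _ _ K L f hf r hr =>
    obtain ⟨r', h₁, h₂⟩ := hf.exists_retraction
    refine isHomotopyEquiv_of_inverse f ?_ (hr ▸ .refl _)
    -- The collapse `r` is an arbitrary left inverse of `f` and may differ from the constructed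
    -- `r'`. Composing the homotopy from the identity to `f ∘ r'` with `f ∘ r`, and cancelling `r ∘
    -- f`, compares the two.
    have h : (f.comp r).Homotopic (f.comp r') := by
      have := (ContinuousMap.Homotopic.refl (f.comp r)).comp h₂
      have e : (f.comp r).comp (f.comp r') = f.comp r' := by
        rw [ContinuousMap.comp_assoc, ← ContinuousMap.comp_assoc r, hr, ContinuousMap.id_comp]
      rw [e] at this
      exact this
    exact h.trans h₂.symm
  | comp _ _ ihf ihg =>
    obtain ⟨e, rfl⟩ := ihf
    obtain ⟨e', rfl⟩ := ihg
    exact ⟨e.trans e', rfl⟩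

lemma IsSimpleHomotopyEquiv.isHomotopyEquiv {K : FiniteCW X} {L : FiniteCW Y} {f : C(X, Y)}
    (h : IsSimpleHomotopyEquiv K L f) : IsHomotopyEquiv f := by
  obtain ⟨g, hg, hfg⟩ := h
  exact hg.isHomotopyEquiv.congr hfg.symm

/-- An inclusion of finite CW complexes, `f : X → Y`, that is a formal deformation and has a
retraction that is a formal deformation. -/
def IsFormalInclusion (K : FiniteCW X) (L : FiniteCW Y) (f : C(X, Y)) : Prop :=
  IsFormalDeformation K L f ∧
    ∃ r : C(Y, X), r.comp f = ContinuousMap.id X ∧ IsFormalDeformation L K r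

lemma IsElementaryExpansion.isFormalInclusion {K : FiniteCW X} {L : FiniteCW Y} {f : C(X, Y)}
    (hf : IsElementaryExpansion K L f) : IsFormalInclusion K L f := by
  obtain ⟨r, hr, -⟩ := hf.exists_retraction
  exact ⟨.expansion hf, r, hr, .collapse hf hr⟩

lemma IsFormalInclusion.comp {Z : Type u} [TopologicalSpace Z] {K : FiniteCW X} {L : FiniteCW Y}
    {M : FiniteCW Z} {f : C(X, Y)} {g : C(Y, Z)} (hf : IsFormalInclusion K L f)
    (hg : IsFormalInclusion L M g) : IsFormalInclusion K M (g.comp f) := by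
  obtain ⟨hf, r, hr, hr'⟩ := hf
  obtain ⟨hg, s, hs, hs'⟩ := hg
  refine ⟨hf.comp hg, r.comp s, ?_, hs'.comp hr'⟩
  rw [ContinuousMap.comp_assoc, ← ContinuousMap.comp_assoc s, hs, ContinuousMap.id_comp, hr]

end SimpleHomotopy

/-! ### Expansions along a matching of cells -/

namespace CellStructure

variable {Y : Type u} [TopologicalSpace Y] (C : CellStructure Y)

/-- The union of a family of open cells. -/
def union (I : Set C.ι) : Set Y := ⋃ i ∈ I, C.openCell i

variable {C} in
lemma mem_union {I : Set C.ι} {p : Y} : p ∈ C.union I ↔ ∃ i ∈ I, p ∈ C.openCell i := by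
  simp [union]

lemma openCell_subset_union {I : Set C.ι} {i : C.ι} (hi : i ∈ I) : C.openCell i ⊆ C.union I :=
  fun _ hp ↦ mem_union.2 ⟨i, hi, hp⟩

lemma union_mono {I J : Set C.ι} (h : I ⊆ J) : C.union I ⊆ C.union J := fun _ hp ↦ by
  obtain ⟨i, hi, hp⟩ := mem_union.1 hp
  exact mem_union.2 ⟨i, h hi, hp⟩

lemma union_univ : C.union univ = univ :=
  eq_univ_of_forall fun p ↦ by simpa [mem_union] using C.exists_mem_openCell p

lemma mem_of_mem_union {I : Set C.ι} {i : C.ι} {p : Y} (hi : p ∈ C.openCell i)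
    (hp : p ∈ C.union I) : i ∈ I := by
  obtain ⟨j, hj, hp⟩ := mem_union.1 hp
  rwa [C.eq_of_mem_openCell hi hp]

lemma closedCell_subset_union {I : Set C.ι} (hI : IsClosed (C.union I)) {i : C.ι} (hi : i ∈ I) :
    C.closedCell i ⊆ C.union I :=
  (C.closedCell_subset_closure i).trans (closure_minimal (C.openCell_subset_union hi) hI)

/-- The cell structure on a closed union of open cells. -/
abbrev sub (I : Set C.ι) (hI : IsClosed (C.union I)) : CellStructure (C.union I) :=
  C.restrict (C.union I) I (fun _ ↦ mem_union) fun _ hi ↦ C.closedCell_subset_union hI hi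

/-- The finite CW complex given by a closed union of open cells. -/
noncomputable def subCW [T2Space Y] [Finite C.ι] (I : Set C.ι) (hI : IsClosed (C.union I)) :
    FiniteCW (C.union I) := (C.sub I hI).toFiniteCW

lemma toFiniteCW_openCell [T2Space Y] [Finite C.ι] (i : C.ι) :
    C.toFiniteCW.openCell (n := C.dim i) ⟨i, rfl⟩ = C.openCell i := rfl

lemma coe_image_openCell_subCW [T2Space Y] [Finite C.ι] (I : Set C.ι) (hI : IsClosed (C.union I))
    {i : C.ι} (hi : i ∈ I) :
    Subtype.val '' (C.subCW I hI).openCell (n := C.dim i) ⟨⟨i, hi⟩, rfl⟩ = C.openCell i :=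
  C.coe_image_openCell_restrict _ _ _ _ ⟨i, hi⟩

/-- `φ` is a characteristic map for the cell `i`, of dimension `n`. -/
structure IsChar (i : C.ι) {n : ℕ} (φ : (Fin n → ℝ) → Y) : Prop where
  dim_eq : C.dim i = n
  continuousOn : ContinuousOn φ (closedBall 0 1)
  injOn : InjOn φ (ball 0 1)
  image_ball : φ '' ball 0 1 = C.openCell i
  boundary : ∀ x ∈ sphere (0 : Fin n → ℝ) 1, ∃ j, C.dim j < n ∧ φ x ∈ C.openCell j

lemma isChar_map (i : C.ι) : C.IsChar i (C.map i) :=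
  ⟨rfl, (C.map i).continuous.continuousOn, C.injOn i, rfl, C.boundary i⟩

variable {C} in
-- Used with symmetries of the cube: an elementary expansion wants the free face on top, so
-- characteristic maps have to be turned by reflections and exchanges of coordinates.
lemma IsChar.comp {i : C.ι} {n : ℕ} {φ : (Fin n → ℝ) → Y} (h : C.IsChar i φ)
    (κ : (Fin n → ℝ) → Fin n → ℝ) (hκ : Continuous κ) (hκ' : Function.Involutive κ)
    (hn : ∀ x, ‖κ x‖ = ‖x‖) : C.IsChar i (φ ∘ κ) where
  dim_eq := h.dim_eq
  continuousOn := h.continuousOn.comp hκ.continuousOn fun x hx ↦ by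
    simpa [mem_closedBall_zero_iff, hn] using hx
  injOn := h.injOn.comp hκ'.injective.injOn fun x hx ↦ by
    simpa [mem_ball_zero_iff, hn] using hx
  image_ball := by
    rw [image_comp, ← h.image_ball]
    congr 1
    ext x
    refine ⟨?_, fun hx ↦ ⟨κ x, ?_, hκ' x⟩⟩
    · rintro ⟨y, hy, rfl⟩
      simpa [mem_ball_zero_iff, hn] using hy
    · simpa [mem_ball_zero_iff, hn] using hx
  boundary x hx := h.boundary (κ x) (by simpa [mem_sphere_zero_iff_norm, hn] using hx)

variable {C} in
lemma IsChar.congr {i : C.ι} {n : ℕ} {φ ψ : (Fin n → ℝ) → Y} (h : C.IsChar i φ)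
    (hψ : EqOn ψ φ (closedBall 0 1)) : C.IsChar i ψ where
  dim_eq := h.dim_eq
  continuousOn := h.continuousOn.congr hψ
  injOn := h.injOn.congr (hψ.mono ball_subset_closedBall).symm
  image_ball := (image_congr (hψ.mono ball_subset_closedBall)).trans h.image_ball
  boundary x hx := by
    rw [hψ (sphere_subset_closedBall hx)]
    exact h.boundary x hx

lemma isCharMap_toFiniteCW [T2Space Y] [Finite C.ι] {i : C.ι} {n : ℕ} {φ : (Fin n → ℝ) → Y}
    (h : C.IsChar i φ) : C.toFiniteCW.IsCharMap ⟨i, h.dim_eq⟩ φ where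
  continuousOn := h.continuousOn
  injOn := h.injOn
  image_ball := by
    obtain rfl := h.dim_eq
    exact h.image_ball
  mapsTo_sphere x hx := by
    obtain ⟨j, hj, hx⟩ := h.boundary x hx
    exact C.toFiniteCW.mem_skeletonLT.2 ⟨_, hj, ⟨j, rfl⟩, hx⟩

variable {C} in
lemma IsChar.restrict {I : Set C.ι} (hI : IsClosed (C.union I)) {i : C.ι} (hi : i ∈ I) {n : ℕ}
    {φ : (Fin n → ℝ) → Y} (h : C.IsChar i φ) {ψ : (Fin n → ℝ) → C.union I}
    (hψ : ∀ x ∈ closedBall (0 : Fin n → ℝ) 1, (ψ x : Y) = φ x) :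
    (C.sub I hI).IsChar ⟨i, hi⟩ ψ where
  dim_eq := h.dim_eq
  continuousOn := by
    rw [IsEmbedding.subtypeVal.continuousOn_iff]
    exact h.continuousOn.congr fun x hx ↦ hψ x hx
  injOn x hx y hy hxy := h.injOn hx hy <| by
    rw [← hψ x (ball_subset_closedBall hx), ← hψ y (ball_subset_closedBall hy), hxy]
  image_ball := by
    apply Subtype.val_injective.image_injective
    refine Eq.trans ?_ (C.coe_image_openCell_restrict _ _ _ _ ⟨i, hi⟩).symm
    rw [image_image, ← h.image_ball]
    exact image_congr fun x hx ↦ hψ x (ball_subset_closedBall hx)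
  boundary x hx := by
    obtain ⟨j, hj, hx'⟩ := h.boundary x hx
    rw [← hψ x (sphere_subset_closedBall hx)] at hx'
    have hjI := C.mem_of_mem_union hx' (ψ x).2
    refine ⟨⟨j, hjI⟩, hj, ?_⟩
    rw [← C.coe_image_openCell_restrict (C.union I) I (fun _ ↦ mem_union)
      (fun _ hi ↦ C.closedCell_subset_union hI hi) ⟨j, hjI⟩] at hx'
    obtain ⟨p, hp, hpx⟩ := hx'
    rwa [← Subtype.ext hpx]

/-- The inclusion of one union of cells into another one is a formal deformation, with a retraction
that is a formal deformation. -/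
def IsFormalPair [T2Space Y] [Finite C.ι] (I J : Set C.ι) : Prop :=
  ∃ (hI : IsClosed (C.union I)) (hJ : IsClosed (C.union J)) (h : C.union I ⊆ C.union J),
    IsFormalInclusion (C.subCW I hI) (C.subCW J hJ)
      ⟨inclusion h, continuous_inclusion h⟩

variable {C} in
lemma IsFormalPair.trans [T2Space Y] [Finite C.ι] {I J K : Set C.ι} (h₁ : C.IsFormalPair I J)
    (h₂ : C.IsFormalPair J K) : C.IsFormalPair I K := by
  obtain ⟨hI, _, h, h₁⟩ := h₁
  obtain ⟨_, hK, h', h₂⟩ := h₂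
  exact ⟨hI, hK, h.trans h', h₁.comp h₂⟩

lemma IsFormalPair.refl [T2Space Y] [Finite C.ι] {I : Set C.ι} (hI : IsClosed (C.union I)) :
    C.IsFormalPair I I := by
  refine ⟨hI, hI, subset_rfl, ?_⟩
  have : IsFormalDeformation (C.subCW I hI) (C.subCW I hI) (ContinuousMap.id _) :=
    .iso ⟨IsHomeomorph.id, fun n i ↦ ⟨i, by rw [ContinuousMap.coe_id, image_id]⟩⟩
  exact ⟨this, ContinuousMap.id _, rfl, this⟩

/-- The enlarged union is the old one together with the image of the closed cube under `φ`, hence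
closed: the top face supplies `a`, the interior `b`, and the other faces lie in the old union. What
remains is the definition of an elementary expansion, with `φ` clamped to the cube so as to take
values in the subspace. -/
lemma isFormalPair_insert [T2Space Y] [Finite C.ι] {I : Set C.ι} (hI : IsClosed (C.union I))
    {a b : C.ι} (ha : a ∉ I) (hb : b ∉ I) {n : ℕ} {φ : (Fin (n + 1) → ℝ) → Y}
    (hφb : C.IsChar b φ)
    (hφa : C.IsChar a (fun x : Fin n → ℝ ↦ φ (Fin.snoc x (1 : ℝ) : Fin (n + 1) → ℝ)))
    (hφ : MapsTo φ (sphere 0 1 \ cubeTop n) (C.union I)) :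
    C.IsFormalPair I (I ∪ {a, b}) := by
  set J := I ∪ {a, b}
  have haJ : a ∈ J := by simp [J]
  have hbJ : b ∈ J := by simp [J]
  have hIJ : I ⊆ J := subset_union_left
  have hφJ : MapsTo φ (closedBall 0 1) (C.union J) := by
    intro z hz
    by_cases hz' : z ∈ ball 0 1
    · exact C.openCell_subset_union hbJ (hφb.image_ball ▸ mem_image_of_mem _ hz')
    · by_cases hz'' : z ∈ cubeTop n
      · obtain ⟨x, hx, rfl⟩ := hz''
        exact C.openCell_subset_union haJ (hφa.image_ball ▸ mem_image_of_mem _ hx)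
      · exact C.union_mono hIJ (hφ ⟨mem_sphere_cube.2 ⟨hz, hz'⟩, hz''⟩)
  have hJ : IsClosed (C.union J) := by
    have : C.union J = C.union I ∪ φ '' closedBall 0 1 := by
      refine subset_antisymm (fun p hp ↦ ?_)
        (union_subset (C.union_mono hIJ) hφJ.image_subset)
      obtain ⟨i, hi | rfl | rfl, hp'⟩ := mem_union.1 hp
      · exact Or.inl (mem_union.2 ⟨i, hi, hp'⟩)
      · rw [← hφa.image_ball] at hp'
        obtain ⟨x, hx, rfl⟩ := hp'
        exact Or.inr ⟨_, snoc_mem_closedBall.2 ⟨ball_subset_closedBall hx, by simp⟩, rfl⟩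
      · rw [← hφb.image_ball] at hp'
        exact Or.inr (image_mono ball_subset_closedBall hp')
    rw [this]
    exact hI.union ((isCompact_closedBall _ _).image_of_continuousOn hφb.continuousOn).isClosed
  refine ⟨hI, hJ, C.union_mono hIJ, IsElementaryExpansion.isFormalInclusion ⟨?_, ?_, ?_⟩⟩
  · exact IsEmbedding.inclusion (C.union_mono hIJ)
  · rintro _ ⟨⟨i, hi⟩, rfl⟩
    refine ⟨⟨⟨i, hIJ hi⟩, rfl⟩, ?_⟩
    apply Subtype.val_injective.image_injective
    refine Eq.trans ?_ (C.coe_image_openCell_subCW J hJ (hIJ hi)).symm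
    rw [image_image]
    exact C.coe_image_openCell_subCW I hI hi
  · have hψa := hφa.restrict hJ haJ (ψ := fun x ↦ ⟨φ (cubeClamp _ (Fin.snoc x (1 : ℝ))),
      hφJ (cubeClamp_mem _)⟩) fun x hx ↦
        congrArg φ (cubeClamp_of_mem (snoc_mem_closedBall.2 ⟨hx, by simp⟩))
    have hψb := hφb.restrict hJ hbJ (ψ := fun x ↦ ⟨φ (cubeClamp _ x), hφJ (cubeClamp_mem _)⟩)
      fun x hx ↦ congrArg φ (cubeClamp_of_mem hx)
    refine ⟨n, ⟨⟨a, haJ⟩, hψa.dim_eq⟩, ⟨⟨b, hbJ⟩, hψb.dim_eq⟩,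
      fun x ↦ ⟨φ (cubeClamp _ x), hφJ (cubeClamp_mem _)⟩, ?_,
      (C.sub J hJ).isCharMap_toFiniteCW hψb, (C.sub J hJ).isCharMap_toFiniteCW hψa, ?_⟩
    · apply Subtype.val_injective.image_injective
      have e1 : Subtype.val '' (C.subCW J hJ).openCell (n := n) ⟨⟨a, haJ⟩, hψa.dim_eq⟩ =
          C.openCell a := by
        obtain rfl := hφa.dim_eq
        exact C.coe_image_openCell_subCW J hJ haJ
      have e2 : Subtype.val '' (C.subCW J hJ).openCell (n := n + 1) ⟨⟨b, hbJ⟩, hψb.dim_eq⟩ =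
          C.openCell b := by
        rw [← (C.coe_image_openCell_subCW J hJ hbJ)]
        congr! 1
        -- The equation `C.dim b = n + 1` has no variable to eliminate, so the dimension is
        -- generalized first.
        have : ∀ m (h : C.dim b = m), (C.subCW J hJ).openCell (n := m) ⟨⟨b, hbJ⟩, h⟩ =
          (C.subCW J hJ).openCell (n := C.dim b) ⟨⟨b, hbJ⟩, rfl⟩ := by
            rintro _ rfl; rfl
        exact this _ hφb.dim_eq
      rw [image_union, e1, e2]
      ext p
      constructor
      · rintro ⟨q, hq, rfl⟩
        obtain ⟨i, hi | rfl | rfl, hp⟩ := mem_union.1 q.2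
        · exact (hq ⟨⟨q, mem_union.2 ⟨i, hi, hp⟩⟩, rfl⟩).elim
        · exact Or.inl hp
        · exact Or.inr hp
      · intro hp
        have hpJ : p ∈ C.union J := by
          rcases hp with hp | hp
          · exact C.openCell_subset_union haJ hp
          · exact C.openCell_subset_union hbJ hp
        refine ⟨⟨p, hpJ⟩, ?_, rfl⟩
        rintro ⟨q, hq⟩
        obtain rfl : (q : Y) = p := congrArg Subtype.val hq
        rcases hp with hp | hp
        · exact ha (C.mem_of_mem_union hp q.2)
        · exact hb (C.mem_of_mem_union hp q.2)
    · intro z hz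
      have hz' := sphere_subset_closedBall hz.1
      refine ⟨⟨⟨φ z, hφ hz⟩, Subtype.ext (by simp [cubeClamp_of_mem hz'])⟩, ?_⟩
      have := ((C.sub J hJ).isCharMap_toFiniteCW hψb).mapsTo_sphere hz.1
      obtain ⟨m, hm, j, h⟩ := (FiniteCW.mem_skeletonLT _).1 this
      exact (FiniteCW.mem_skeleton _).2 ⟨m, Nat.lt_succ_iff.1 hm, j, h⟩

/-- If the cells outside of a subcomplex are matched in pairs, in such a way that every pair is
attached to the subcomplex and to the pairs of lower rank as in an elementary expansion, then the
inclusion of the subcomplex is a formal deformation. -/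
theorem isFormalPair_of_matching [T2Space Y] [Finite C.ι] {I : Set C.ι}
    (hI : IsClosed (C.union I)) {P : Type v} [Finite P] {α : Type*} [LinearOrder α] (ρ : P → α)
    (a b : P → C.ι) (n : P → ℕ) (φ : ∀ π, (Fin (n π + 1) → ℝ) → Y)
    (ha : ∀ π, a π ∉ I) (hb : ∀ π, b π ∉ I)
    (hab : ∀ π π', a π ≠ b π') (ha' : Function.Injective a) (hb' : Function.Injective b)
    (hcover : ∀ i, i ∈ I ∨ ∃ π, i = a π ∨ i = b π)
    (hφb : ∀ π, C.IsChar (b π) (φ π))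
    (hφa : ∀ π, C.IsChar (a π)
      (fun x : Fin (n π) → ℝ ↦ φ π (Fin.snoc x (1 : ℝ) : Fin (n π + 1) → ℝ)))
    (hφ : ∀ π, MapsTo (φ π) (sphere 0 1 \ cubeTop (n π))
      (C.union {i | i ∈ I ∨ ∃ π', ρ π' < ρ π ∧ (i = a π' ∨ i = b π')})) :
    C.IsFormalPair I univ := by
  classical
  have := Fintype.ofFinite P
  -- Induction over sets of pairs closed under passing to lower rank. A pair of maximal rank is
  -- added last; all pairs of strictly lower rank, to which it may be attached, are then present,
  -- and the set without it is still closed downwards.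
  have key : ∀ s : Finset P, (∀ π ∈ s, ∀ π', ρ π' < ρ π → π' ∈ s) →
      C.IsFormalPair I {i | i ∈ I ∨ ∃ π ∈ s, i = a π ∨ i = b π} := by
    intro s
    induction s using Finset.induction_on_max_value ρ with
    | empty =>
      intro _
      convert IsFormalPair.refl C hI using 1
      simp
    | insert π s hπ hmax ih =>
      intro hs
      have hs' : ∀ π₁ ∈ s, ∀ π', ρ π' < ρ π₁ → π' ∈ s := fun π₁ h₁ π' h' ↦
        (Finset.mem_insert.1 (hs π₁ (Finset.mem_insert_of_mem h₁) π' h')).resolve_left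
          fun h ↦ (h ▸ h').not_ge (hmax π₁ h₁)
      have hpair := ih hs'
      have hcl := hpair.choose_spec.choose
      have := C.isFormalPair_insert hcl (a := a π) (b := b π) (n := n π) (φ := φ π) ?_ ?_
        (hφb π) (hφa π) ?_
      · convert hpair.trans this using 1
        ext i
        simp only [Finset.mem_insert, mem_ofPred_eq, mem_insert_iff, mem_singleton_iff,
          exists_eq_or_imp, Set.mem_union]
        exact (or_congr_right or_comm).trans or_assoc.symm
      · rintro (h | ⟨π', hπ', h | h⟩)
        · exact ha π h
        · exact hπ (ha' h ▸ hπ')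
        · exact hab π π' h
      · rintro (h | ⟨π', hπ', h | h⟩)
        · exact hb π h
        · exact hab π' π h.symm
        · exact hπ (hb' h ▸ hπ')
      · intro z hz
        refine C.union_mono ?_ (hφ π hz)
        rintro i (hi | ⟨π', hπ', h⟩)
        · exact Or.inl hi
        · refine Or.inr ⟨π', ?_, h⟩
          exact (Finset.mem_insert.1 (hs π (Finset.mem_insert_self _ _) π' hπ')).resolve_left
            fun h ↦ (h ▸ hπ').false
  convert key Finset.univ (fun _ _ _ _ ↦ Finset.mem_univ _) using 1
  ext i
  simpa using hcover i

lemma isCWIso_coe_univ [T2Space Y] [Finite C.ι] (h : IsClosed (C.union univ)) :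
    IsCWIso (C.subCW univ h) C.toFiniteCW ⟨Subtype.val, continuous_subtype_val⟩ where
  isHomeomorph := by
    refine ⟨continuous_subtype_val, IsOpen.isOpenMap_subtype_val ?_, Subtype.val_injective, fun y ↦ ?_⟩
    · rw [union_univ]; exact isOpen_univ
    · exact ⟨⟨y, by rw [union_univ]; exact mem_univ y⟩, rfl⟩
  image_cell := by
    rintro _ ⟨⟨i, hi⟩, rfl⟩
    exact ⟨⟨i, rfl⟩, C.coe_image_openCell_subCW univ h hi⟩

/-- Every cell of the target is hit: the inverse image of its centre lies in some open cell, whose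
image is an open cell containing this centre. -/
lemma isCWIso_symm {X Y : Type u} [TopologicalSpace X] [TopologicalSpace Y] [T2Space X]
    (A : CellStructure X) (C : CellStructure Y) [Finite A.ι] [T2Space Y] [Finite C.ι] (e : X ≃ₜ Y)
    (h : IsCWIso A.toFiniteCW C.toFiniteCW e) : IsCWIso C.toFiniteCW A.toFiniteCW e.symm where
  isHomeomorph := e.symm.isHomeomorph
  image_cell := by
    rintro _ ⟨j, rfl⟩
    have h0 : C.map j 0 ∈ C.openCell j := C.map_mem_openCell (mem_ball_self one_pos)
    obtain ⟨i, hi⟩ := A.exists_mem_openCell (e.symm (C.map j 0))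
    obtain ⟨⟨k, hk⟩, hik⟩ := h.image_cell _ ⟨i, rfl⟩
    rw [toFiniteCW_openCell] at hik
    have hk' : C.toFiniteCW.openCell ⟨k, hk⟩ = C.openCell k := by
      revert hk; generalize A.dim i = m; rintro rfl _; rfl
    rw [hk'] at hik
    have : C.map j 0 ∈ C.openCell k := by
      rw [← hik]
      exact ⟨_, hi, e.apply_symm_apply _⟩
    obtain rfl := C.eq_of_mem_openCell h0 this
    refine ⟨⟨i, hk.symm⟩, ?_⟩
    have hi' : A.toFiniteCW.openCell ⟨i, hk.symm⟩ = A.openCell i := by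
      clear hik hk'; revert hk; generalize C.dim j = m; rintro rfl; rfl
    rw [hi', toFiniteCW_openCell, ← hik]
    exact (e.toEquiv.symm_image_image _)

/-- A version of `isFormalPair_of_matching` for an injective map instead of an inclusion. -/
theorem isFormalInclusion_of_isFormalPair {X Y : Type u} [TopologicalSpace X] [TopologicalSpace Y]
    [T2Space X] [T2Space Y] (A : CellStructure X) (C : CellStructure Y) [Finite A.ι] [Finite C.ι]
    (j : C(X, Y)) (hj : Function.Injective j) (σ : A.ι → C.ι) (hdim : ∀ c, C.dim (σ c) = A.dim c)
    (hσ : ∀ c, j '' A.openCell c = C.openCell (σ c)) (h : C.IsFormalPair (range σ) univ) :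
    IsFormalInclusion A.toFiniteCW C.toFiniteCW j := by
  obtain ⟨hI, hU, hIU, hincl⟩ := h
  have := A.compactSpace
  have hmem : ∀ x, j x ∈ C.union (range σ) := fun x ↦ by
    obtain ⟨c, hc⟩ := A.exists_mem_openCell x
    exact mem_union.2 ⟨σ c, ⟨c, rfl⟩, hσ c ▸ mem_image_of_mem _ hc⟩
  let j' : C(X, C.union (range σ)) := ⟨fun x ↦ ⟨j x, hmem x⟩, by fun_prop⟩
  have hj' : Function.Bijective j' := by
    refine ⟨fun x y h ↦ hj (congrArg Subtype.val h), fun ⟨y, hy⟩ ↦ ?_⟩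
    obtain ⟨_, ⟨c, rfl⟩, hp⟩ := mem_union.1 hy
    rw [← hσ c] at hp
    obtain ⟨x, -, rfl⟩ := hp
    exact ⟨x, rfl⟩
  have hhomeo : IsHomeomorph j' :=
    isHomeomorph_iff_continuous_isClosedMap_bijective.2 ⟨j'.continuous, j'.continuous.isClosedMap, hj'⟩
  let e := hhomeo.homeomorph j'
  have iso₁ : IsCWIso A.toFiniteCW (C.subCW (range σ) hI) e := by
    refine ⟨e.isHomeomorph, ?_⟩
    rintro _ ⟨c, rfl⟩
    refine ⟨⟨⟨σ c, ⟨c, rfl⟩⟩, hdim c⟩, ?_⟩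
    apply Subtype.val_injective.image_injective
    have : Subtype.val '' (C.subCW (range σ) hI).openCell (n := A.dim c)
        ⟨⟨σ c, ⟨c, rfl⟩⟩, hdim c⟩ = C.openCell (σ c) := by
      rw [← C.coe_image_openCell_subCW (range σ) hI ⟨c, rfl⟩]
      generalize_proofs h1 h2
      revert h2
      generalize A.dim c = m
      rintro rfl
      rfl
    rw [this, ← hσ c, image_image]
    rfl
  have iso₂ : IsCWIso (C.subCW (range σ) hI) A.toFiniteCW e.symm :=
    isCWIso_symm A (C.sub (range σ) hI) e iso₁
  let E : C.union univ ≃ₜ Y := (C.isCWIso_coe_univ hU).isHomeomorph.homeomorph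
  have iso₃ : IsCWIso C.toFiniteCW (C.subCW univ hU) E.symm :=
    isCWIso_symm (C.sub univ hU) C E (C.isCWIso_coe_univ hU)
  have f₁ : IsFormalInclusion A.toFiniteCW (C.subCW (range σ) hI) e :=
    ⟨.iso iso₁, e.symm, by ext x; exact e.symm_apply_apply x, .iso iso₂⟩
  have f₂ : IsFormalInclusion (C.subCW univ hU) C.toFiniteCW
      ⟨Subtype.val, continuous_subtype_val⟩ :=
    ⟨.iso (C.isCWIso_coe_univ hU), E.symm, by ext x; exact congrArg _ (E.symm_apply_apply x),
      .iso iso₃⟩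
  exact (f₁.comp hincl).comp f₂

end CellStructure

/-! ### Products, sums and graphs -/

section CubeAppend

variable {m n : ℕ}

lemma forall_fin_append {p : Fin (m + n) → Prop} :
    (∀ k, p k) ↔ (∀ k, p (Fin.castAdd n k)) ∧ ∀ k, p (Fin.natAdd m k) :=
  ⟨fun h ↦ ⟨fun _ ↦ h _, fun _ ↦ h _⟩, fun h k ↦ Fin.addCases h.1 h.2 k⟩

lemma mem_closedBall_cube_append {z : Fin (m + n) → ℝ} :
    z ∈ closedBall (0 : Fin (m + n) → ℝ) 1 ↔
      (fun k ↦ z (Fin.castAdd n k)) ∈ closedBall (0 : Fin m → ℝ) 1 ∧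
      (fun k ↦ z (Fin.natAdd m k)) ∈ closedBall (0 : Fin n → ℝ) 1 := by
  simp only [mem_closedBall_cube]
  exact forall_fin_append

lemma mem_ball_cube_append {z : Fin (m + n) → ℝ} :
    z ∈ ball (0 : Fin (m + n) → ℝ) 1 ↔
      (fun k ↦ z (Fin.castAdd n k)) ∈ ball (0 : Fin m → ℝ) 1 ∧
      (fun k ↦ z (Fin.natAdd m k)) ∈ ball (0 : Fin n → ℝ) 1 := by
  simp only [mem_ball_cube]
  exact forall_fin_append

end CubeAppend

namespace CellStructure

section Prod

variable {X : Type u} {Y : Type v} [TopologicalSpace X] [TopologicalSpace Y]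

/-- The characteristic map of a product cell. -/
def prodMap (A : CellStructure X) (B : CellStructure Y) (i : A.ι) (j : B.ι) :
    C(Fin (A.dim i + B.dim j) → ℝ, X × Y) :=
  ⟨fun z ↦ (A.map i fun k ↦ z (Fin.castAdd _ k), B.map j fun k ↦ z (Fin.natAdd _ k)), by fun_prop⟩

lemma prodMap_image_ball (A : CellStructure X) (B : CellStructure Y) (i : A.ι) (j : B.ι) :
    prodMap A B i j '' ball 0 1 = A.openCell i ×ˢ B.openCell j := by
  ext ⟨p, q⟩
  constructor
  · rintro ⟨z, hz, h⟩
    obtain ⟨rfl, rfl⟩ := Prod.mk.inj h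
    exact ⟨⟨_, (mem_ball_cube_append.1 hz).1, rfl⟩, ⟨_, (mem_ball_cube_append.1 hz).2, rfl⟩⟩
  · rintro ⟨⟨x, hx, rfl⟩, ⟨y, hy, rfl⟩⟩
    refine ⟨Fin.append x y, mem_ball_cube_append.2 ?_, ?_⟩
    · simp only [Fin.append_left, Fin.append_right]
      exact ⟨hx, hy⟩
    · simp [prodMap]

lemma prodMap_injOn (A : CellStructure X) (B : CellStructure Y) (i : A.ι) (j : B.ι) :
    InjOn (prodMap A B i j) (ball 0 1) := by
  intro z hz w hw h
  obtain ⟨h1, h2⟩ := Prod.mk.inj h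
  have h1 := A.injOn i (mem_ball_cube_append.1 hz).1 (mem_ball_cube_append.1 hw).1 h1
  have h2 := B.injOn j (mem_ball_cube_append.1 hz).2 (mem_ball_cube_append.1 hw).2 h2
  funext k
  exact Fin.addCases (fun k ↦ congrFun h1 k) (fun k ↦ congrFun h2 k) k

/-- The product of two cell structures. -/
abbrev prod (A : CellStructure X) (B : CellStructure Y) : CellStructure (X × Y) where
  ι := A.ι × B.ι
  dim i := A.dim i.1 + B.dim i.2
  map i := prodMap A B i.1 i.2
  injOn i := prodMap_injOn A B i.1 i.2
  eq_of_mem := by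
    rintro ⟨i, j⟩ ⟨i', j'⟩ p h h'
    rw [prodMap_image_ball] at h h'
    exact Prod.ext (A.eq_of_mem_openCell h.1 h'.1) (B.eq_of_mem_openCell h.2 h'.2)
  cover p := by
    obtain ⟨i, hi⟩ := A.exists_mem_openCell p.1
    obtain ⟨j, hj⟩ := B.exists_mem_openCell p.2
    exact ⟨(i, j), by rw [prodMap_image_ball]; exact ⟨hi, hj⟩⟩
  boundary := by
    rintro ⟨i, j⟩ z hz
    rw [mem_sphere_cube, mem_closedBall_cube_append, mem_ball_cube_append, not_and_or] at hz
    obtain ⟨⟨h1, h2⟩, h3⟩ := hz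
    obtain ⟨i', hi', hi''⟩ := A.exists_openCell_of_mem_closedBall i h1
    obtain ⟨j', hj', hj''⟩ := B.exists_openCell_of_mem_closedBall j h2
    refine ⟨(i', j'), ?_, by rw [prodMap_image_ball]; exact ⟨hi'', hj''⟩⟩
    rcases h3 with h3 | h3
    · obtain ⟨k, hk, hk'⟩ := A.boundary i _ (mem_sphere_cube.2 ⟨h1, h3⟩)
      obtain rfl := A.eq_of_mem_openCell hi'' hk'
      exact add_lt_add_of_lt_of_le hk hj'
    · obtain ⟨k, hk, hk'⟩ := B.boundary j _ (mem_sphere_cube.2 ⟨h2, h3⟩)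
      obtain rfl := B.eq_of_mem_openCell hj'' hk'
      exact add_lt_add_of_le_of_lt hi' hk

lemma prod_openCell (A : CellStructure X) (B : CellStructure Y) (i : (A.prod B).ι) :
    (A.prod B).openCell i = A.openCell i.1 ×ˢ B.openCell i.2 := prodMap_image_ball A B i.1 i.2

end Prod

section Sum

variable {X Y : Type u} [TopologicalSpace X] [TopologicalSpace Y]

/-- The cell structure on a disjoint union. -/
abbrev sum (A : CellStructure X) (B : CellStructure Y) : CellStructure (X ⊕ Y) where
  ι := A.ι ⊕ B.ι
  dim := Sum.elim A.dim B.dim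
  map
    | .inl i => ⟨Sum.inl ∘ A.map i, by fun_prop⟩
    | .inr j => ⟨Sum.inr ∘ B.map j, by fun_prop⟩
  injOn
    | .inl i => fun x hx y hy h ↦ A.injOn i hx hy (Sum.inl_injective h)
    | .inr j => fun x hx y hy h ↦ B.injOn j hx hy (Sum.inr_injective h)
  eq_of_mem := by
    rintro (i | i) (j | j) _ ⟨x, hx, rfl⟩ ⟨y, hy, h⟩
    · exact congrArg _ (A.eq_of_mem_openCell (A.map_mem_openCell hx)
        (Sum.inl_injective h ▸ A.map_mem_openCell hy))
    · exact (Sum.inr_ne_inl h).elim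
    · exact (Sum.inl_ne_inr h).elim
    · exact congrArg _ (B.eq_of_mem_openCell (B.map_mem_openCell hx)
        (Sum.inr_injective h ▸ B.map_mem_openCell hy))
  cover := by
    rintro (p | p)
    · obtain ⟨i, x, hx, rfl⟩ := A.exists_mem_openCell p
      exact ⟨.inl i, x, hx, rfl⟩
    · obtain ⟨i, x, hx, rfl⟩ := B.exists_mem_openCell p
      exact ⟨.inr i, x, hx, rfl⟩
  boundary := by
    rintro (i | i) x hx
    · obtain ⟨j, hj, y, hy, h⟩ := A.boundary i x hx
      exact ⟨.inl j, hj, y, hy, congrArg Sum.inl h⟩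
    · obtain ⟨j, hj, y, hy, h⟩ := B.boundary i x hx
      exact ⟨.inr j, hj, y, hy, congrArg Sum.inr h⟩

lemma sum_openCell_inl (A : CellStructure X) (B : CellStructure Y) (i : A.ι) :
    (A.sum B).openCell (Sum.inl i) = Sum.inl '' A.openCell i := by
  rw [openCell, openCell, image_image]; rfl

lemma sum_openCell_inr (A : CellStructure X) (B : CellStructure Y) (i : B.ι) :
    (A.sum B).openCell (Sum.inr i) = Sum.inr '' B.openCell i := by
  rw [openCell, openCell, image_image]; rfl

end Sum

section Graph

variable {X : Type u} [TopologicalSpace X]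

/-- A cell structure of dimension at most one, given by its vertices and its edges. -/
abbrev ofGraph {V E : Type u} (v : V → X) (e : E → C(ℝ, X)) (hv : Function.Injective v)
    (he : ∀ {i j s t}, |s| < 1 → |t| < 1 → e i s = e j t → i = j ∧ s = t)
    (hev : ∀ {i s w}, |s| < 1 → e i s ≠ v w)
    (hc : ∀ p, (∃ w, v w = p) ∨ ∃ i s, |s| < 1 ∧ e i s = p)
    (hend : ∀ i, (∃ w, v w = e i (-1)) ∧ ∃ w, v w = e i 1) : CellStructure X where
  ι := V ⊕ E
  dim := Sum.elim (fun _ ↦ 0) (fun _ ↦ 1)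
  map
    | .inl w => .const _ (v w)
    | .inr i => (e i).comp ⟨fun x : Fin 1 → ℝ ↦ x 0, continuous_apply 0⟩
  injOn
    | .inl w => fun x _ y _ _ ↦ Subsingleton.elim (α := Fin 0 → ℝ) x y
    | .inr i => fun (x : Fin 1 → ℝ) hx (y : Fin 1 → ℝ) hy h ↦ by
      have : x 0 = y 0 := (he (mem_ball_cube.1 hx (0 : Fin 1)) (mem_ball_cube.1 hy (0 : Fin 1)) h).2
      funext (k : Fin 1)
      rwa [Subsingleton.elim k 0]
  eq_of_mem := by
    rintro (i | i) (j | j) _ ⟨x, hx, rfl⟩ ⟨y, hy, h⟩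
    · exact congrArg _ (hv h.symm)
    · exact (hev (mem_ball_cube.1 hy (0 : Fin 1)) h).elim
    · exact (hev (mem_ball_cube.1 hx (0 : Fin 1)) h.symm).elim
    · exact congrArg _
        (he (mem_ball_cube.1 hy (0 : Fin 1)) (mem_ball_cube.1 hx (0 : Fin 1)) h).1.symm
  cover p := by
    rcases hc p with ⟨w, rfl⟩ | ⟨i, s, hs, rfl⟩
    · exact ⟨.inl w, 0, mem_ball_self one_pos, rfl⟩
    · exact ⟨.inr i, fun _ ↦ s, mem_ball_cube.2 fun _ ↦ hs, rfl⟩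
  boundary := by
    rintro (i | i) x hx
    · rw [mem_sphere_cube] at hx
      exact (hx.2 (mem_ball_cube.2 fun k : Fin 0 ↦ k.elim0)).elim
    · change Fin 1 → ℝ at x
      replace hx : x ∈ sphere (0 : Fin 1 → ℝ) 1 := hx
      have key : x 0 = 1 ∨ x 0 = -1 := by
        rw [mem_sphere_cube, mem_closedBall_cube, mem_ball_cube] at hx
        refine (abs_eq zero_le_one).1 (le_antisymm (hx.1 (0 : Fin 1)) (not_lt.1 fun h ↦ hx.2 ?_))
        intro (k : Fin 1)
        rwa [Subsingleton.elim k 0]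
      rcases key with h | h
      · obtain ⟨w, hw⟩ := (hend i).2
        exact ⟨.inl w, zero_lt_one, 0, mem_ball_self one_pos, hw.trans (congrArg (e i) h.symm)⟩
      · obtain ⟨w, hw⟩ := (hend i).1
        exact ⟨.inl w, zero_lt_one, 0, mem_ball_self one_pos, hw.trans (congrArg (e i) h.symm)⟩

end Graph

end CellStructure

/-! ### The space `Y × [-1, 1] ∪ Z` -/

/-- Two fibres are disjoint closed sets in a normal space, so they have disjoint open neighbourhoods
`U` and `V`. Since `f` is closed, the points whose whole fibre lies in `U`, respectively in `V`,
form open sets, and these are disjoint. -/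
lemma t2Space_of_isClosedMap {K : Type u} {X : Type v} [TopologicalSpace K] [CompactSpace K]
    [T2Space K] [TopologicalSpace X] {f : K → X} (hf : Continuous f) (hs : Function.Surjective f)
    (hc : IsClosedMap f) : T2Space X := by
  have hsing : ∀ x, IsClosed ({x} : Set X) := fun x ↦ by
    obtain ⟨k, rfl⟩ := hs x
    simpa using hc _ (isClosed_singleton (x := k))
  refine ⟨fun x y hxy ↦ ?_⟩
  obtain ⟨U, V, hU, hV, hxU, hyV, hUV⟩ := normal_separation ((hsing x).preimage hf)
    ((hsing y).preimage hf) (disjoint_singleton.2 hxy |>.preimage f)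
  refine ⟨(f '' Uᶜ)ᶜ, (f '' Vᶜ)ᶜ, (hc _ hU.isClosed_compl).isOpen_compl,
    (hc _ hV.isClosed_compl).isOpen_compl, ?_, ?_, ?_⟩
  · rintro ⟨k, hk, rfl⟩; exact hk (hxU rfl)
  · rintro ⟨k, hk, rfl⟩; exact hk (hyV rfl)
  · rw [disjoint_left]
    intro z h1 h2
    obtain ⟨k, rfl⟩ := hs z
    have hkU : k ∈ U := by_contra fun h ↦ h1 ⟨k, h, rfl⟩
    have hkV : k ∈ V := by_contra fun h ↦ h2 ⟨k, h, rfl⟩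
    exact disjoint_left.1 hUV hkU hkV

namespace FSplitting

variable {μ : ℕ} (S : FSplitting.{u} μ)

open Classical in
/-- A normal form for the points of `X`. -/
noncomputable def normalForm : S.Pre → S.Pre
  | .inl (⟨i, y⟩, t) =>
    if (t : ℝ) = -1 then .inr (S.αminus i y) else
    if (t : ℝ) = 1 then .inr (S.αplus i y) else .inl (⟨i, y⟩, t)
  | .inr z => .inr z

lemma tube_neg_one (i : Fin μ) (y : S.Y i) {t : Icc (-1 : ℝ) 1} (ht : (t : ℝ) = -1) :
    S.tube i y t = S.base (S.αminus i y) := by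
  obtain rfl : t = ⟨-1, by norm_num⟩ := Subtype.ext ht
  exact Quot.sound (Rel.minus i y)

lemma tube_one (i : Fin μ) (y : S.Y i) {t : Icc (-1 : ℝ) 1} (ht : (t : ℝ) = 1) :
    S.tube i y t = S.base (S.αplus i y) := by
  obtain rfl : t = ⟨1, by norm_num⟩ := Subtype.ext ht
  exact Quot.sound (Rel.plus i y)

lemma mk_normalForm (p : S.Pre) : Quot.mk S.Rel (S.normalForm p) = Quot.mk S.Rel p := by
  rcases p with ⟨⟨i, y⟩, t⟩ | z
  · simp only [normalForm]
    split_ifs with h1 h2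
    · exact (S.tube_neg_one i y h1).symm
    · exact (S.tube_one i y h2).symm
    · rfl
  · rfl

/-- The normal form moves the ends of the tubes to their attaching points and is constant along
`Rel`. It thus decides equality in the quotient without any description of the generated equivalence
relation. -/
lemma mk_eq_mk_iff {p q : S.Pre} :
    Quot.mk S.Rel p = Quot.mk S.Rel q ↔ S.normalForm p = S.normalForm q := by
  constructor
  · intro h
    have key : ∀ p q, S.Rel p q → S.normalForm p = S.normalForm q := by
      rintro _ _ (⟨i, y⟩ | ⟨i, y⟩)
      · simp [normalForm]
      · simp only [normalForm, ite_eq_right_iff]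
        norm_num
    exact congrArg (Quot.lift S.normalForm key) h
  · intro h
    rw [← S.mk_normalForm p, h, S.mk_normalForm]

lemma normalForm_tube {i : Fin μ} {y : S.Y i} {t : Icc (-1 : ℝ) 1} (ht : |(t : ℝ)| < 1) :
    S.normalForm (.inl (⟨i, y⟩, t)) = .inl (⟨i, y⟩, t) := by
  rw [abs_lt] at ht
  simp only [normalForm]
  rw [if_neg ht.1.ne', if_neg ht.2.ne]

lemma base_injective : Function.Injective S.base := fun _ _ h ↦
  Sum.inr_injective (S.mk_eq_mk_iff.1 h)

lemma tube_ne_base {i : Fin μ} {y : S.Y i} {t : Icc (-1 : ℝ) 1} (ht : |(t : ℝ)| < 1) (z : S.Z) :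
    S.tube i y t ≠ S.base z := fun h ↦ by
  have := S.mk_eq_mk_iff.1 h
  rw [S.normalForm_tube ht] at this
  exact Sum.inl_ne_inr this

lemma tube_eq_tube {i j : Fin μ} {y : S.Y i} {y' : S.Y j} {t t' : Icc (-1 : ℝ) 1}
    (ht : |(t : ℝ)| < 1) (ht' : |(t' : ℝ)| < 1) (h : S.tube i y t = S.tube j y' t') :
    (⟨i, y⟩ : Σ i, S.Y i) = ⟨j, y'⟩ ∧ t = t' := by
  have := S.mk_eq_mk_iff.1 h
  rw [S.normalForm_tube ht, S.normalForm_tube ht'] at this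
  exact Prod.mk.inj (Sum.inl_injective this)

lemma base_or_tube (p : S.X) : (∃ z, p = S.base z) ∨
    ∃ (i : Fin μ) (y : S.Y i) (t : Icc (-1 : ℝ) 1), |(t : ℝ)| < 1 ∧ p = S.tube i y t := by
  obtain ⟨⟨⟨i, y⟩, t⟩ | z, rfl⟩ := Quot.exists_rep p
  · rcases lt_or_eq_of_le (abs_le.2 t.2) with h | h
    · exact Or.inr ⟨i, y, t, h, rfl⟩
    · rcases (abs_eq zero_le_one).1 h with h | h
      · exact Or.inl ⟨_, S.tube_one i y h⟩
      · exact Or.inl ⟨_, S.tube_neg_one i y h⟩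
  · exact Or.inl ⟨z, rfl⟩

/-- The inclusion of `Z` as a continuous map. -/
def baseMap : C(S.Z, S.X) := ⟨S.base, continuous_quot_mk.comp continuous_inr⟩

/-- The map `Y_i × [-1, 1] → X` as a continuous map. -/
def tubeMap (i : Fin μ) : C(S.Y i × Icc (-1 : ℝ) 1, S.X) :=
  ⟨fun p ↦ S.tube i p.1 p.2, continuous_quot_mk.comp (continuous_inl.comp
    ((continuous_sigmaMk.comp continuous_fst).prodMk continuous_snd))⟩

lemma isClosed_iff {A : Set S.X} : IsClosed A ↔ IsClosed (S.base ⁻¹' A) ∧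
    ∀ i, IsClosed ((fun p : S.Y i × Icc (-1 : ℝ) 1 ↦ S.tube i p.1 p.2) ⁻¹' A) := by
  constructor
  · exact fun h ↦ ⟨h.preimage S.baseMap.continuous, fun i ↦ h.preimage (S.tubeMap i).continuous⟩
  · rintro ⟨h1, h2⟩
    refine (isQuotientMap_quot_mk (r := S.Rel)).isClosed_preimage.1 (isClosed_sum_iff.2 ?_)
    refine ⟨?_, h1⟩
    rw [← (Homeomorph.sigmaProdDistrib (X := S.Y) (Y := Icc (-1 : ℝ) 1)).symm.isClosed_preimage,
      isClosed_sigma_iff]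
    exact h2

/-- The saturation of a closed `A` is computed by hand. On `Z` it adds to `A` the images under the
attaching maps of the parts of `A` at the ends of the tubes. On a tube it adds the end points whose
attaching points are already reached. Closed attaching maps and finiteness of the index set keep
both sets closed. No compactness enters, so this applies to `X(∞)` as well. -/
lemma isClosedMap_mk (hm : ∀ i, IsClosedMap (S.αminus i)) (hp : ∀ i, IsClosedMap (S.αplus i)) :
    IsClosedMap (Quot.mk S.Rel : S.Pre → S.X) := by
  intro A hA
  have hA1 : ∀ i, IsClosed {p : S.Y i × Icc (-1 : ℝ) 1 | Sum.inl (⟨i, p.1⟩, p.2) ∈ A} := fun i ↦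
    hA.preimage (continuous_inl.comp
      ((continuous_sigmaMk.comp continuous_fst).prodMk continuous_snd))
  have hm' : ∀ i, IsClosed (S.αminus i '' {y | Sum.inl (⟨i, y⟩, ⟨-1, by norm_num⟩) ∈ A}) := fun i ↦
    hm i _ ((hA1 i).preimage (continuous_id.prodMk continuous_const))
  have hp' : ∀ i, IsClosed (S.αplus i '' {y | Sum.inl (⟨i, y⟩, ⟨1, by norm_num⟩) ∈ A}) := fun i ↦
    hp i _ ((hA1 i).preimage (continuous_id.prodMk continuous_const))
  have hbase : S.base ⁻¹' (Quot.mk S.Rel '' A) = Sum.inr ⁻¹' A ∪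
      ((⋃ i, S.αminus i '' {y | Sum.inl (⟨i, y⟩, ⟨-1, by norm_num⟩) ∈ A}) ∪
        ⋃ i, S.αplus i '' {y | Sum.inl (⟨i, y⟩, ⟨1, by norm_num⟩) ∈ A}) := by
    ext z
    constructor
    · rintro ⟨⟨⟨i, y⟩, t⟩ | z', hA', h⟩
      · rcases lt_or_eq_of_le (abs_le.2 t.2) with ht | ht
        · exact (S.tube_ne_base ht z h).elim
        · rcases (abs_eq zero_le_one).1 ht with ht | ht
          · obtain rfl : t = ⟨1, by norm_num⟩ := Subtype.ext ht
            exact Or.inr (Or.inr (mem_iUnion.2 ⟨i, y, hA',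
              S.base_injective ((S.tube_one i y rfl).symm.trans h)⟩))
          · obtain rfl : t = ⟨-1, by norm_num⟩ := Subtype.ext ht
            exact Or.inr (Or.inl (mem_iUnion.2 ⟨i, y, hA',
              S.base_injective ((S.tube_neg_one i y rfl).symm.trans h)⟩))
      · obtain rfl := S.base_injective h
        exact Or.inl hA'
    · rintro (h | h | h)
      · exact ⟨_, h, rfl⟩
      · obtain ⟨i, y, hy, rfl⟩ := mem_iUnion.1 h
        exact ⟨_, hy, S.tube_neg_one i y rfl⟩
      · obtain ⟨i, y, hy, rfl⟩ := mem_iUnion.1 h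
        exact ⟨_, hy, S.tube_one i y rfl⟩
  have hbase' : IsClosed (S.base ⁻¹' (Quot.mk S.Rel '' A)) := by
    rw [hbase]
    exact (hA.preimage continuous_inr).union
      ((isClosed_iUnion_of_finite hm').union (isClosed_iUnion_of_finite hp'))
  refine S.isClosed_iff.2 ⟨hbase', fun i ↦ ?_⟩
  have : (fun p : S.Y i × Icc (-1 : ℝ) 1 ↦ S.tube i p.1 p.2) ⁻¹' (Quot.mk S.Rel '' A) =
      {p | Sum.inl (⟨i, p.1⟩, p.2) ∈ A} ∪
      (({p | S.αminus i p.1 ∈ S.base ⁻¹' (Quot.mk S.Rel '' A)} ∩ {p | (p.2 : ℝ) = -1}) ∪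
      ({p | S.αplus i p.1 ∈ S.base ⁻¹' (Quot.mk S.Rel '' A)} ∩ {p | (p.2 : ℝ) = 1})) := by
    ext ⟨y, t⟩
    simp only [mem_preimage, mem_union, mem_inter_iff, mem_ofPred_eq]
    constructor
    · intro h
      rcases lt_or_eq_of_le (abs_le.2 t.2) with ht | ht
      · left
        obtain ⟨⟨⟨j, y'⟩, t'⟩ | z', hA', h⟩ := h
        · rcases lt_or_eq_of_le (abs_le.2 t'.2) with ht' | ht'
          · obtain ⟨h1, rfl⟩ := S.tube_eq_tube ht' ht h
            rwa [h1] at hA'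
          · rcases (abs_eq zero_le_one).1 ht' with ht' | ht'
            · exact (S.tube_ne_base ht _ (h.symm.trans (S.tube_one j y' ht'))).elim
            · exact (S.tube_ne_base ht _ (h.symm.trans (S.tube_neg_one j y' ht'))).elim
        · exact (S.tube_ne_base ht _ h.symm).elim
      · right
        rcases (abs_eq zero_le_one).1 ht with ht | ht
        · right; rw [S.tube_one i y ht] at h; exact ⟨h, ht⟩
        · left; rw [S.tube_neg_one i y ht] at h; exact ⟨h, ht⟩
    · rintro (h | h | h)
      · exact ⟨_, h, rfl⟩
      · rw [S.tube_neg_one i y h.2]; exact h.1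
      · rw [S.tube_one i y h.2]; exact h.1
  refine this ▸ (hA1 i).union (IsClosed.union ?_ ?_)
  · exact (hbase'.preimage ((S.αminus i).continuous.comp continuous_fst)).inter
      (isClosed_eq (by fun_prop) continuous_const)
  · exact (hbase'.preimage ((S.αplus i).continuous.comp continuous_fst)).inter
      (isClosed_eq (by fun_prop) continuous_const)

lemma t2Space [∀ i, CompactSpace (S.Y i)] [∀ i, T2Space (S.Y i)] [CompactSpace S.Z]
    [T2Space S.Z] : T2Space S.X :=
  t2Space_of_isClosedMap continuous_quot_mk Quot.mk_surjective
    (S.isClosedMap_mk (fun i ↦ (S.αminus i).continuous.isClosedMap)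
      fun i ↦ (S.αplus i).continuous.isClosedMap)

/-! ### Cells of `Y × [-1, 1] ∪ Z` -/

section Cells

variable (A : ∀ i, CellStructure (S.Y i)) (B : CellStructure S.Z)
  (D : CellStructure (Icc (-1 : ℝ) 1)) (J : Set D.ι)

/-- The characteristic map of a cell in `Y × (-1, 1)`. -/
def tubeCellMap (i : Fin μ) (c : (A i).ι) (d : D.ι) :
    C(Fin ((A i).dim c + D.dim d) → ℝ, S.X) := (S.tubeMap i).comp ((A i).prodMap D c d)

lemma tubeCellMap_image (i : Fin μ) (c : (A i).ι) (d : D.ι) :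
    S.tubeCellMap A D i c d '' ball 0 1 =
      S.tubeMap i '' ((A i).openCell c ×ˢ D.openCell d) := by
  rw [← CellStructure.prodMap_image_ball, image_image]
  rfl

variable {D J} in
/-- The cell structure on `X` given by cell structures on `Y`, on `Z` and on `[-1, 1]`. -/
abbrev cells (hJ : ∀ d, ∀ t ∈ D.openCell d, d ∈ J ↔ |(t : ℝ)| < 1)
    (hm : ∀ i c, ∀ y ∈ (A i).openCell c, ∃ d, B.dim d ≤ (A i).dim c ∧
      S.αminus i y ∈ B.openCell d)
    (hp : ∀ i c, ∀ y ∈ (A i).openCell c, ∃ d, B.dim d ≤ (A i).dim c ∧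
      S.αplus i y ∈ B.openCell d) : CellStructure S.X where
  ι := B.ι ⊕ Σ i, (A i).ι × J
  dim := Sum.elim B.dim fun c ↦ (A c.1).dim c.2.1 + D.dim c.2.2
  map
    | .inl c => S.baseMap.comp (B.map c)
    | .inr c => S.tubeCellMap A D c.1 c.2.1 c.2.2
  injOn
    | .inl c => fun x hx y hy h ↦ B.injOn c hx hy (S.base_injective h)
    | .inr ⟨i, c, d⟩ => fun x hx y hy h ↦ by
      refine (A i).prodMap_injOn D c d hx hy ?_
      have key : ∀ z ∈ ball (0 : Fin ((A i).dim c + D.dim d) → ℝ) 1,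
          |(((A i).prodMap D c d z).2 : ℝ)| < 1 := fun z hz ↦
        (hJ d _ ((CellStructure.prodMap_image_ball (A i) D c d).subset
          (mem_image_of_mem _ hz)).2).1 d.2
      obtain ⟨h1, h2⟩ := S.tube_eq_tube (key x hx) (key y hy) h
      exact Prod.ext (eq_of_heq (Sigma.mk.inj h1).2) h2
  eq_of_mem := by
    have key : ∀ c z (_ : z ∈ ball (0 : Fin (B.dim c) → ℝ) 1) i c' (d : J),
        S.base (B.map c z) ∉ S.tubeCellMap A D i c' d '' ball 0 1 := by
      intro c z _ i c' d h
      rw [tubeCellMap_image] at h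
      obtain ⟨⟨y, t⟩, ⟨_, ht⟩, h⟩ := h
      exact S.tube_ne_base ((hJ d _ ht).1 d.2) _ h
    rintro (c | ⟨i, c, d⟩) (c' | ⟨i', c', d'⟩) p h h'
    · obtain ⟨x, hx, rfl⟩ := h
      obtain ⟨y, hy, h⟩ := h'
      rw [B.eq_of_mem_openCell (B.map_mem_openCell hx)
        (S.base_injective h ▸ B.map_mem_openCell hy)]
    · obtain ⟨x, hx, rfl⟩ := h
      exact (key c x hx i' c' d' h').elim
    · obtain ⟨x, hx, rfl⟩ := h'
      exact (key c' x hx i c d h).elim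
    · replace h := (S.tubeCellMap_image A D i c d).subset h
      replace h' := (S.tubeCellMap_image A D i' c' d').subset h'
      obtain ⟨⟨y, t⟩, ⟨hy, ht⟩, rfl⟩ := h
      obtain ⟨⟨y', t'⟩, ⟨hy', ht'⟩, h⟩ := h'
      obtain ⟨h1, rfl⟩ := S.tube_eq_tube ((hJ d' _ ht').1 d'.2) ((hJ d _ ht).1 d.2) h
      obtain ⟨rfl, h1⟩ := Sigma.mk.inj h1
      obtain rfl := eq_of_heq h1
      obtain rfl := (A _).eq_of_mem_openCell hy hy'
      obtain rfl := Subtype.ext (D.eq_of_mem_openCell ht ht')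
      rfl
  cover p := by
    rcases S.base_or_tube p with ⟨z, rfl⟩ | ⟨i, y, t, ht, rfl⟩
    · obtain ⟨c, x, hx, rfl⟩ := B.exists_mem_openCell z
      exact ⟨.inl c, x, hx, rfl⟩
    · obtain ⟨c, hc⟩ := (A i).exists_mem_openCell y
      obtain ⟨d, hd⟩ := D.exists_mem_openCell t
      exact ⟨.inr ⟨i, c, d, (hJ d t hd).2 ht⟩,
        (S.tubeCellMap_image A D i c d).superset ⟨(y, t), ⟨hc, hd⟩, rfl⟩⟩
  boundary := by
    rintro (c | ⟨i, c, d⟩) x hx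
    · obtain ⟨j, hj, y, hy, h⟩ := B.boundary c x hx
      exact ⟨.inl j, hj, y, hy, congrArg S.base h⟩
    · obtain ⟨⟨c', d'⟩, hdim, h⟩ := ((A i).prod D).boundary (c, d) x hx
      rw [CellStructure.prodMap_image_ball] at h
      by_cases hd' : d' ∈ J
      · exact ⟨.inr ⟨i, c', d', hd'⟩, hdim, (S.tubeCellMap_image A D i c' d').superset ⟨_, h, rfl⟩⟩
      -- Here the boundary point sits at an end of the tube and is a point of `Z`. The attaching
      -- maps do not raise the dimension of cells, so its cell is still of lower dimension.
      · have h1 := fun h' ↦ hd' ((hJ d' _ h.2).2 h')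
        have h2 : |(((A i).prodMap D c d x).2 : ℝ)| = 1 :=
          le_antisymm (abs_le.2 ((A i).prodMap D c d x).2.2) (not_lt.1 h1)
        rcases (abs_eq zero_le_one).1 h2 with h2 | h2
        · obtain ⟨e, he, y, hy, hye⟩ := hp i c' _ h.1
          refine ⟨.inl e, he.trans_lt (lt_of_le_of_lt (Nat.le_add_right _ _) hdim), y, hy, ?_⟩
          exact (congrArg S.base hye).trans (S.tube_one i _ h2).symm
        · obtain ⟨e, he, y, hy, hye⟩ := hm i c' _ h.1
          refine ⟨.inl e, he.trans_lt (lt_of_le_of_lt (Nat.le_add_right _ _) hdim), y, hy, ?_⟩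
          exact (congrArg S.base hye).trans (S.tube_neg_one i _ h2).symm

end Cells

end FSplitting

/-! ### Cell structures on the interval -/

/-- The affine map from `[-1, 1]` to `[0, 1]`, extended continuously to `ℝ`. -/
noncomputable def toUnit : C(ℝ, ℝ) := ⟨fun s ↦ (1 + max (-1) (min 1 s)) / 2, by fun_prop⟩

lemma toUnit_of_mem {s : ℝ} (hs : |s| ≤ 1) : toUnit s = (1 + s) / 2 := by
  rw [abs_le] at hs
  simp [toUnit, hs.1, hs.2]

lemma toUnit_mem (s : ℝ) : 0 ≤ toUnit s ∧ toUnit s ≤ 1 := by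
  have h1 : -1 ≤ max (-1) (min 1 s) := le_max_left _ _
  have h2 : max (-1) (min 1 s) ≤ 1 := max_le (by norm_num) (min_le_left _ _)
  simp only [toUnit, ContinuousMap.coe_mk]
  constructor <;> linarith

lemma toUnit_mem_Ioo {s : ℝ} (hs : |s| < 1) : 0 < toUnit s ∧ toUnit s < 1 := by
  rw [toUnit_of_mem hs.le]
  rw [abs_lt] at hs
  constructor <;> linarith

lemma toUnit_neg_one : toUnit (-1) = 0 := by rw [toUnit_of_mem (by simp)]; norm_num

lemma toUnit_one : toUnit 1 = 1 := by rw [toUnit_of_mem (by simp)]; norm_num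

lemma toUnit_inj {s t : ℝ} (hs : |s| < 1) (ht : |t| < 1) (h : toUnit s = toUnit t) : s = t := by
  rw [toUnit_of_mem hs.le, toUnit_of_mem ht.le] at h
  linarith

lemma toUnit_surj {r : ℝ} (h0 : 0 < r) (h1 : r < 1) : ∃ s, |s| < 1 ∧ toUnit s = r := by
  have : |2 * r - 1| < 1 := by rw [abs_lt]; constructor <;> linarith
  exact ⟨2 * r - 1, this, by rw [toUnit_of_mem this.le]; ring⟩

/-- The sign `±1` of a Boolean. -/
def boolSign (b : Bool) : ℝ := if b then 1 else -1

@[simp] lemma boolSign_true : boolSign true = 1 := rfl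

@[simp] lemma boolSign_false : boolSign false = -1 := rfl

lemma abs_boolSign (b : Bool) : |boolSign b| = 1 := by cases b <;> simp

lemma boolSign_mul_mem {b : Bool} {r : ℝ} (h0 : 0 ≤ r) (h1 : r ≤ 1) :
    boolSign b * r ∈ Icc (-1 : ℝ) 1 := by
  rw [mem_Icc, ← abs_le, abs_mul, abs_boolSign, one_mul, abs_of_nonneg h0]
  exact h1

lemma boolSign_mul_inj {b c : Bool} {r s : ℝ} (hr : 0 < r) (hs : 0 < s)
    (h : boolSign b * r = boolSign c * s) : b = c ∧ r = s := by
  cases b <;> cases c <;> simp at h ⊢ <;> linarith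

/-- The end point `±1` of `[-1, 1]`. -/
def intervalEnd (b : Bool) : Icc (-1 : ℝ) 1 :=
  ⟨boolSign b, by simpa using boolSign_mul_mem (b := b) zero_le_one le_rfl⟩

/-- The retraction of `ℝ` onto `[-1, 1]`. -/
noncomputable def intervalClamp : C(ℝ, Icc (-1 : ℝ) 1) :=
  ⟨projIcc (-1) 1 (by norm_num), continuous_projIcc⟩

lemma coe_intervalClamp {s : ℝ} (hs : |s| ≤ 1) : (intervalClamp s : ℝ) = s := by
  rw [abs_le] at hs
  simp [intervalClamp, projIcc_of_mem _ (show s ∈ Icc (-1 : ℝ) 1 from hs)]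

lemma intervalEnd_injective : Function.Injective intervalEnd := fun b c h ↦
  (boolSign_mul_inj one_pos one_pos (by
    have : boolSign b = boolSign c := congrArg Subtype.val h
    rw [this])).1

lemma abs_intervalEnd (b : Bool) : |(intervalEnd b : ℝ)| = 1 := abs_boolSign b

lemma exists_intervalEnd {t : Icc (-1 : ℝ) 1} (ht : ¬ |(t : ℝ)| < 1) : ∃ b, intervalEnd b = t := by
  have : |(t : ℝ)| = 1 := le_antisymm (abs_le.2 t.2) (not_lt.1 ht)
  rcases (abs_eq zero_le_one).1 this with h | h
  · exact ⟨true, Subtype.ext h.symm⟩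
  · exact ⟨false, Subtype.ext h.symm⟩

/-- The cell structure on `[-1, 1]` with one edge. -/
noncomputable abbrev intervalCells : CellStructure (Icc (-1 : ℝ) 1) :=
  CellStructure.ofGraph (V := Bool) (E := Unit) intervalEnd (fun _ ↦ intervalClamp)
    intervalEnd_injective
    (fun hs ht h ↦ ⟨rfl, by
      have := congrArg Subtype.val h
      rwa [coe_intervalClamp hs.le, coe_intervalClamp ht.le] at this⟩)
    (fun {_ s w} hs h ↦ by
      have := congrArg Subtype.val h
      rw [coe_intervalClamp hs.le] at this
      rw [this, abs_intervalEnd] at hs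
      exact hs.false)
    (fun t ↦ by
      by_cases ht : |(t : ℝ)| < 1
      · exact Or.inr ⟨(), t, ht, Subtype.ext (coe_intervalClamp ht.le)⟩
      · exact Or.inl (exists_intervalEnd ht))
    (fun _ ↦ ⟨⟨false, Subtype.ext (coe_intervalClamp (s := -1) (by simp)).symm⟩,
      ⟨true, Subtype.ext (coe_intervalClamp (s := 1) (by simp)).symm⟩⟩)

lemma mem_interior_intervalCells (d : intervalCells.ι) (t : Icc (-1 : ℝ) 1)
    (ht : t ∈ intervalCells.openCell d) : d ∈ ({Sum.inr ()} : Set intervalCells.ι) ↔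
      |(t : ℝ)| < 1 := by
  obtain ⟨x, hx, rfl⟩ := ht
  rcases d with b | ⟨⟨⟩⟩
  · simp only [mem_singleton_iff, reduceCtorEq, false_iff, not_lt]
    exact (abs_intervalEnd b).ge
  · have := mem_ball_cube.1 hx (0 : Fin 1)
    refine iff_of_true rfl ?_
    change |(intervalClamp (x (0 : Fin 1)) : ℝ)| < 1
    rwa [coe_intervalClamp this.le]

lemma mem_openCell_intervalCells {t : Icc (-1 : ℝ) 1} (ht : |(t : ℝ)| < 1) :
    t ∈ intervalCells.openCell (Sum.inr ()) :=
  ⟨fun _ ↦ t, mem_ball_cube.2 fun _ ↦ ht, Subtype.ext (coe_intervalClamp ht.le)⟩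

/-- The half edges of `[-1, 1]`. -/
noncomputable def halfInterval (b : Bool) : C(ℝ, Icc (-1 : ℝ) 1) :=
  ⟨fun s ↦ ⟨boolSign b * toUnit s, boolSign_mul_mem (toUnit_mem s).1 (toUnit_mem s).2⟩, by fun_prop⟩

/-- The vertices of the subdivided interval. -/
def subdividedVertex (w : Option Bool) : Icc (-1 : ℝ) 1 := w.elim ⟨0, by norm_num⟩ intervalEnd

/-- The cell structure on `[-1, 1]` with two edges. -/
noncomputable abbrev subdividedCells : CellStructure (Icc (-1 : ℝ) 1) :=
  CellStructure.ofGraph (V := Option Bool) (E := Bool) subdividedVertex halfInterval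
    (by
      rintro (_ | b) (_ | c) h
      · rfl
      · have := abs_intervalEnd c
        rw [show intervalEnd c = ⟨0, by norm_num⟩ from h.symm] at this
        simp at this
      · have := abs_intervalEnd b
        rw [show intervalEnd b = ⟨0, by norm_num⟩ from h] at this
        simp at this
      · exact congrArg some (intervalEnd_injective h))
    (fun {b c s t} hs ht h ↦ by
      obtain ⟨h1, h2⟩ := boolSign_mul_inj (toUnit_mem_Ioo hs).1 (toUnit_mem_Ioo ht).1
        (congrArg Subtype.val h)
      exact ⟨h1, toUnit_inj hs ht h2⟩)
    (fun {b s w} hs h ↦ by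
      have h' := congrArg (fun t : Icc (-1 : ℝ) 1 ↦ |(t : ℝ)|) h
      have hs' := toUnit_mem_Ioo hs
      simp only [halfInterval, ContinuousMap.coe_mk, abs_mul, abs_boolSign, one_mul,
        abs_of_pos hs'.1] at h'
      rcases w with _ | w
      · simp [subdividedVertex] at h'; linarith
      · simp only [subdividedVertex, Option.elim_some, abs_intervalEnd] at h'; linarith)
    (fun t ↦ by
      by_cases ht : |(t : ℝ)| < 1
      · rcases lt_trichotomy (t : ℝ) 0 with h | h | h
        · rw [abs_of_neg h] at ht
          obtain ⟨s, hs, hs'⟩ := toUnit_surj (neg_pos.2 h) ht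
          exact Or.inr ⟨false, s, hs, Subtype.ext (by simp [halfInterval, hs'])⟩
        · exact Or.inl ⟨none, Subtype.ext h.symm⟩
        · rw [abs_of_pos h] at ht
          obtain ⟨s, hs, hs'⟩ := toUnit_surj h ht
          exact Or.inr ⟨true, s, hs, Subtype.ext (by simp [halfInterval, hs'])⟩
      · obtain ⟨b, rfl⟩ := exists_intervalEnd ht
        exact Or.inl ⟨some b, rfl⟩)
    (fun b ↦ ⟨⟨none, Subtype.ext (by simp [halfInterval, toUnit_neg_one, subdividedVertex])⟩,
      ⟨some b, Subtype.ext (by simp [halfInterval, toUnit_one, subdividedVertex, intervalEnd])⟩⟩)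

/-- The interior cells of the subdivided interval. -/
def subdividedInterior : Set subdividedCells.ι := {d | ∀ b, d ≠ Sum.inl (some b)}

lemma mem_subdividedInterior (d : subdividedCells.ι) (t : Icc (-1 : ℝ) 1)
    (ht : t ∈ subdividedCells.openCell d) : d ∈ subdividedInterior ↔ |(t : ℝ)| < 1 := by
  obtain ⟨x, hx, rfl⟩ := ht
  rcases d with (_ | b) | b
  · refine iff_of_true (fun b ↦ by simp) ?_
    change |(0 : ℝ)| < 1
    simp
  · refine iff_of_false (fun h ↦ h b rfl) ?_
    change ¬ |(intervalEnd b : ℝ)| < 1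
    simp [abs_intervalEnd]
  · refine iff_of_true (fun b ↦ by simp) ?_
    have := toUnit_mem_Ioo (mem_ball_cube.1 hx (0 : Fin 1))
    change |boolSign b * toUnit (x (0 : Fin 1))| < 1
    rw [abs_mul, abs_boolSign, one_mul, abs_of_pos this.1]
    exact this.2

/-! ### Homotopies out of `Y × [-1, 1] ∪ Z` -/

namespace FSplitting

open unitInterval

variable {μ : ℕ} (S : FSplitting.{u} μ) {T : Type u} [TopologicalSpace T]

/-- A map `Y × [-1, 1] × [0, 1] → T` given by its restrictions to the `Y_i × [-1, 1] × [0, 1]`. -/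
def sigmaCurry (f : ∀ i, C(S.Y i × (Icc (-1 : ℝ) 1 × I), T)) :
    C((Σ i, S.Y i) × Icc (-1 : ℝ) 1, C(I, T)) :=
  ContinuousMap.curry
    ⟨fun p ↦ f p.1.1.1 (p.1.1.2, p.1.2, p.2), by
      -- After currying, continuity on the disjoint union is checked on each `Y_i` separately.
      have h : Continuous fun s : Σ i, S.Y i ↦ (f s.1).curry s.2 :=
        continuous_sigma fun i ↦ (f i).curry.continuous
      have := ContinuousMap.continuous_uncurry_of_continuous ⟨_, h⟩
      exact this.comp (by fun_prop : Continuous fun p : ((Σ i, S.Y i) × Icc (-1 : ℝ) 1) × I ↦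
        (p.1.1, (p.1.2, p.2)))⟩

/-- The homotopy out of `X` determined by compatible homotopies on `Y × [-1, 1]` and on `Z`. -/
def descHomotopy (f : ∀ i, C(S.Y i × (Icc (-1 : ℝ) 1 × I), T)) (k : C(S.Z × I, T))
    (hm : ∀ i y s, f i (y, ⟨-1, by norm_num⟩, s) = k (S.αminus i y, s))
    (hp : ∀ i y s, f i (y, ⟨1, by norm_num⟩, s) = k (S.αplus i y, s)) : C(I × S.X, T) :=
  -- The homotopy descends to the quotient as a map into the path space and is uncurried there,
  -- which is continuous because the interval is locally compact.
  (ContinuousMap.uncurry (S.desc (S.sigmaCurry f) k.curry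
    (fun i y ↦ ContinuousMap.ext fun s ↦ hm i y s)
    fun i y ↦ ContinuousMap.ext fun s ↦ hp i y s)).comp ⟨Prod.swap, continuous_swap⟩

variable {S} in
lemma induction_X {p : S.X → Prop} (hb : ∀ z, p (S.base z)) (ht : ∀ i y t, p (S.tube i y t)) :
    ∀ x, p x := by
  rintro ⟨⟨⟨i, y⟩, t⟩ | z⟩
  · exact ht i y t
  · exact hb z

end FSplitting

/-! ### Mapping cylinders -/

section MapCylinder

open unitInterval

variable {X W : Type u} [TopologicalSpace X] [TopologicalSpace W]

/-- The mapping cylinder of `h : X → W`, with `X` at the end `1` and `W` at the end `-1`. -/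
abbrev mapCylinder (h : C(X, W)) : FSplitting.{u} 1 where
  Y _ := X
  Z := X ⊕ W
  αminus _ := ⟨Sum.inr ∘ h, by fun_prop⟩
  αplus _ := ⟨Sum.inl, continuous_inl⟩

variable (h : C(X, W))

/-- The inclusion of the domain in the mapping cylinder. -/
def cylinderInl : C(X, (mapCylinder h).X) := (mapCylinder h).baseMap.comp ⟨Sum.inl, continuous_inl⟩

/-- The inclusion of the codomain in the mapping cylinder. -/
def cylinderInr : C(W, (mapCylinder h).X) := (mapCylinder h).baseMap.comp ⟨Sum.inr, continuous_inr⟩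

/-- The projection of the mapping cylinder onto the codomain. -/
def cylinderProj : C((mapCylinder h).X, W) :=
  (mapCylinder h).desc ⟨fun q ↦ h q.1.2,
      h.continuous.comp ((continuous_sigma fun _ ↦ continuous_id :
        Continuous fun s : (Σ _ : Fin 1, X) ↦ s.2).comp continuous_fst)⟩
    ⟨Sum.elim h id, h.continuous.sumElim continuous_id⟩ (fun _ _ ↦ rfl) (fun _ _ ↦ rfl)

lemma cylinderProj_comp_inl : (cylinderProj h).comp (cylinderInl h) = h := rfl

/-- The linear homotopy from the identity of `[-1, 1]` to the constant map `-1`. -/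
def slideDown (p : Icc (-1 : ℝ) 1 × I) : Icc (-1 : ℝ) 1 :=
  ⟨(1 - p.2) * p.1 - p.2, by
    have h1 := p.1.2; have h2 := p.2.2
    simp only [mem_Icc] at h1 h2 ⊢
    constructor <;> nlinarith⟩

lemma continuous_slideDown : Continuous slideDown := by unfold slideDown; fun_prop

lemma cylinderInr_comp_proj_homotopic :
    ((cylinderInr h).comp (cylinderProj h)).Homotopic (ContinuousMap.id _) := by
  -- The copy of `X` in `Z` is the end `1` of the cylinder and has to move along with it; `K` is its
  -- track.
  let K : C(X × I, (mapCylinder h).X) := ((mapCylinder h).tubeMap 0).comp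
    ⟨fun p ↦ (p.1, slideDown (intervalEnd true, p.2)), by
      have := continuous_slideDown; fun_prop⟩
  let H := (mapCylinder h).descHomotopy
    (fun i ↦ ((mapCylinder h).tubeMap i).comp
      ⟨fun p ↦ (p.1, slideDown p.2), continuous_fst.prodMk (continuous_slideDown.comp continuous_snd)⟩)
    (ContinuousMap.uncurry ⟨Sum.elim K.curry fun w ↦ ContinuousMap.const I (cylinderInr h w),
      K.curry.continuous.sumElim
        (ContinuousMap.continuous_of_continuous_uncurry _
          ((cylinderInr h).continuous.comp continuous_fst))⟩)
    (fun i y s ↦ (mapCylinder h).tube_neg_one i y (by simp [slideDown]))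
    (fun i y s ↦ by rw [Subsingleton.elim i 0]; rfl)
  refine ContinuousMap.Homotopic.symm ⟨⟨H, ?_, ?_⟩⟩
  · refine FSplitting.induction_X ?_ ?_
    · rintro (x | w)
      · exact (mapCylinder h).tube_one 0 x (by simp [slideDown, intervalEnd])
      · rfl
    · intro i y t
      exact congrArg ((mapCylinder h).tube i y) (Subtype.ext (by simp [slideDown]))
  · refine FSplitting.induction_X ?_ ?_
    · rintro (x | w)
      · exact (mapCylinder h).tube_neg_one 0 x (by simp [slideDown])
      · rfl
    · intro i y t
      exact (mapCylinder h).tube_neg_one i y (by simp [slideDown])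

variable (A : CellStructure X) (B : CellStructure W)
  (hA : ∀ c, ∀ x ∈ A.openCell c, ∃ d, B.dim d ≤ A.dim c ∧ h x ∈ B.openCell d)

/-- The cell structure of the mapping cylinder of a cellular map. -/
noncomputable abbrev cylinderCells : CellStructure (mapCylinder h).X :=
  (mapCylinder h).cells (fun _ ↦ A) (A.sum B) mem_interior_intervalCells
    (fun _ c x hx ↦ by
      obtain ⟨d, hd, hd'⟩ := hA c x hx
      exact ⟨Sum.inr d, hd, (CellStructure.sum_openCell_inr A B d).superset (mem_image_of_mem _ hd')⟩)
    (fun _ c x hx ↦ ⟨Sum.inl c, le_rfl,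
      (CellStructure.sum_openCell_inl A B c).superset (mem_image_of_mem _ hx)⟩)

/-- The index of the cell `c × (-1, 1)`. -/
def cylinderIndex (c : A.ι) : (cylinderCells h A B hA).ι := Sum.inr ⟨0, c, Sum.inr (), rfl⟩

lemma cylinder_openCell_index (c : A.ι) :
    (cylinderCells h A B hA).openCell (cylinderIndex h A B hA c) =
      (mapCylinder h).tubeMap 0 '' (A.openCell c ×ˢ intervalCells.openCell (Sum.inr ())) :=
  (mapCylinder h).tubeCellMap_image (fun _ ↦ A) intervalCells 0 c (Sum.inr ())

lemma tube_mem_openCell_cylinder {c : A.ι} {x : X} (hx : x ∈ A.openCell c) {t : Icc (-1 : ℝ) 1}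
    (ht : |(t : ℝ)| < 1) (i : Fin 1) : (mapCylinder h).tube i x t ∈
      (cylinderCells h A B hA).openCell (cylinderIndex h A B hA c) := by
  rw [cylinder_openCell_index, Subsingleton.elim i 0]
  exact ⟨(x, t), ⟨hx, mem_openCell_intervalCells ht⟩, rfl⟩

lemma cylinder_openCell_inl (c : A.ι) :
    (cylinderCells h A B hA).openCell (Sum.inl (Sum.inl c)) = cylinderInl h '' A.openCell c := by
  rw [CellStructure.openCell, CellStructure.openCell, image_image]; rfl

lemma cylinder_openCell_inr (d : B.ι) :
    (cylinderCells h A B hA).openCell (Sum.inl (Sum.inr d)) = cylinderInr h '' B.openCell d := by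
  rw [CellStructure.openCell, CellStructure.openCell, image_image]; rfl

instance [Finite A.ι] [Finite B.ι] : Finite (cylinderCells h A B hA).ι :=
  inferInstanceAs (Finite ((A.ι ⊕ B.ι) ⊕ Σ _ : Fin 1, A.ι × ({Sum.inr ()} : Set (Bool ⊕ Unit))))

lemma cylinder_cases (i : (cylinderCells h A B hA).ι) :
    (∃ c, i = Sum.inl (Sum.inl c)) ∨ (∃ d, i = Sum.inl (Sum.inr d)) ∨
      ∃ c, i = cylinderIndex h A B hA c := by
  rcases i with (c | d) | ⟨k, c, ⟨d, rfl⟩⟩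
  · exact Or.inl ⟨c, rfl⟩
  · exact Or.inr (Or.inl ⟨d, rfl⟩)
  · rw [Subsingleton.elim k 0]
    exact Or.inr (Or.inr ⟨c, rfl⟩)

lemma cylinder_t2Space [CompactSpace X] [T2Space X] [CompactSpace W] [T2Space W] :
    T2Space (mapCylinder h).X := FSplitting.t2Space _

/-- Match each cell `c` at the domain end with `c × (-1, 1)`, in order of increasing dimension. The
top face of `c × [-1, 1]` is the free cell `c`, the bottom goes to `W`, and the sides lie over cells
of lower dimension. -/
lemma isFormalInclusion_cylinderInr [T2Space X] [T2Space W] [T2Space (mapCylinder h).X]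
    [Finite A.ι] [Finite B.ι] :
    IsFormalInclusion B.toFiniteCW (cylinderCells h A B hA).toFiniteCW (cylinderInr h) := by
  have := B.compactSpace
  set M := cylinderCells h A B hA
  have hrange : M.union (range fun d : B.ι ↦ (Sum.inl (Sum.inr d) : M.ι)) =
      range (cylinderInr h) := by
    ext p
    rw [CellStructure.mem_union]
    constructor
    · rintro ⟨_, ⟨d, rfl⟩, hp⟩
      rw [cylinder_openCell_inr] at hp
      exact image_subset_range _ _ hp
    · rintro ⟨w, rfl⟩
      obtain ⟨d, hd⟩ := B.exists_mem_openCell w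
      refine ⟨_, ⟨d, rfl⟩, ?_⟩
      rw [cylinder_openCell_inr]
      exact mem_image_of_mem _ hd
  refine CellStructure.isFormalInclusion_of_isFormalPair B M (cylinderInr h)
    (fun x y hxy ↦ Sum.inr_injective ((mapCylinder h).base_injective hxy))
    (fun d ↦ Sum.inl (Sum.inr d)) (fun _ ↦ rfl) (fun d ↦ (cylinder_openCell_inr h A B hA d).symm) ?_
  refine M.isFormalPair_of_matching ?_ A.dim (fun c ↦ Sum.inl (Sum.inl c)) (cylinderIndex h A B hA)
    A.dim (fun c ↦ M.map (cylinderIndex h A B hA c)) ?_ ?_ ?_ ?_ ?_ ?_ (fun c ↦ M.isChar_map _)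
    ?_ ?_
  · rw [hrange]
    exact (isCompact_range (cylinderInr h).continuous).isClosed
  · rintro c ⟨d, hd⟩; cases hd
  · rintro c ⟨d, hd⟩; cases hd
  · intro c c' h; cases h
  · intro c c' h; cases h; rfl
  · intro c c' h; cases h; rfl
  · intro i
    rcases cylinder_cases h A B hA i with ⟨c, rfl⟩ | ⟨d, rfl⟩ | ⟨c, rfl⟩
    · exact Or.inr ⟨c, Or.inl rfl⟩
    · exact Or.inl ⟨d, rfl⟩
    · exact Or.inr ⟨c, Or.inr rfl⟩
  · intro c
    refine (M.isChar_map (Sum.inl (Sum.inl c))).congr fun x hx ↦ ?_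
    refine ((mapCylinder h).tube_one 0 _ ?_).trans (congrArg (cylinderInl h) (congrArg (A.map c) ?_))
    · refine (congrArg (fun s ↦ (intervalClamp s : ℝ)) ?_).trans (coe_intervalClamp (s := 1) (by simp))
      exact Fin.snoc_last (α := fun _ ↦ ℝ) 1 x
    · funext k
      exact Fin.snoc_castSucc (α := fun _ ↦ ℝ) 1 x k
  · intro c z hz
    obtain ⟨h1, h2, h3⟩ := mem_sphere_diff_cubeTop.1 hz
    change (mapCylinder h).tube 0 (A.map c (Fin.init z)) (intervalClamp (z (Fin.last _))) ∈ _
    by_cases hm : z (Fin.last _) = -1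
    · rw [(mapCylinder h).tube_neg_one 0 _
        (by rw [coe_intervalClamp h2, hm])]
      refine M.union_mono (fun i hi ↦ Or.inl hi) (hrange.superset ⟨_, rfl⟩)
    · obtain ⟨c', hc', hz'⟩ := A.boundary c (Fin.init z)
        (mem_sphere_zero_iff_norm.2 (h3.resolve_right hm))
      rcases lt_or_eq_of_le h2 with h2' | h2'
      · refine CellStructure.mem_union.2 ⟨cylinderIndex h A B hA c', Or.inr ⟨c', hc', Or.inr rfl⟩, ?_⟩
        exact tube_mem_openCell_cylinder h A B hA hz' (by rwa [coe_intervalClamp h2]) 0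
      · refine CellStructure.mem_union.2 ⟨Sum.inl (Sum.inl c'), Or.inr ⟨c', hc', Or.inl rfl⟩, ?_⟩
        rw [cylinder_openCell_inl, (mapCylinder h).tube_one 0 _
          (by rw [coe_intervalClamp h2]; exact ((abs_eq zero_le_one).1 h2').resolve_right hm)]
        exact mem_image_of_mem _ hz'

/-- A cellular map is a simple homotopy equivalence if the inclusion of its domain into its mapping
cylinder is a formal deformation. -/
theorem isSimpleHomotopyEquiv_of_cylinder [T2Space X] (L : FiniteCW W)
    [T2Space (mapCylinder h).X] [Finite A.ι]
    (hA : ∀ c, ∀ x ∈ A.openCell c, ∃ d, L.toCells.dim d ≤ A.dim c ∧ h x ∈ L.toCells.openCell d)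
    (hinl : IsFormalDeformation A.toFiniteCW (cylinderCells h A L.toCells hA).toFiniteCW
      (cylinderInl h)) : IsSimpleHomotopyEquiv A.toFiniteCW L h := by
  have := L.t2
  obtain ⟨-, r, hr, hr'⟩ := isFormalInclusion_cylinderInr h A L.toCells hA
  refine ⟨(ContinuousMap.id W).comp (r.comp (cylinderInl h)), (hinl.comp hr').comp
    (.iso (CellStructure.isCWIso_toFiniteCW_toCells L)), ?_⟩
  -- Any retraction onto `W` is homotopic to the projection: the identity of the cylinder is
  -- homotopic to `inr ∘ proj`, and `r ∘ inr` is the identity.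
  have h1 : r.Homotopic (cylinderProj h) := by
    have h2 := (ContinuousMap.Homotopic.refl r).comp (cylinderInr_comp_proj_homotopic h)
    rw [← ContinuousMap.comp_assoc, hr, ContinuousMap.id_comp, ContinuousMap.comp_id] at h2
    exact h2.symm
  have h3 := h1.comp (ContinuousMap.Homotopic.refl (cylinderInl h))
  rw [cylinderProj_comp_inl] at h3
  exact h3.symm

end MapCylinder

/-! ### Lifted cells of an `F_μ`-cover -/

namespace FCover

variable {μ : ℕ} {W : Type u} [TopologicalSpace W] (P : FCover μ W)

lemma eq_one_of_smul_eq {g : FreeGroup (Fin μ)} {x : P.E} (h : g • x = x) : g = 1 := by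
  obtain ⟨U, hU, hd⟩ := P.isCover.disjoint x
  exact hd g ⟨x, ⟨x, mem_of_mem_nhds hU, h⟩, mem_of_mem_nhds hU⟩

lemma smul_right_injective (x : P.E) :
    Function.Injective fun g : FreeGroup (Fin μ) ↦ g • x := fun g k h ↦ by
  have : (k⁻¹ * g) • x = x := by
    rw [mul_smul, show g • x = k • x from h, inv_smul_smul]
  exact (inv_mul_eq_one.1 (P.eq_one_of_smul_eq this)).symm

lemma exists_smul_eq {x y : P.E} (h : P.proj x = P.proj y) :
    ∃ g : FreeGroup (Fin μ), g • y = x := P.isCover.apply_eq_iff_mem_orbit.1 h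

instance t2Space_E [T2Space W] : T2Space P.E := by
  refine ⟨fun x y hxy ↦ ?_⟩
  by_cases h : P.proj x = P.proj y
  · exact P.isCover.isCoveringMap.isSeparatedMap x y h hxy
  · obtain ⟨U, V, hU, hV, hx, hy, hUV⟩ := t2_separation h
    exact ⟨_, _, hU.preimage P.continuous_proj, hV.preimage P.continuous_proj, hx, hy,
      hUV.preimage _⟩

/-- Lifting uses the simple connectedness of `ℝⁿ`; it is the reason for extending characteristic
maps from the cube to all of `ℝⁿ`. -/
lemma exists_lift {n : ℕ} (f : C(Fin n → ℝ, W)) :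
    ∃ F : C(Fin n → ℝ, P.E), ∀ x, P.proj (F x) = f x := by
  obtain ⟨e, he⟩ := P.isCover.surjective (f 0)
  obtain ⟨F, ⟨-, hF⟩, -⟩ := P.isCover.isCoveringMap.existsUnique_continuousMap_lifts f 0 e he
  exact ⟨F, congrFun hF⟩

/-- A lift of a map from a Euclidean space. -/
noncomputable def lift {n : ℕ} (f : C(Fin n → ℝ, W)) : C(Fin n → ℝ, P.E) := (P.exists_lift f).choose

@[simp] lemma proj_lift {n : ℕ} (f : C(Fin n → ℝ, W)) (x : Fin n → ℝ) :
    P.proj (P.lift f x) = f x := (P.exists_lift f).choose_spec x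

variable (C : CellStructure W)

/-- The characteristic map of a lifted cell. -/
noncomputable def cellMap (i : C.ι × FreeGroup (Fin μ)) : C(Fin (C.dim i.1) → ℝ, P.E) :=
  ⟨fun x ↦ i.2 • P.lift (C.map i.1) x, (P.continuous_smul _).comp (P.lift _).continuous⟩

lemma proj_cellMap (i : C.ι × FreeGroup (Fin μ)) (x : Fin (C.dim i.1) → ℝ) :
    P.proj (P.cellMap C i x) = C.map i.1 x := by
  simp [cellMap, P.proj_smul]

lemma smul_cellMap (g : FreeGroup (Fin μ)) (i : C.ι × FreeGroup (Fin μ))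
    (x : Fin (C.dim i.1) → ℝ) : g • P.cellMap C i x = P.cellMap C (i.1, g * i.2) x :=
  (mul_smul _ _ _).symm

lemma exists_mem_of_proj_mem {p : P.E} {c : C.ι} (h : P.proj p ∈ C.openCell c) :
    ∃ g, p ∈ P.cellMap C (c, g) '' ball 0 1 := by
  obtain ⟨x, hx, h⟩ := h
  obtain ⟨g, hg⟩ := P.exists_smul_eq (x := p) (y := P.lift (C.map c) x) (by simp [h])
  exact ⟨g, x, hx, hg⟩

/-- The lifted cell structure on the total space. -/
noncomputable abbrev cells : CellStructure P.E where
  ι := C.ι × FreeGroup (Fin μ)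
  dim i := C.dim i.1
  map i := P.cellMap C i
  injOn i x hx y hy h := C.injOn i.1 hx hy (by rw [← P.proj_cellMap, h, P.proj_cellMap])
  eq_of_mem := by
    rintro ⟨c, g⟩ ⟨c', g'⟩ _ ⟨x, hx, rfl⟩ ⟨y, hy, h⟩
    have h' := congrArg P.proj h
    rw [proj_cellMap, proj_cellMap] at h'
    change C.map c' y = C.map c x at h'
    obtain rfl := C.eq_of_mem_openCell (C.map_mem_openCell hy) (h' ▸ C.map_mem_openCell hx)
    obtain rfl := C.injOn _ hy hx h'
    exact congrArg (Prod.mk _) (P.smul_right_injective _ h.symm)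
  cover p := by
    obtain ⟨c, hc⟩ := C.exists_mem_openCell (P.proj p)
    obtain ⟨g, hg⟩ := P.exists_mem_of_proj_mem C hc
    exact ⟨(c, g), hg⟩
  boundary := by
    rintro ⟨c, g⟩ x hx
    obtain ⟨c', hc', h⟩ := C.boundary c x hx
    rw [← P.proj_cellMap C (c, g)] at h
    obtain ⟨g', hg'⟩ := P.exists_mem_of_proj_mem C h
    exact ⟨(c', g'), hc', hg'⟩

lemma proj_mem_openCell {p : P.E} {i : (P.cells C).ι} (h : p ∈ (P.cells C).openCell i) :
    P.proj p ∈ C.openCell i.1 := by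
  obtain ⟨x, hx, rfl⟩ := h
  exact ⟨x, hx, (P.proj_cellMap C i x).symm⟩

lemma smul_mem_openCell {p : P.E} {c : C.ι} {k : FreeGroup (Fin μ)}
    (h : p ∈ (P.cells C).openCell (c, k)) (g : FreeGroup (Fin μ)) :
    g • p ∈ (P.cells C).openCell (c, g * k) := by
  obtain ⟨x, hx, rfl⟩ := h
  exact ⟨x, hx, (P.smul_cellMap C g (c, k) x).symm⟩

lemma smul_mem_closedCell {p : P.E} {c : C.ι} {k : FreeGroup (Fin μ)}
    (h : p ∈ (P.cells C).closedCell (c, k)) (g : FreeGroup (Fin μ)) :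
    g • p ∈ (P.cells C).closedCell (c, g * k) := by
  obtain ⟨x, hx, rfl⟩ := h
  exact ⟨x, hx, (P.smul_cellMap C g (c, k) x).symm⟩

/-- By compactness of `A × B` it is enough to bound the translations near one pair `(a, b)`. If `a`
and `b` lie in different fibres, no translation carries points near `a` to points near `b`. If `b =
k • a`, a neighbourhood of `a` disjoint from its nontrivial translates leaves only `k`. -/
lemma finite_setOf_smul_mem [T2Space W] {A B : Set P.E} (hA : IsCompact A) (hB : IsCompact B) :
    {g : FreeGroup (Fin μ) | ∃ p ∈ A, g • p ∈ B}.Finite := by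
  suffices h : {g : FreeGroup (Fin μ) | ∃ q ∈ A ×ˢ B, g • q.1 = q.2}.Finite by
    refine h.subset ?_
    rintro g ⟨p, hp, hg⟩
    exact ⟨(p, g • p), ⟨hp, hg⟩, rfl⟩
  refine (hA.prod hB).induction_on
    (p := fun S ↦ {g : FreeGroup (Fin μ) | ∃ q ∈ S, g • q.1 = q.2}.Finite) (by simp)
    (fun s t hst h ↦ h.subset fun g ⟨q, hq, hg⟩ ↦ ⟨q, hst hq, hg⟩)
    (fun s t hs ht ↦ (hs.union ht).subset ?_) ?_
  · rintro g ⟨q, hq | hq, hg⟩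
    · exact Or.inl ⟨q, hq, hg⟩
    · exact Or.inr ⟨q, hq, hg⟩
  · rintro ⟨a, b⟩ -
    by_cases h : P.proj a = P.proj b
    · obtain ⟨k, rfl⟩ := P.exists_smul_eq h.symm
      obtain ⟨U, hU, hd⟩ := P.isCover.disjoint a
      refine ⟨U ×ˢ ((fun x : P.E ↦ k⁻¹ • x) ⁻¹' U), mem_nhdsWithin_of_mem_nhds
        (prod_mem_nhds hU ((P.continuous_smul k⁻¹).continuousAt.preimage_mem_nhds
          (by simpa using hU))), (finite_singleton k).subset ?_⟩
      rintro g ⟨⟨x, y⟩, ⟨hx, hy⟩, hg⟩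
      obtain rfl : g • x = y := hg
      have := hd (k⁻¹ * g) ⟨_, ⟨x, hx, mul_smul _ _ _⟩, hy⟩
      exact (inv_mul_eq_one.1 this).symm
    · obtain ⟨U, V, hU, hV, hx, hy, hUV⟩ := t2_separation h
      refine ⟨(P.proj ⁻¹' U) ×ˢ (P.proj ⁻¹' V), mem_nhdsWithin_of_mem_nhds (prod_mem_nhds
        ((hU.preimage P.continuous_proj).mem_nhds hx)
        ((hV.preimage P.continuous_proj).mem_nhds hy)), finite_empty.subset ?_⟩
      rintro g ⟨⟨x, y⟩, ⟨hx, hy⟩, hg⟩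
      obtain rfl : g • x = y := hg
      refine disjoint_left.1 hUV hx ?_
      rw [← P.proj_smul g]
      exact hy

/-- Translating both cells back to the chosen lifts, `g'⁻¹ * g` belongs to a set that is finite
because the finitely many chosen lifts are compact. `N` bounds the norms in this set, so a step to a
touching cell changes the norm by at most `N`. -/
lemma exists_norm_le [T2Space W] [Finite C.ι] : ∃ N : ℕ, ∀ (i j : (P.cells C).ι) (p : P.E),
    p ∈ (P.cells C).closedCell i → p ∈ (P.cells C).openCell j →
    FreeGroup.norm j.2 ≤ FreeGroup.norm i.2 + N := by
  have hfin : (⋃ c : C.ι × C.ι, {g : FreeGroup (Fin μ) | ∃ p ∈ (P.cells C).closedCell (c.1, 1),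
      g • p ∈ (P.cells C).closedCell (c.2, 1)}).Finite :=
    finite_iUnion fun c ↦ P.finite_setOf_smul_mem ((P.cells C).isCompact_closedCell _)
      ((P.cells C).isCompact_closedCell _)
  obtain ⟨N, hN⟩ := (hfin.image FreeGroup.norm).bddAbove
  refine ⟨N, ?_⟩
  rintro ⟨c, g⟩ ⟨c', g'⟩ p hp hp'
  have h1 := P.smul_mem_closedCell C hp g⁻¹
  have h2 := P.smul_mem_closedCell C ((P.cells C).openCell_subset_closedCell _ hp') g'⁻¹
  rw [inv_mul_cancel] at h1 h2
  have := hN (mem_image_of_mem _ (mem_iUnion.2 ⟨(c, c'), g⁻¹ • p, h1, (by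
    rwa [smul_smul, mul_inv_cancel_right] : (g'⁻¹ * g) • g⁻¹ • p ∈ _)⟩))
  change FreeGroup.norm g' ≤ FreeGroup.norm g + N
  calc FreeGroup.norm g' = FreeGroup.norm (g * (g'⁻¹ * g)⁻¹) := by simp
    _ ≤ _ := FreeGroup.norm_mul_le _ _
    _ ≤ _ := by rw [FreeGroup.norm_inv_eq]; exact Nat.add_le_add_left this _

/-! ### Subcomplexes of bounded norm -/

variable {C} in
/-- The cells of norm at most `R`, where the bound depends on the underlying cell of the base. -/
def boundedCells (R : C.ι → ℕ) : Set (C.ι × FreeGroup (Fin μ)) := {i | FreeGroup.norm i.2 ≤ R i.1}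

variable {C} in
/-- The union of the open cells of norm at most `R`. -/
def bounded (R : C.ι → ℕ) : Set P.E := (P.cells C).union (boundedCells R)

variable {C} in
/-- The cells of norm at most `R` form a subcomplex. -/
def IsBound (R : C.ι → ℕ) : Prop :=
  ∀ i ∈ boundedCells (μ := μ) R, (P.cells C).closedCell i ⊆ P.bounded R

lemma exists_isBound [T2Space W] [Finite C.ι] (r : ℕ) :
    ∃ R : C.ι → ℕ, P.IsBound R ∧ ∀ c, r ≤ R c := by
  obtain ⟨N, hN⟩ := P.exists_norm_le C
  obtain ⟨D, hD⟩ := (finite_range C.dim).bddAbove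
  -- A face has lower dimension, which raises its allowance by at least `N`, and its norm exceeds
  -- that of the cell by at most `N`. A constant radius would not give a closed set of cells in
  -- general.
  refine ⟨fun c ↦ r + N * (D - C.dim c), ?_, fun c ↦ Nat.le_add_right _ _⟩
  rintro i hi _ ⟨x, hx, rfl⟩
  by_cases hx' : x ∈ ball 0 1
  · exact CellStructure.mem_union.2 ⟨i, hi, (P.cells C).map_mem_openCell hx'⟩
  obtain ⟨j, hj, h⟩ := (P.cells C).boundary i x (mem_sphere_cube.2 ⟨hx, hx'⟩)
  refine CellStructure.mem_union.2 ⟨j, ?_, h⟩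
  have h1 := hN i j _ ⟨x, hx, rfl⟩ h
  have h2 : FreeGroup.norm i.2 ≤ r + N * (D - C.dim i.1) := hi
  have h3 : D - C.dim i.1 + 1 ≤ D - C.dim j.1 := by
    have : C.dim i.1 ≤ D := hD (mem_range_self _)
    have : C.dim j.1 < C.dim i.1 := hj
    omega
  have h4 := Nat.mul_le_mul_left N h3
  change FreeGroup.norm j.2 ≤ r + N * (D - C.dim j.1)
  rw [mul_add] at h4
  omega

lemma finite_norm_le (n : ℕ) : {g : FreeGroup (Fin μ) | FreeGroup.norm g ≤ n}.Finite :=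
  ((List.finite_length_le (Fin μ × Bool) n).preimage
    FreeGroup.toWord_injective.injOn).subset fun _ hg ↦ hg

variable {C} {R : C.ι → ℕ}

lemma finite_boundedCells [Finite C.ι] : (boundedCells (μ := μ) R).Finite :=
  (finite_iUnion fun c ↦ ((finite_singleton c).prod (finite_norm_le (R c)))).subset fun i hi ↦
    mem_iUnion.2 ⟨i.1, rfl, hi⟩

instance [Finite C.ι] : Finite (boundedCells (μ := μ) R) := finite_boundedCells

lemma mem_bounded {p : P.E} : p ∈ P.bounded R ↔
    ∃ i ∈ boundedCells R, p ∈ (P.cells C).openCell i := CellStructure.mem_union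

lemma mem_boundedCells_of_mem {p : P.E} (hp : p ∈ P.bounded R) {i : (P.cells C).ι}
    (hi : p ∈ (P.cells C).openCell i) : i ∈ boundedCells R := by
  obtain ⟨j, hj, hp⟩ := P.mem_bounded.1 hp
  rwa [(P.cells C).eq_of_mem_openCell hi hp]

variable {P} in
lemma IsBound.eq_iUnion (hR : P.IsBound R) :
    P.bounded R = ⋃ i ∈ boundedCells R, (P.cells C).closedCell i := by
  refine subset_antisymm (fun p hp ↦ ?_) (iUnion₂_subset hR)
  obtain ⟨i, hi, hp⟩ := P.mem_bounded.1 hp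
  exact mem_biUnion hi ((P.cells C).openCell_subset_closedCell i hp)

variable {P} in
lemma IsBound.isCompact [Finite C.ι] (hR : P.IsBound R) : IsCompact (P.bounded R) := by
  rw [hR.eq_iUnion]
  exact finite_boundedCells.isCompact_biUnion fun i _ ↦ (P.cells C).isCompact_closedCell i

lemma proj_image_bounded : P.proj '' P.bounded R = univ := by
  refine eq_univ_of_forall fun w ↦ ?_
  obtain ⟨c, x, hx, rfl⟩ := C.exists_mem_openCell w
  exact ⟨P.cellMap C (c, 1) x, P.mem_bounded.2 ⟨(c, 1), by simp [boundedCells], x, hx, rfl⟩,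
    P.proj_cellMap C (c, 1) x⟩

/-- The cell structure on `V`, for `V` the union of the cells of norm at most `R`. -/
noncomputable abbrev boundedStructure (hR : P.IsBound R) : CellStructure (P.bounded R) :=
  (P.cells C).restrict (P.bounded R) (boundedCells R) (fun _ ↦ P.mem_bounded) hR

/-- The indices of the cells of `V ∩ z_i⁻¹ V`. -/
def yIndex (R : C.ι → ℕ) (i : Fin μ) : Set (C.ι × FreeGroup (Fin μ)) :=
  {c | FreeGroup.norm c.2 ≤ R c.1 ∧ FreeGroup.norm (FreeGroup.of i * c.2) ≤ R c.1}

lemma mem_ySet_bounded (i : Fin μ) (p : P.E) : p ∈ P.ySet (P.bounded R) i ↔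
    ∃ c ∈ yIndex R i, p ∈ (P.cells C).openCell c := by
  rw [ySet, mem_inter_iff, mem_inv_smul_set_iff]
  constructor
  · rintro ⟨h1, h2⟩
    obtain ⟨c, hc, hp⟩ := P.mem_bounded.1 h1
    exact ⟨c, ⟨hc, P.mem_boundedCells_of_mem h2 (P.smul_mem_openCell C (c := c.1) hp _)⟩, hp⟩
  · rintro ⟨c, hc, hp⟩
    exact ⟨P.mem_bounded.2 ⟨c, hc.1, hp⟩,
      P.mem_bounded.2 ⟨(c.1, _), hc.2, P.smul_mem_openCell C (c := c.1) hp _⟩⟩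

/-- The cell structure on `V ∩ z_i⁻¹ V`. -/
noncomputable abbrev yStructure (hR : P.IsBound R) (i : Fin μ) :
    CellStructure (P.ySet (P.bounded R) i) :=
  (P.cells C).restrict (P.ySet (P.bounded R) i) (yIndex R i) (P.mem_ySet_bounded i)
    fun c hc _ hp ↦ ⟨hR c hc.1 hp, mem_inv_smul_set_iff.2
      (hR (c.1, _) hc.2 (P.smul_mem_closedCell C (c := c.1) hp _))⟩

variable {P} in
lemma IsBound.isCompact_ySet [T2Space W] [Finite C.ι] (hR : P.IsBound R) (i : Fin μ) :
    IsCompact (P.ySet (P.bounded R) i) :=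
  hR.isCompact.inter_right <| by
    have : (FreeGroup.of i)⁻¹ • P.bounded R =
        (fun x : P.E ↦ FreeGroup.of i • x) ⁻¹' P.bounded R := by
      ext p; exact mem_inv_smul_set_iff
    rw [this]
    exact hR.isCompact.isClosed.preimage (P.continuous_smul _)

/-- A finite union of lifted cells that contains their closures is a finite subcomplex. -/
lemma isFiniteSubcomplex_of (L : FiniteCW W) {J : Type v} [Finite J] (c : J → Σ n, L.cell n)
    (φ : ∀ j, C(Fin (c j).1 → ℝ, P.E))
    (hφ : ∀ j, ∀ x ∈ closedBall (0 : Fin (c j).1 → ℝ) 1, P.proj (φ j x) = L.charMap (c j).2 x)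
    {V : Set P.E} (ho : ∀ p, p ∈ V ↔ ∃ j, p ∈ φ j '' ball 0 1)
    (hc : ∀ j, φ j '' closedBall 0 1 ⊆ V) : P.IsFiniteSubcomplex L V := by
  let l : J → P.LiftedCell L := fun j ↦
    ⟨(c j).1, (c j).2, (φ j).comp ⟨Subtype.val, continuous_subtype_val⟩, fun x ↦ hφ j x x.2⟩
  have h1 : ∀ j, (l j).openCell = φ j '' ball 0 1 := fun j ↦ by
    ext p
    constructor
    · rintro ⟨x, hx, rfl⟩; exact ⟨x, hx, rfl⟩
    · rintro ⟨x, hx, rfl⟩; exact ⟨⟨x, ball_subset_closedBall hx⟩, hx, rfl⟩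
  have h2 : ∀ j, (l j).closedCell = φ j '' closedBall 0 1 := fun j ↦ by
    ext p
    constructor
    · rintro ⟨x, rfl⟩; exact ⟨x, x.2, rfl⟩
    · rintro ⟨x, hx, rfl⟩; exact ⟨⟨x, hx⟩, rfl⟩
  refine ⟨range l, finite_range l, ?_, ?_⟩
  · ext p
    simp [h1, ho]
  · refine subset_antisymm (fun p hp ↦ ?_) ?_
    · obtain ⟨j, hj⟩ := (ho p).1 hp
      simp only [biUnion_range, h2, mem_iUnion]
      exact ⟨j, image_mono ball_subset_closedBall hj⟩
    · simp only [biUnion_range, h2]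
      exact iUnion_subset hc

lemma isFiniteSubcomplex_bounded {L : FiniteCW W} {R : L.toCells.ι → ℕ} (hR : P.IsBound R) :
    P.IsFiniteSubcomplex L (P.bounded R) := by
  have : Finite (boundedCells (μ := μ) R) := finite_boundedCells (C := L.toCells)
  refine P.isFiniteSubcomplex_of L (J := boundedCells (μ := μ) R) (fun j ↦ j.1.1)
    (fun j ↦ P.cellMap L.toCells j.1) (fun j x hx ↦ ?_) (fun p ↦ ?_) fun j ↦ hR j.1 j.2
  · exact (P.proj_cellMap L.toCells j.1 x).trans (L.charMapExt_apply j.1.1.2 hx)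
  · rw [P.mem_bounded]
    exact ⟨fun ⟨i, hi, h⟩ ↦ ⟨⟨i, hi⟩, h⟩, fun ⟨j, h⟩ ↦ ⟨j.1, j.2, h⟩⟩

end FCover

/-! ### The cell structure of `I_μ` -/

section Imu

variable {μ : ℕ}

/-- The segment `[e_i⁻, e_i⁺]`. -/
def imuSeg (i : Fin μ) : C(Icc (-1 : ℝ) 1, Imu μ) :=
  ⟨fun t ↦ ⟨Pi.single i (t : ℝ), i, (1 - t) / 2, (1 + t) / 2, by linarith [t.2.2],
    by linarith [t.2.1], by ring, by
      ext j
      rcases eq_or_ne j i with rfl | h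
      · simp; ring
      · simp [h]⟩,
    ((continuous_single (A := fun _ ↦ ℝ) i).comp continuous_subtype_val).subtype_mk _⟩

lemma imuSeg_one (i : Fin μ) : imuSeg i (intervalEnd true) = ePlus i := rfl

lemma imuSeg_neg_one (i : Fin μ) : imuSeg i (intervalEnd false) = eMinus i :=
  Subtype.ext (Pi.single_neg (f := fun _ ↦ ℝ) i 1)

lemma exists_imuSeg (x : Imu μ) : ∃ i t, imuSeg i t = x := by
  obtain ⟨x, i, a, b, ha, hb, hab, rfl⟩ := x
  refine ⟨i, ⟨b - a, by constructor <;> linarith⟩, Subtype.ext ?_⟩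
  ext j
  change (Pi.single i (b - a) : Fin μ → ℝ) j = _
  rcases eq_or_ne j i with rfl | h
  · simp; ring
  · simp [h]

/-- Different segments of the star meet only in the origin, which the hypothesis on `s` excludes. -/
lemma imuSeg_inj {i j : Fin μ} {s t : Icc (-1 : ℝ) 1} (hs : (s : ℝ) ≠ 0)
    (h : imuSeg i s = imuSeg j t) : i = j ∧ s = t := by
  have h' : Pi.single i (s : ℝ) = (Pi.single j (t : ℝ) : Fin μ → ℝ) := congrArg Subtype.val h
  have h1 := congrFun h' i
  rcases eq_or_ne i j with rfl | hij
  · simp only [Pi.single_eq_same] at h1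
    exact ⟨rfl, Subtype.ext h1⟩
  · simp [hij, hs] at h1

variable [NeZero μ]

/-- The centre of `I_μ`. -/
def imuCenter : Imu μ := imuSeg 0 ⟨0, by norm_num⟩

lemma imuSeg_zero (i : Fin μ) {t : Icc (-1 : ℝ) 1} (ht : (t : ℝ) = 0) :
    imuSeg i t = imuCenter :=
  Subtype.ext ((congrArg (Pi.single i) ht).trans ((Pi.single_zero i).trans (Pi.single_zero 0).symm))

lemma imuSeg_ne_center {i : Fin μ} {t : Icc (-1 : ℝ) 1} (ht : (t : ℝ) ≠ 0) :
    imuSeg i t ≠ imuCenter := fun h ↦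
  ht (congrArg Subtype.val (imuSeg_inj ht h).2)

/-- The vertices of `I_μ`. -/
def imuVertex (w : Option (Fin μ × Bool)) : Imu μ :=
  w.elim imuCenter fun x ↦ imuSeg x.1 (intervalEnd x.2)

lemma intervalEnd_ne_zero (b : Bool) : (intervalEnd b : ℝ) ≠ 0 := by
  cases b <;> simp [intervalEnd]

lemma halfInterval_ne_zero {b : Bool} {s : ℝ} (hs : |s| < 1) : (halfInterval b s : ℝ) ≠ 0 := by
  have := (toUnit_mem_Ioo hs).1.ne'
  cases b <;> simpa [halfInterval]

lemma abs_halfInterval_lt {b : Bool} {s : ℝ} (hs : |s| < 1) : |(halfInterval b s : ℝ)| < 1 := by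
  have := toUnit_mem_Ioo hs
  cases b <;> simp [halfInterval, abs_of_pos this.1, this.2]

lemma halfInterval_inj {b c : Bool} {s t : ℝ} (hs : |s| < 1) (ht : |t| < 1)
    (h : halfInterval b s = halfInterval c t) : b = c ∧ s = t := by
  obtain ⟨h1, h2⟩ := boolSign_mul_inj (toUnit_mem_Ioo hs).1 (toUnit_mem_Ioo ht).1
    (congrArg Subtype.val h)
  exact ⟨h1, toUnit_inj hs ht h2⟩

lemma halfInterval_one (b : Bool) : halfInterval b 1 = intervalEnd b :=
  Subtype.ext (by simp [halfInterval, toUnit_one, intervalEnd])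

lemma halfInterval_neg_one (b : Bool) : halfInterval b (-1) = ⟨0, by norm_num⟩ :=
  Subtype.ext (by simp [halfInterval, toUnit_neg_one])

lemma exists_halfInterval {t : Icc (-1 : ℝ) 1} (h0 : (t : ℝ) ≠ 0) (ht : |(t : ℝ)| < 1) :
    ∃ b s, |s| < 1 ∧ halfInterval b s = t := by
  rcases h0.lt_or_gt with h | h
  · rw [abs_of_neg h] at ht
    obtain ⟨s, hs, hs'⟩ := toUnit_surj (neg_pos.2 h) ht
    exact ⟨false, s, hs, Subtype.ext (by simp [halfInterval, hs'])⟩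
  · rw [abs_of_pos h] at ht
    obtain ⟨s, hs, hs'⟩ := toUnit_surj h ht
    exact ⟨true, s, hs, Subtype.ext (by simp [halfInterval, hs'])⟩

variable (μ) in
/-- The cell structure of `I_μ`, with a central vertex and `2μ` edges. -/
noncomputable abbrev imuCells : CellStructure (Imu μ) :=
  CellStructure.ofGraph (V := Option (Fin μ × Bool)) (E := Fin μ × Bool) imuVertex
    (fun x ↦ (imuSeg x.1).comp (halfInterval x.2))
    (by
      rintro (_ | x) (_ | y) h
      · rfl
      · exact (imuSeg_ne_center (intervalEnd_ne_zero y.2) h.symm).elim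
      · exact (imuSeg_ne_center (intervalEnd_ne_zero x.2) h).elim
      · obtain ⟨h1, h2⟩ := imuSeg_inj (intervalEnd_ne_zero x.2) h
        exact congrArg some (Prod.ext h1 (intervalEnd_injective h2)))
    (fun {x y s t} hs ht h ↦ by
      obtain ⟨h1, h2⟩ := imuSeg_inj (halfInterval_ne_zero hs) h
      obtain ⟨h3, h4⟩ := halfInterval_inj hs ht h2
      exact ⟨Prod.ext h1 h3, h4⟩)
    (fun {x s w} hs h ↦ by
      rcases w with _ | y
      · exact imuSeg_ne_center (halfInterval_ne_zero hs) h
      · obtain ⟨h1, h2⟩ := imuSeg_inj (halfInterval_ne_zero hs) h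
        have := abs_halfInterval_lt (b := x.2) hs
        rw [h2, abs_intervalEnd] at this
        exact this.false)
    (fun p ↦ by
      obtain ⟨i, t, rfl⟩ := exists_imuSeg p
      by_cases h0 : (t : ℝ) = 0
      · exact Or.inl ⟨none, (imuSeg_zero i h0).symm⟩
      by_cases ht : |(t : ℝ)| < 1
      · obtain ⟨b, s, hs, rfl⟩ := exists_halfInterval h0 ht
        exact Or.inr ⟨(i, b), s, hs, rfl⟩
      · obtain ⟨b, rfl⟩ := exists_intervalEnd ht
        exact Or.inl ⟨some (i, b), rfl⟩)
    (fun x ↦ ⟨⟨none, (imuSeg_zero x.1 (congrArg Subtype.val (halfInterval_neg_one x.2))).symm⟩,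
      ⟨some x, congrArg (imuSeg x.1) (halfInterval_one x.2).symm⟩⟩)

instance : CompactSpace (Imu μ) :=
  have : Finite (imuCells μ).ι :=
    inferInstanceAs (Finite (Option (Fin μ × Bool) ⊕ (Fin μ × Bool)))
  (imuCells μ).compactSpace

end Imu

lemma CellStructure.mem_openCell_restrict {X : Type u} [TopologicalSpace X] {C : CellStructure X}
    {A : Set X} {I : Set C.ι} {hA : ∀ p, p ∈ A ↔ ∃ i ∈ I, p ∈ C.openCell i}
    {hI : ∀ i ∈ I, C.closedCell i ⊆ A} {i : I} {p : A} :
    p ∈ (C.restrict A I hA hI).openCell i ↔ (p : X) ∈ C.openCell i := by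
  rw [← C.coe_image_openCell_restrict A I hA hI, Subtype.val_injective.mem_set_image]

lemma FSplitting.base_mem_openCell_iff {μ : ℕ} (S : FSplitting.{u} μ)
    (A : ∀ i, CellStructure (S.Y i)) (B : CellStructure S.Z) {D : CellStructure (Icc (-1 : ℝ) 1)}
    {J : Set D.ι} (hJ : ∀ d, ∀ t ∈ D.openCell d, d ∈ J ↔ |(t : ℝ)| < 1)
    (hm : ∀ i c, ∀ y ∈ (A i).openCell c, ∃ d, B.dim d ≤ (A i).dim c ∧
      S.αminus i y ∈ B.openCell d)
    (hp : ∀ i c, ∀ y ∈ (A i).openCell c, ∃ d, B.dim d ≤ (A i).dim c ∧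
      S.αplus i y ∈ B.openCell d) {c : B.ι} {z : S.Z} :
    S.base z ∈ (S.cells A B hJ hm hp).openCell (Sum.inl c) ↔ z ∈ B.openCell c := by
  have : (S.cells A B hJ hm hp).openCell (Sum.inl c) = S.base '' B.openCell c := by
    rw [CellStructure.openCell, CellStructure.openCell, image_image]; rfl
  rw [this, S.base_injective.mem_set_image]

/-! ### The cell structure of `X(V)` -/

namespace FCover

variable {μ : ℕ} [NeZero μ] {W : Type u} [TopologicalSpace W] (P : FCover μ W)
  {C : CellStructure W} {R : C.ι → ℕ} (hR : P.IsBound R)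

/-- The cell structure on `V × I_μ`. -/
noncomputable abbrev zStructure : CellStructure (P.bounded R × Imu μ) :=
  (P.boundedStructure hR).prod (imuCells μ)

/-- The cell structure on `X(V)`. -/
noncomputable abbrev splittingCells : CellStructure (P.splitting (P.bounded R)).X :=
  (P.splitting (P.bounded R)).cells (P.yStructure hR) (P.zStructure hR) mem_subdividedInterior
    (fun i c (y : P.ySet (P.bounded R) i) hy ↦ ⟨(⟨c.1, c.2.1⟩, Sum.inl (some (i, false))), le_rfl, by
      refine (CellStructure.prod_openCell _ _ _).superset ⟨?_, ?_⟩
      · refine CellStructure.mem_openCell_restrict.2 (?_ : (y : P.E) ∈ (P.cells C).openCell c.1)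
        exact CellStructure.mem_openCell_restrict.1 hy
      · refine ⟨0, mem_ball_self one_pos, imuSeg_neg_one i⟩⟩)
    (fun i c (y : P.ySet (P.bounded R) i) hy ↦ ⟨(⟨(c.1.1, FreeGroup.of i * c.1.2), c.2.2⟩, Sum.inl (some (i, true))), le_rfl,
      by
      refine (CellStructure.prod_openCell _ _ _).superset ⟨?_, ?_⟩
      · refine CellStructure.mem_openCell_restrict.2 (?_ : FreeGroup.of i • (y : P.E) ∈
          (P.cells C).openCell (c.1.1, FreeGroup.of i * c.1.2))
        exact P.smul_mem_openCell C (c := c.1.1) (CellStructure.mem_openCell_restrict.1 hy) _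
      · refine ⟨0, mem_ball_self one_pos, imuSeg_one i⟩⟩)

instance finite_splittingCells [Finite C.ι] : Finite (P.splittingCells hR).ι := by
  have : Finite ((boundedCells (μ := μ) R × (Option (Fin μ × Bool) ⊕ (Fin μ × Bool))) ⊕
    Σ i : Fin μ, yIndex R i × subdividedInterior) := by
    have h1 : ∀ i : Fin μ, Finite (yIndex R i) := fun i ↦ (finite_boundedCells (μ := μ)
      (R := R)).subset fun c (hc : c ∈ yIndex R i) ↦ hc.1
    have h2 : Finite subdividedCells.ι := inferInstanceAs (Finite (Option Bool ⊕ Bool))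
    infer_instance
  exact this

lemma base_mem_openCell_iff {c : boundedCells (μ := μ) R} {d : (imuCells μ).ι} {v : P.bounded R}
    {s : Imu μ} : (P.splitting (P.bounded R)).base (v, s) ∈
      (P.splittingCells hR).openCell (Sum.inl (c, d)) ↔
      (v : P.E) ∈ (P.cells C).openCell c ∧ s ∈ (imuCells μ).openCell d := by
  refine (FSplitting.base_mem_openCell_iff _ _ _ _ _ _).trans ?_
  exact (Set.ext_iff.1 (CellStructure.prod_openCell (P.boundedStructure hR) (imuCells μ) (c, d))
    (v, s)).trans (and_congr_left' CellStructure.mem_openCell_restrict)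

lemma openCell_inr (i : Fin μ) (c : yIndex R i) (d : subdividedInterior) :
    (P.splittingCells hR).openCell (Sum.inr ⟨i, c, d⟩) =
      (P.splitting (P.bounded R)).tubeMap i '' ((P.yStructure hR i).openCell c ×ˢ
        subdividedCells.openCell d) :=
  (P.splitting (P.bounded R)).tubeCellMap_image (P.yStructure hR) subdividedCells i c d

lemma exists_of_mem_openCell_inl {c : boundedCells (μ := μ) R} {d : (imuCells μ).ι}
    {p : (P.splitting (P.bounded R)).X}
    (hp : p ∈ (P.splittingCells hR).openCell (Sum.inl (c, d))) :
    ∃ (v : P.bounded R) (s : Imu μ), (v : P.E) ∈ (P.cells C).openCell c ∧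
      s ∈ (imuCells μ).openCell d ∧ p = (P.splitting (P.bounded R)).base (v, s) := by
  obtain ⟨⟨v, s⟩, rfl⟩ : p ∈ range (P.splitting (P.bounded R)).base := by
    obtain ⟨x, -, rfl⟩ := hp; exact ⟨_, rfl⟩
  obtain ⟨h1, h2⟩ := (P.base_mem_openCell_iff hR).1 hp
  exact ⟨v, s, h1, h2, rfl⟩

lemma exists_of_mem_openCell_inr {i : Fin μ} {c : yIndex R i} {d : subdividedInterior}
    {p : (P.splitting (P.bounded R)).X}
    (hp : p ∈ (P.splittingCells hR).openCell (Sum.inr ⟨i, c, d⟩)) :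
    ∃ (y : P.ySet (P.bounded R) i) (t : Icc (-1 : ℝ) 1), (y : P.E) ∈ (P.cells C).openCell c ∧
      t ∈ subdividedCells.openCell d ∧ p = (P.splitting (P.bounded R)).tube i y t := by
  obtain ⟨⟨y, t⟩, ⟨hy, ht⟩, rfl⟩ := (P.openCell_inr hR i c d).subset hp
  exact ⟨y, t, CellStructure.mem_openCell_restrict.1 hy, ht, rfl⟩

/-- The cell of the base below a cell of `X(V)`. -/
def baseCell : (P.splittingCells hR).ι → C.ι
  | .inl c => c.1.1.1
  | .inr c => c.2.1.1.1

lemma baseCell_dim_le (k : (P.splittingCells hR).ι) :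
    C.dim (P.baseCell hR k) ≤ (P.splittingCells hR).dim k := by
  rcases k with ⟨c, d⟩ | ⟨i, c, d⟩ <;> exact Nat.le_add_right _ _

lemma splittingMap_mem_openCell {k : (P.splittingCells hR).ι}
    {p : (P.splitting (P.bounded R)).X} (hp : p ∈ (P.splittingCells hR).openCell k) :
    P.splittingMap (P.bounded R) p ∈ C.openCell (P.baseCell hR k) := by
  rcases k with ⟨c, d⟩ | ⟨i, c, d⟩
  · obtain ⟨v, s, hv, -, rfl⟩ := P.exists_of_mem_openCell_inl hR hp
    exact P.proj_mem_openCell C hv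
  · obtain ⟨v, s, hv, -, rfl⟩ := P.exists_of_mem_openCell_inr hR hp
    exact P.proj_mem_openCell C hv

variable {P} [T2Space W] [Finite C.ι]

include hR in
lemma IsBound.t2Space_X : T2Space (P.splitting (P.bounded R)).X := by
  have h1 : ∀ i, CompactSpace ((P.splitting (P.bounded R)).Y i) := fun i ↦
    isCompact_iff_compactSpace.1 (hR.isCompact_ySet i)
  have h2 : ∀ i, T2Space ((P.splitting (P.bounded R)).Y i) := fun i ↦
    inferInstanceAs (T2Space (P.ySet (P.bounded R) i))
  have h3 : CompactSpace (P.bounded R) := isCompact_iff_compactSpace.1 hR.isCompact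
  have h4 : CompactSpace (P.splitting (P.bounded R)).Z :=
    inferInstanceAs (CompactSpace (P.bounded R × Imu μ))
  have h5 : T2Space (P.splitting (P.bounded R)).Z :=
    inferInstanceAs (T2Space (P.bounded R × Imu μ))
  exact FSplitting.t2Space _

include hR in
lemma IsBound.isClosed_YSet [T2Space (P.splitting (P.bounded R)).X] (i : Fin μ) :
    IsClosed ((P.splitting (P.bounded R)).YSet i) := by
  have h1 : CompactSpace ((P.splitting (P.bounded R)).Y i) :=
    isCompact_iff_compactSpace.1 (hR.isCompact_ySet i)
  exact (isCompact_range (((P.splitting (P.bounded R)).tubeMap i).continuous.comp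
    (continuous_id.prodMk continuous_const))).isClosed

include hR in
lemma IsBound.isClosed_ZSet [T2Space (P.splitting (P.bounded R)).X] :
    IsClosed ((P.splitting (P.bounded R)).ZSet) := by
  have h3 : CompactSpace (P.bounded R) := isCompact_iff_compactSpace.1 hR.isCompact
  have h4 : CompactSpace (P.splitting (P.bounded R)).Z :=
    inferInstanceAs (CompactSpace (P.bounded R × Imu μ))
  exact (isCompact_range (P.splitting (P.bounded R)).baseMap.continuous).isClosed

lemma isSubcomplex_YSet [T2Space (P.splitting (P.bounded R)).X] (i : Fin μ) :
    (P.splittingCells hR).toFiniteCW.IsSubcomplex ((P.splitting (P.bounded R)).YSet i) := by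
  refine FiniteCW.isSubcomplex_of_isClosed _ (hR.isClosed_YSet i) ?_
  rintro _ ⟨⟨c, d⟩ | ⟨j, c, d⟩, rfl⟩ p hp ⟨y, hy⟩ q hq
  · obtain ⟨v, s, hv, -, rfl⟩ := P.exists_of_mem_openCell_inl hR hp
    exact (FSplitting.tube_ne_base _ (by simp) _ hy).elim
  · obtain ⟨y', t, hy', ht, rfl⟩ := P.exists_of_mem_openCell_inr hR hp
    obtain ⟨y'', t', hy'', ht', rfl⟩ := P.exists_of_mem_openCell_inr hR hq
    obtain ⟨h1, rfl⟩ := FSplitting.tube_eq_tube _ (by simp)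
      ((mem_subdividedInterior _ _ ht).1 d.2) hy
    obtain ⟨rfl, -⟩ := Sigma.mk.inj h1
    have hd : (d : subdividedCells.ι) = Sum.inl none := subdividedCells.eq_of_mem_openCell ht
      ⟨0, mem_ball_self one_pos, rfl⟩
    rw [hd] at ht'
    obtain ⟨x, -, rfl⟩ := ht'
    exact ⟨y'', rfl⟩

lemma isSubcomplex_ZSet [T2Space (P.splitting (P.bounded R)).X] :
    (P.splittingCells hR).toFiniteCW.IsSubcomplex ((P.splitting (P.bounded R)).ZSet) := by
  refine FiniteCW.isSubcomplex_of_isClosed _ hR.isClosed_ZSet ?_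
  rintro _ ⟨⟨c, d⟩ | ⟨j, c, d⟩, rfl⟩ p hp ⟨y, hy⟩ q hq
  · obtain ⟨v, s, hv, -, rfl⟩ := P.exists_of_mem_openCell_inl hR hq
    exact ⟨_, rfl⟩
  · obtain ⟨y', t, hy', ht, rfl⟩ := P.exists_of_mem_openCell_inr hR hp
    exact (FSplitting.tube_ne_base _ ((mem_subdividedInterior _ _ ht).1 d.2) _ hy.symm).elim

end FCover

/-! ### Collapsing a mapping cylinder onto its domain -/

section Cube

variable {n : ℕ}

lemma norm_eq_max_init_last (z : Fin (n + 1) → ℝ) :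
    ‖z‖ = max ‖(Fin.init z : Fin n → ℝ)‖ |z (Fin.last n)| := by
  refine le_antisymm ?_ (max_le ?_ (norm_le_pi_norm z (Fin.last n)))
  · rw [pi_norm_le_iff_of_nonneg (le_max_of_le_left (norm_nonneg _)), Fin.forall_fin_succ']
    exact ⟨fun k ↦ le_max_of_le_left (norm_le_pi_norm (Fin.init z : Fin n → ℝ) k),
      le_max_right _ _⟩
  · rw [pi_norm_le_iff_of_nonneg (norm_nonneg _)]
    exact fun k ↦ norm_le_pi_norm z k.castSucc

lemma boolSign_mul_self (b : Bool) (r : ℝ) : boolSign b * (boolSign b * r) = r := by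
  cases b <;> simp

lemma abs_boolSign_mul (b : Bool) (r : ℝ) : |boolSign b * r| = |r| := by
  rw [abs_mul, abs_boolSign, one_mul]

/-- The map of the cube that multiplies the last coordinate by a sign. -/
def flipLast (b : Bool) (z : Fin (n + 1) → ℝ) : Fin (n + 1) → ℝ :=
  Fin.snoc (Fin.init z : Fin n → ℝ) (boolSign b * z (Fin.last n))

@[simp] lemma init_flipLast (b : Bool) (z : Fin (n + 1) → ℝ) :
    (Fin.init (flipLast b z) : Fin n → ℝ) = Fin.init z := Fin.init_snoc (α := fun _ ↦ ℝ) _ _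

@[simp] lemma flipLast_last (b : Bool) (z : Fin (n + 1) → ℝ) :
    flipLast b z (Fin.last n) = boolSign b * z (Fin.last n) := Fin.snoc_last (α := fun _ ↦ ℝ) _ _

lemma flipLast_involutive (b : Bool) : Function.Involutive (flipLast (n := n) b) := fun z ↦ by
  rw [flipLast, init_flipLast, flipLast_last, boolSign_mul_self]
  exact Fin.snoc_init_self z

lemma continuous_flipLast (b : Bool) : Continuous (flipLast (n := n) b) :=
  Continuous.finSnoc (A := fun _ ↦ ℝ) continuous_init
    (continuous_const.mul (continuous_apply (Fin.last n)))

lemma norm_flipLast (b : Bool) (z : Fin (n + 1) → ℝ) : ‖flipLast b z‖ = ‖z‖ := by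
  rw [norm_eq_max_init_last, norm_eq_max_init_last z, init_flipLast, flipLast_last,
    abs_boolSign_mul]

/-- The map of the cube that exchanges the last two coordinates and multiplies them by a sign. -/
def swapLast (b : Bool) (z : Fin (n + 1 + 1) → ℝ) : Fin (n + 1 + 1) → ℝ :=
  Fin.snoc (Fin.snoc (Fin.init (Fin.init z : Fin (n + 1) → ℝ) : Fin n → ℝ)
    (boolSign b * z (Fin.last _)) : Fin (n + 1) → ℝ)
    (boolSign b * (Fin.init z : Fin (n + 1) → ℝ) (Fin.last n))

@[simp] lemma init_swapLast (b : Bool) (z : Fin (n + 1 + 1) → ℝ) :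
    (Fin.init (swapLast b z) : Fin (n + 1) → ℝ) =
      Fin.snoc (Fin.init (Fin.init z : Fin (n + 1) → ℝ) : Fin n → ℝ)
        (boolSign b * z (Fin.last _)) := Fin.init_snoc (α := fun _ ↦ ℝ) _ _

@[simp] lemma swapLast_last (b : Bool) (z : Fin (n + 1 + 1) → ℝ) :
    swapLast b z (Fin.last _) = boolSign b * (Fin.init z : Fin (n + 1) → ℝ) (Fin.last n) :=
  Fin.snoc_last (α := fun _ ↦ ℝ) _ _

lemma swapLast_involutive (b : Bool) : Function.Involutive (swapLast (n := n) b) := fun z ↦ by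
  rw [swapLast, init_swapLast, swapLast_last, boolSign_mul_self, Fin.init_snoc, Fin.snoc_last,
    boolSign_mul_self]
  exact (congrArg (Fin.snoc · _) (Fin.snoc_init_self (α := fun _ ↦ ℝ) (Fin.init z))).trans
    (Fin.snoc_init_self z)

lemma continuous_swapLast (b : Bool) : Continuous (swapLast (n := n) b) :=
  Continuous.finSnoc (A := fun _ ↦ ℝ)
    (Continuous.finSnoc (A := fun _ ↦ ℝ) (continuous_init.comp continuous_init)
      (continuous_const.mul (continuous_apply (Fin.last (n + 1)))))
    (continuous_const.mul ((continuous_apply (Fin.last n)).comp continuous_init))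

lemma norm_swapLast (b : Bool) (z : Fin (n + 1 + 1) → ℝ) : ‖swapLast b z‖ = ‖z‖ := by
  rw [norm_eq_max_init_last, norm_eq_max_init_last z, init_swapLast, swapLast_last,
    norm_eq_max_init_last, norm_eq_max_init_last (Fin.init z), Fin.init_snoc, Fin.snoc_last,
    abs_boolSign_mul, abs_boolSign_mul, max_right_comm]

end Cube

section MapCylinder

variable {X W : Type u} [TopologicalSpace X] [TopologicalSpace W] (h : C(X, W))
  (A : CellStructure X) (B : CellStructure W)
  (hA : ∀ c, ∀ x ∈ A.openCell c, ∃ d, B.dim d ≤ A.dim c ∧ h x ∈ B.openCell d)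

lemma cylinder_tube_of_mem {x : X} {t : ℝ} (ht : |t| ≤ 1) :
    (t = 1 ∧ (mapCylinder h).tube 0 x (intervalClamp t) = cylinderInl h x) ∨
    (t = -1 ∧ (mapCylinder h).tube 0 x (intervalClamp t) = cylinderInr h (h x)) ∨ |t| < 1 := by
  rcases lt_or_eq_of_le ht with h1 | h1
  · exact Or.inr (Or.inr h1)
  · rcases (abs_eq zero_le_one).1 h1 with rfl | rfl
    · exact Or.inl ⟨rfl, (mapCylinder h).tube_one 0 _ (by rw [coe_intervalClamp ht])⟩
    · exact Or.inr (Or.inl ⟨rfl, (mapCylinder h).tube_neg_one 0 _ (by rw [coe_intervalClamp ht])⟩)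

lemma cylinder_tube_mem {c : A.ι} {x : X} (hx : x ∈ A.openCell c) {t : ℝ} (ht : |t| < 1) :
    (mapCylinder h).tube 0 x (intervalClamp t) ∈
      (cylinderCells h A B hA).openCell (cylinderIndex h A B hA c) :=
  tube_mem_openCell_cylinder h A B hA hx (by rwa [coe_intervalClamp ht.le]) 0

lemma cylinderInl_mem {c : A.ι} {x : X} (hx : x ∈ A.openCell c) :
    cylinderInl h x ∈ (cylinderCells h A B hA).openCell (Sum.inl (Sum.inl c)) :=
  (cylinder_openCell_inl h A B hA c).superset (mem_image_of_mem _ hx)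

lemma cylinderInr_mem {d : B.ι} {w : W} (hw : w ∈ B.openCell d) :
    cylinderInr h w ∈ (cylinderCells h A B hA).openCell (Sum.inl (Sum.inr d)) :=
  (cylinder_openCell_inr h A B hA d).superset (mem_image_of_mem _ hw)

variable {A} in
-- The characteristic maps of roots and edges are chosen to be compatible with `h` and need not be
-- those of the given structure, so the cylinder on a cell is parametrized by an arbitrary one.
lemma CellStructure.IsChar.cylinder {c : A.ι} {n : ℕ} {ψ : (Fin n → ℝ) → X} (hψ : A.IsChar c ψ) :
    (cylinderCells h A B hA).IsChar (cylinderIndex h A B hA c) (fun z : Fin (n + 1) → ℝ ↦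
      (mapCylinder h).tube 0 (ψ (Fin.init z)) (intervalClamp (z (Fin.last n)))) where
  dim_eq := congrArg (· + 1) hψ.dim_eq
  continuousOn := by
    refine ((mapCylinder h).tubeMap 0).continuous.comp_continuousOn
      (ContinuousOn.prodMk (hψ.continuousOn.comp continuous_init.continuousOn fun z hz ↦
        (mem_closedBall_cube_succ.1 hz).1)
      (intervalClamp.continuous.comp (continuous_apply (Fin.last n))).continuousOn)
  injOn z hz w hw hzw := by
    obtain ⟨h1, h2⟩ := mem_ball_cube_succ.1 hz
    obtain ⟨h3, h4⟩ := mem_ball_cube_succ.1 hw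
    obtain ⟨h5, h6⟩ := (mapCylinder h).tube_eq_tube (by rwa [coe_intervalClamp h2.le])
      (by rwa [coe_intervalClamp h4.le]) hzw
    have h7 : (Fin.init z : Fin n → ℝ) = Fin.init w :=
      hψ.injOn h1 h3 (eq_of_heq (Sigma.mk.inj h5).2)
    have h8 := congrArg Subtype.val h6
    rw [coe_intervalClamp h2.le, coe_intervalClamp h4.le] at h8
    rw [← Fin.snoc_init_self z, ← Fin.snoc_init_self w]
    exact congrArg₂ (Fin.snoc (α := fun _ ↦ ℝ)) h7 h8
  image_ball := by
    rw [cylinder_openCell_index, ← hψ.image_ball]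
    ext p
    constructor
    · rintro ⟨z, hz, rfl⟩
      obtain ⟨h1, h2⟩ := mem_ball_cube_succ.1 hz
      exact ⟨(_, _), ⟨⟨_, h1, rfl⟩, mem_openCell_intervalCells (by rwa [coe_intervalClamp h2.le])⟩,
        rfl⟩
    · rintro ⟨⟨_, t⟩, ⟨⟨x, hx, rfl⟩, ht⟩, rfl⟩
      have ht' := (mem_interior_intervalCells _ t ht).1 rfl
      refine ⟨Fin.snoc x (t : ℝ), snoc_mem_ball.2 ⟨hx, ht'⟩, ?_⟩
      simp only [Fin.init_snoc, Fin.snoc_last]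
      exact congrArg ((mapCylinder h).tube 0 (ψ x)) (Subtype.ext (coe_intervalClamp ht'.le))
  boundary z hz := by
    obtain ⟨hz1, hz2⟩ := mem_sphere_cube.1 hz
    obtain ⟨h1, h2⟩ := mem_closedBall_cube_succ.1 hz1
    obtain ⟨j, hj, hj'⟩ : ∃ j, A.dim j ≤ n ∧ ψ (Fin.init z) ∈ A.openCell j := by
      by_cases hb : (Fin.init z : Fin n → ℝ) ∈ ball 0 1
      · exact ⟨c, hψ.dim_eq.le, hψ.image_ball.subset ⟨_, hb, rfl⟩⟩
      · obtain ⟨j, hj, h⟩ := hψ.boundary _ (mem_sphere_cube.2 ⟨h1, hb⟩)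
        exact ⟨j, hj.le, h⟩
    rcases cylinder_tube_of_mem h (x := ψ (Fin.init z)) h2 with ⟨-, h3⟩ | ⟨-, h3⟩ | h3
    · exact ⟨Sum.inl (Sum.inl j), Nat.lt_succ_of_le hj, h3 ▸ cylinderInl_mem h A B hA hj'⟩
    · obtain ⟨d, hd, hd'⟩ := hA j _ hj'
      exact ⟨Sum.inl (Sum.inr d), Nat.lt_succ_of_le (hd.trans hj), h3 ▸ cylinderInr_mem h A B hA hd'⟩
    · obtain ⟨k, hk, hk'⟩ := hψ.boundary _ (mem_sphere_cube.2
        ⟨h1, fun hb ↦ hz2 (mem_ball_cube_succ.2 ⟨hb, h3⟩)⟩)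
      exact ⟨cylinderIndex h A B hA k, Nat.succ_lt_succ hk, cylinder_tube_mem h A B hA hk' h3⟩

lemma isChar_cylinderInr {d : B.ι} {φ : (Fin (B.dim d) → ℝ) → (mapCylinder h).X}
    (hφ : ∀ x ∈ closedBall 0 1, φ x = cylinderInr h (B.map d x)) :
    (cylinderCells h A B hA).IsChar (Sum.inl (Sum.inr d)) φ :=
  ((cylinderCells h A B hA).isChar_map (Sum.inl (Sum.inr d))).congr hφ

/-- The mapping cylinder of `h` collapses to its domain if the fibres of `h` are trees: every open
cell `d` of the codomain has a section `root d`, and the remaining cells over `d` are products of `d`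
with the edges and vertices of a tree, such that removing, successively, the edges `e q` together
with their end points `f q` leaves only the root. -/
theorem isFormalInclusion_cylinderInl [T2Space X] [T2Space (mapCylinder h).X] [CompactSpace X]
    [Finite A.ι] [Finite B.ι]
    (root : B.ι → A.ι) (χ : ∀ d, (Fin (B.dim d) → ℝ) → X) (hχ : ∀ d, A.IsChar (root d) (χ d))
    (hχh : ∀ d, ∀ x ∈ closedBall 0 1, h (χ d x) = B.map d x)
    {Q : Type u} [Finite Q] (t : Q → B.ι) (e f near : Q → A.ι) (σ : Q → Bool)
    (ψ : ∀ q, (Fin (B.dim (t q) + 1) → ℝ) → X) (hψ : ∀ q, A.IsChar (e q) (ψ q))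
    (hψh : ∀ q, ∀ z ∈ closedBall 0 1, h (ψ q z) = B.map (t q) (Fin.init z))
    (hf : ∀ q, A.IsChar (f q) fun x ↦ ψ q (Fin.snoc x (boolSign (σ q)) : Fin (_ + 1) → ℝ))
    (hn : ∀ q, ∀ x ∈ ball (0 : Fin (B.dim (t q)) → ℝ) 1,
      ψ q (Fin.snoc x (-boolSign (σ q)) : Fin (_ + 1) → ℝ) ∈ A.openCell (near q))
    (depth : A.ι → ℕ) (hdepth : ∀ q, depth (near q) < depth (f q))
    (hnear : ∀ q, near q = root (t q) ∨ ∃ q', near q = f q' ∧ t q' = t q)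
    (hroot : Function.Injective root) (he : Function.Injective e) (hf' : Function.Injective f)
    (hre : ∀ d q, root d ≠ e q) (hrf : ∀ d q, root d ≠ f q) (hef : ∀ q q', e q ≠ f q')
    (hcover : ∀ c, (∃ d, c = root d) ∨ ∃ q, c = e q ∨ c = f q) :
    IsFormalInclusion A.toFiniteCW (cylinderCells h A B hA).toFiniteCW (cylinderInl h) := by
  set M := cylinderCells h A B hA with hM
  have hrange : M.union (range fun c : A.ι ↦ (Sum.inl (Sum.inl c) : M.ι)) =
      range (cylinderInl h) := by
    ext p
    rw [CellStructure.mem_union]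
    constructor
    · rintro ⟨_, ⟨d, rfl⟩, hp⟩
      rw [cylinder_openCell_inl] at hp
      exact image_subset_range _ _ hp
    · rintro ⟨x, rfl⟩
      obtain ⟨d, hd⟩ := A.exists_mem_openCell x
      exact ⟨_, ⟨d, rfl⟩, cylinderInl_mem h A B hA hd⟩
  refine CellStructure.isFormalInclusion_of_isFormalPair A M (cylinderInl h)
    (fun x y hxy ↦ Sum.inl_injective ((mapCylinder h).base_injective hxy))
    (fun d ↦ Sum.inl (Sum.inl d)) (fun _ ↦ rfl) (fun d ↦ (cylinder_openCell_inl h A B hA d).symm) ?_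
  set I : Set M.ι := range fun c : A.ι ↦ (Sum.inl (Sum.inl c) : M.ι)
  -- Pairs are added by dimension of the base cell and, over a fixed base cell, by distance from the
  -- root. The pair of the root has depth `0`, below every `depth (f q)`, since the latter exceeds
  -- `depth (near q)`.
  let ρ : B.ι ⊕ Q → ℕ ×ₗ ℕ := Sum.elim (fun d ↦ toLex (B.dim d, 0))
    fun q ↦ toLex (B.dim (t q), depth (f q))
  let a : B.ι ⊕ Q → M.ι := Sum.elim (fun d ↦ Sum.inl (Sum.inr d))
    fun q ↦ cylinderIndex h A B hA (f q)
  let b : B.ι ⊕ Q → M.ι := Sum.elim (fun d ↦ cylinderIndex h A B hA (root d))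
    fun q ↦ cylinderIndex h A B hA (e q)
  have hidx : Function.Injective (cylinderIndex h A B hA) := fun c c' hc ↦ by cases hc; rfl
  have hIcov : ∀ i, i ∈ I ∨ ∃ π, i = a π ∨ i = b π := by
    intro i
    rcases cylinder_cases h A B hA i with ⟨c, rfl⟩ | ⟨d, rfl⟩ | ⟨c, rfl⟩
    · exact Or.inl ⟨c, rfl⟩
    · exact Or.inr ⟨Sum.inl d, Or.inl rfl⟩
    · rcases hcover c with ⟨d, rfl⟩ | ⟨q, rfl | rfl⟩
      · exact Or.inr ⟨Sum.inl d, Or.inr rfl⟩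
      · exact Or.inr ⟨Sum.inr q, Or.inr rfl⟩
      · exact Or.inr ⟨Sum.inr q, Or.inl rfl⟩
  -- Both cells of a pair lie over one base cell, whose dimension is the leading coordinate of the
  -- rank. So all that lies over cells of lower dimension is already present (`hlower`).
  have hproj : ∀ π i, i = a π ∨ i = b π → ∀ p ∈ M.openCell i, ∃ d, cylinderProj h p ∈ B.openCell d ∧
      ρ π = toLex (B.dim d, (ofLex (ρ π)).2) := by
    rintro (d | q) i (rfl | rfl) p hp
    · rw [show a (Sum.inl d) = Sum.inl (Sum.inr d) from rfl, cylinder_openCell_inr] at hp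
      obtain ⟨w, hw, rfl⟩ := hp
      exact ⟨d, hw, rfl⟩
    · rw [show b (Sum.inl d) = cylinderIndex h A B hA (root d) from rfl,
        cylinder_openCell_index, ← (hχ d).image_ball] at hp
      obtain ⟨⟨_, s⟩, ⟨⟨x, hx, rfl⟩, hs⟩, rfl⟩ := hp
      refine ⟨d, ?_, rfl⟩
      change h (χ d x) ∈ _
      rw [hχh d x (ball_subset_closedBall hx)]
      exact B.map_mem_openCell hx
    · rw [show a (Sum.inr q) = cylinderIndex h A B hA (f q) from rfl,
        cylinder_openCell_index, ← (hf q).image_ball] at hp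
      obtain ⟨⟨_, s⟩, ⟨⟨x, hx, rfl⟩, hs⟩, rfl⟩ := hp
      refine ⟨t q, ?_, rfl⟩
      change h (ψ q _) ∈ _
      rw [hψh q _ (snoc_mem_closedBall.2 ⟨ball_subset_closedBall hx, (abs_boolSign _).le⟩),
        Fin.init_snoc]
      exact B.map_mem_openCell hx
    · rw [show b (Sum.inr q) = cylinderIndex h A B hA (e q) from rfl,
        cylinder_openCell_index, ← (hψ q).image_ball] at hp
      obtain ⟨⟨_, s⟩, ⟨⟨x, hx, rfl⟩, hs⟩, rfl⟩ := hp
      refine ⟨t q, ?_, rfl⟩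
      change h (ψ q _) ∈ _
      rw [hψh q _ (ball_subset_closedBall hx)]
      exact B.map_mem_openCell (mem_ball_cube_succ.1 hx).1
  have hlower : ∀ π p d, cylinderProj h p ∈ B.openCell d → B.dim d < (ofLex (ρ π)).1 →
      p ∈ M.union {i | i ∈ I ∨ ∃ π', ρ π' < ρ π ∧ (i = a π' ∨ i = b π')} := by
    intro π p d hp hd
    obtain ⟨i, hi⟩ := M.exists_mem_openCell p
    refine CellStructure.mem_union.2 ⟨i, (hIcov i).imp id ?_, hi⟩
    rintro ⟨π', hπ'⟩
    obtain ⟨d', hd', h'⟩ := hproj π' i hπ' p hi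
    obtain rfl := B.eq_of_mem_openCell hp hd'
    refine ⟨π', ?_, hπ'⟩
    rw [h', Prod.Lex.lt_iff]
    exact Or.inl hd
  have hI : ∀ π x, cylinderInl h x ∈
      M.union {i | i ∈ I ∨ ∃ π', ρ π' < ρ π ∧ (i = a π' ∨ i = b π')} := fun π x ↦
    M.union_mono (fun i hi ↦ Or.inl hi) (hrange.superset ⟨_, rfl⟩)
  -- The free face must be on top. For a root the cylinder direction is reversed, since `W` sits at
  -- its end `-1`. For an edge the edge direction and the cylinder direction are exchanged, with the
  -- sign that puts the far end `f q` on top.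
  refine M.isFormalPair_of_matching ?_ ρ a b (Sum.rec B.dim fun q ↦ B.dim (t q) + 1)
    (Sum.rec (fun d z ↦ (mapCylinder h).tube 0 (χ d (Fin.init (flipLast false z)))
        (intervalClamp (flipLast false z (Fin.last _))))
      fun q z ↦ (mapCylinder h).tube 0 (ψ q (Fin.init (swapLast (σ q) z)))
        (intervalClamp (swapLast (σ q) z (Fin.last _)))) ?_ ?_ ?_ ?_ ?_ hIcov ?_ ?_ ?_
  · rw [hrange]
    exact (isCompact_range (cylinderInl h).continuous).isClosed
  · rintro (d | q) ⟨c, hc⟩ <;> cases hc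
  · rintro (d | q) ⟨c, hc⟩ <;> cases hc
  · rintro (d | q) (d' | q') hc
    · cases hc
    · cases hc
    · exact hrf d' q (hidx hc).symm
    · exact hef q' q (hidx hc).symm
  · rintro (d | q) (d' | q') hc
    · cases hc; rfl
    · cases hc
    · cases hc
    · exact congrArg _ (hf' (hidx hc))
  · rintro (d | q) (d' | q') hc
    · exact congrArg _ (hroot (hidx hc))
    · exact (hre _ _ (hidx hc)).elim
    · exact (hre _ _ (hidx hc).symm).elim
    · exact congrArg _ (he (hidx hc))
  · rintro (d | q)
    · exact ((hχ d).cylinder h B hA).comp (flipLast false) (continuous_flipLast _)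
        (flipLast_involutive _) (norm_flipLast _)
    · exact ((hψ q).cylinder h B hA).comp (swapLast (σ q)) (continuous_swapLast _)
        (swapLast_involutive _) (norm_swapLast _)
  · rintro (d | q)
    · refine isChar_cylinderInr h A B hA fun x hx ↦ ?_
      simp only [init_flipLast, flipLast_last, Fin.init_snoc, Fin.snoc_last, boolSign_false, mul_one]
      refine ((mapCylinder h).tube_neg_one 0 _ (coe_intervalClamp (by simp))).trans ?_
      exact congrArg (cylinderInr h) (hχh d x hx)
    -- Being an involution, `swapLast` carries its sign on both coordinates; on the top face this
    -- leaves a sign in the cylinder direction.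
    · have := ((hf q).cylinder h B hA).comp (flipLast (σ q)) (continuous_flipLast _)
        (flipLast_involutive _) (norm_flipLast _)
      refine this.congr fun x _ ↦ ?_
      simp
  · rintro (d | q) z hz
    · obtain ⟨h1, h2, h3⟩ := mem_sphere_diff_cubeTop.1 hz
      simp only [init_flipLast, flipLast_last]
      rcases h3 with h3 | h3
      · obtain ⟨d', hd', h4⟩ := B.boundary d _ (mem_sphere_zero_iff_norm.2 h3)
        refine hlower (Sum.inl d) _ d' ?_ hd'
        change h (χ d _) ∈ _
        rwa [hχh d _ h1]
      · rw [h3, (mapCylinder h).tube_one 0 _ (by rw [coe_intervalClamp] <;> simp)]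
        exact hI _ _
    · obtain ⟨h1, h2, h3⟩ := mem_sphere_diff_cubeTop.1 hz
      obtain ⟨h4, h5⟩ := mem_closedBall_cube_succ.1 h1
      simp only [init_swapLast, swapLast_last]
      set x : Fin (B.dim (t q)) → ℝ := Fin.init (Fin.init z) with hx
      set s : ℝ := z (Fin.last _) with hs
      set r : ℝ := (Fin.init z : Fin (B.dim (t q) + 1) → ℝ) (Fin.last _) with hr
      have hmem : (Fin.snoc x (boolSign (σ q) * s) : Fin (B.dim (t q) + 1) → ℝ) ∈ closedBall 0 1 :=
        snoc_mem_closedBall.2 ⟨h4, by rwa [abs_boolSign_mul]⟩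
      have hp : h (ψ q (Fin.snoc x (boolSign (σ q) * s))) = B.map (t q) x := by
        rw [hψh q _ hmem, Fin.init_snoc]
      -- Over the open base cell the faces other than the top are the domain end of the cylinder,
      -- its codomain end, which belongs to the pair of the root, and the cylinder on the near end
      -- of the edge. The near end is the root or the far end of an edge of smaller depth.
      by_cases hxb : x ∈ ball 0 1
      · rcases cylinder_tube_of_mem h (x := ψ q (Fin.snoc x (boolSign (σ q) * s)))
          (t := boolSign (σ q) * r) (by rwa [abs_boolSign_mul]) with ⟨h6, h7⟩ | ⟨h6, h7⟩ | h6
        · rw [h7]; exact hI _ _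
        · rw [h7, hp]
          refine CellStructure.mem_union.2 ⟨Sum.inl (Sum.inr (t q)), Or.inr ⟨Sum.inl (t q), ?_,
            Or.inl rfl⟩, cylinderInr_mem h A B hA (B.map_mem_openCell hxb)⟩
          rw [Prod.Lex.lt_iff]
          exact Or.inr ⟨rfl, (Nat.zero_le _).trans_lt (hdepth q)⟩
        · have h7 : s = -1 := by
            refine h3.resolve_left fun h7 ↦ ?_
            rw [norm_eq_max_init_last] at h7
            rw [abs_boolSign_mul] at h6
            exact (max_lt (mem_ball_zero_iff.1 hxb) h6).ne h7
          have h8 := hn q x hxb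
          rw [h7, mul_neg_one]
          refine CellStructure.mem_union.2 ⟨cylinderIndex h A B hA (near q), Or.inr ?_,
            cylinder_tube_mem h A B hA h8 h6⟩
          rcases hnear q with h9 | ⟨q', h9, h10⟩
          · refine ⟨Sum.inl (t q), ?_, Or.inr (by rw [h9]; rfl)⟩
            rw [Prod.Lex.lt_iff]
            exact Or.inr ⟨rfl, (Nat.zero_le _).trans_lt (hdepth q)⟩
          · refine ⟨Sum.inr q', ?_, Or.inl (by rw [h9]; rfl)⟩
            rw [Prod.Lex.lt_iff]
            refine Or.inr ⟨congrArg B.dim h10, ?_⟩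
            change depth (f q') < depth (f q)
            rw [← h9]
            exact hdepth q
      · obtain ⟨d', hd', h6⟩ := B.boundary (t q) x (mem_sphere_cube.2 ⟨h4, hxb⟩)
        refine hlower (Sum.inr q) _ d' ?_ hd'
        change h (ψ q _) ∈ _
        rwa [hp]

end MapCylinder

/-! ### The Cayley tree -/

namespace FreeGroup

variable {μ : ℕ}

/-- The generators and their inverses, as directions at the vertices of the Cayley tree. -/
def leg (x : Fin μ × Bool) : FreeGroup (Fin μ) := mk [(x.1, !x.2)]

/-- The tube over `y` starts at the tip `e_i⁻` of the star at `y` and ends at `e_i⁺` of the star at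
`z_i y`. Leaving a star through `e_i⁻` thus multiplies by `z_i`, and leaving through `e_i⁺` by its
inverse. -/
lemma leg_false (i : Fin μ) : leg (i, false) = of i := rfl

lemma leg_true (i : Fin μ) : leg (i, true) = (of i)⁻¹ := rfl

/-- The direction `x` at `g` points to `1`. -/
def Toward (g : FreeGroup (Fin μ)) (x : Fin μ × Bool) : Prop := g.toWord.head? = some x

instance (g : FreeGroup (Fin μ)) (x : Fin μ × Bool) : Decidable (Toward g x) :=
  inferInstanceAs (Decidable (g.toWord.head? = some x))

/-- As a word, `leg x` is the single letter inverse to `x`. Against a reduced word it cancels a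
first letter `x` or is prepended without further reduction. -/
lemma toWord_leg_mul (x : Fin μ × Bool) (g : FreeGroup (Fin μ)) :
    (Toward g x ∧ g.toWord = x :: (leg x * g).toWord) ∨
      (¬ Toward g x ∧ (leg x * g).toWord = (x.1, !x.2) :: g.toWord) := by
  have h : (leg x * g).toWord = reduce ((x.1, !x.2) :: g.toWord) := by
    rw [leg, ← mk_toWord (x := g), mul_mk, toWord_mk, mk_toWord]; rfl
  rw [reduce.cons, reduce_toWord] at h
  rcases hg : g.toWord with _ | ⟨y, t⟩
  · rw [hg] at h
    exact Or.inr ⟨by simp [Toward, hg], h⟩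
  · rw [hg] at h
    by_cases hy : x = y
    · subst hy
      left
      simp only [Bool.not_not, true_and, and_self, if_true, Bool.not_eq_eq_eq_not] at h
      simp [Toward, hg, h]
    · right
      refine ⟨by simpa [Toward, hg] using fun h' : y = x ↦ hy h'.symm, h.trans (if_neg ?_)⟩
      rintro ⟨h1, h2⟩
      exact hy (Prod.ext h1 (by simpa using h2))

lemma norm_of_toward {x : Fin μ × Bool} {g : FreeGroup (Fin μ)} (h : Toward g x) :
    norm g = norm (leg x * g) + 1 := by
  rcases toWord_leg_mul x g with ⟨-, h'⟩ | ⟨h', -⟩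
  · exact congrArg List.length h'
  · exact (h' h).elim

lemma norm_of_not_toward {x : Fin μ × Bool} {g : FreeGroup (Fin μ)} (h : ¬ Toward g x) :
    norm (leg x * g) = norm g + 1 := by
  rcases toWord_leg_mul x g with ⟨h', -⟩ | ⟨-, h'⟩
  · exact (h h').elim
  · exact congrArg List.length h'

lemma leg_not_mul_leg_mul (x : Fin μ × Bool) (g : FreeGroup (Fin μ)) :
    leg (x.1, !x.2) * (leg x * g) = g := by
  obtain ⟨i, _ | _⟩ := x
  · exact inv_mul_cancel_left (of i) g
  · exact mul_inv_cancel_left (of i) g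

/-- The norms at the two ends of an edge of the Cayley graph differ by one, so the edge leads to `1`
from exactly one end, that of larger norm. Together with `toward_unique` and `exists_toward` this
encodes that the Cayley graph is a tree. -/
lemma toward_leg_mul {x : Fin μ × Bool} {g : FreeGroup (Fin μ)} :
    Toward (leg x * g) (x.1, !x.2) ↔ ¬ Toward g x := by
  constructor
  · intro h h'
    have h1 := norm_of_toward h
    have h2 := norm_of_toward h'
    rw [leg_not_mul_leg_mul] at h1
    omega
  · intro h
    by_contra h'
    have h1 := norm_of_not_toward h'
    have h2 := norm_of_not_toward h
    rw [leg_not_mul_leg_mul] at h1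
    omega

lemma toward_unique {x y : Fin μ × Bool} {g : FreeGroup (Fin μ)} (hx : Toward g x)
    (hy : Toward g y) : x = y := Option.some_injective _ (hx.symm.trans hy)

lemma exists_toward {g : FreeGroup (Fin μ)} (hg : g ≠ 1) : ∃ x, Toward g x := by
  rcases h : g.toWord with _ | ⟨x, t⟩
  · exact (hg (toWord_eq_nil_iff.1 h)).elim
  · exact ⟨x, by simp [Toward, h]⟩

lemma not_toward_one (x : Fin μ × Bool) : ¬ Toward 1 x := by simp [Toward]

end FreeGroup

/-! ### The map `h(V)` is a simple homotopy equivalence -/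

namespace FCover

open FreeGroup

variable {μ : ℕ} [NeZero μ] {W : Type u} [TopologicalSpace W] (P : FCover μ W)
  {C : CellStructure W} {R : C.ι → ℕ} (hR : P.IsBound R)

/-- The cell `c × {0}` of `V × I_μ`. -/
def centerCell (c : boundedCells (μ := μ) R) : (P.splittingCells hR).ι := Sum.inl (c, Sum.inl none)

/-- The cell `c × {± e_i}` of `V × I_μ`. -/
def tipCell (c : boundedCells (μ := μ) R) (x : Fin μ × Bool) : (P.splittingCells hR).ι :=
  Sum.inl (c, Sum.inl (some x))

/-- The cell `c × (0, ± e_i)` of `V × I_μ`. -/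
def armCell (c : boundedCells (μ := μ) R) (x : Fin μ × Bool) : (P.splittingCells hR).ι :=
  Sum.inl (c, Sum.inr x)

/-- The cell `c × {0}` of `Y_i × (-1, 1)`. -/
def midCell (i : Fin μ) (c : yIndex R i) : (P.splittingCells hR).ι :=
  Sum.inr ⟨i, c, Sum.inl none, by simp [subdividedInterior]⟩

/-- The cells `c × (-1, 0)` and `c × (0, 1)` of `Y_i × (-1, 1)`. -/
def halfCell (i : Fin μ) (c : yIndex R i) (b : Bool) : (P.splittingCells hR).ι :=
  Sum.inr ⟨i, c, Sum.inr b, by simp [subdividedInterior]⟩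

/-- The cell of `V` to which the end of `c × [-1, 1]` is attached. -/
def yEnd (i : Fin μ) (c : yIndex R i) (b : Bool) : boundedCells (μ := μ) R :=
  ⟨(c.1.1, if b then of i * c.1.2 else c.1.2), by
    cases b
    · exact c.2.1
    · exact c.2.2⟩

lemma leg_mul_yEnd (i : Fin μ) (c : yIndex R i) (b : Bool) :
    leg (i, b) * (yEnd i c b).1.2 = (yEnd i c (!b)).1.2 := by
  cases b
  · rfl
  · exact inv_mul_cancel_left (of i) c.1.2

lemma toward_yEnd (i : Fin μ) (c : yIndex R i) (b : Bool) :
    Toward (yEnd i c (!b)).1.2 (i, !b) ↔ ¬ Toward (yEnd i c b).1.2 (i, b) := by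
  rw [← leg_mul_yEnd]
  exact toward_leg_mul (x := (i, b))

lemma yEnd_injective (i : Fin μ) (b : Bool) : Function.Injective fun c : yIndex R i ↦ yEnd i c b := by
  intro c c' h
  have h' : (yEnd i c b).1 = (yEnd i c' b).1 := congrArg Subtype.val h
  refine Subtype.ext (Prod.ext (congrArg (fun c ↦ c.1) h') ?_)
  have h2 := congrArg (fun c ↦ c.2) h'
  cases b
  · exact h2
  · exact mul_left_cancel h2

/-- The neighbour in the direction of `1` has smaller norm, hence is within the bound and the
joining tube belongs to `X(V)`. This makes the graph over a cell connected. -/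
lemma exists_yEnd (c : boundedCells (μ := μ) R) (x : Fin μ × Bool) (h : Toward c.1.2 x) :
    ∃ c' : yIndex R x.1, yEnd x.1 c' x.2 = c := by
  have h1 : norm c.1.2 ≤ R c.1.1 := c.2
  have h2 : norm (leg x * c.1.2) ≤ R c.1.1 := by
    have := norm_of_toward h
    omega
  obtain ⟨i, _ | _⟩ := x
  · exact ⟨⟨c.1, h1, h2⟩, rfl⟩
  · refine ⟨⟨(c.1.1, (of i)⁻¹ * c.1.2), h2, ?_⟩, Subtype.ext (Prod.ext rfl ?_)⟩
    · rwa [mul_inv_cancel_left]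
    · exact mul_inv_cancel_left _ _

/-! ### Ends of the edges of the trees, and their images in the base -/

section Faces

lemma map_armCell_one (c : boundedCells (μ := μ) R) (x : Fin μ × Bool)
    (z : Fin (C.dim c.1.1) → ℝ) : (P.splittingCells hR).map (P.armCell hR c x)
      (Fin.snoc z (1 : ℝ) : Fin (C.dim c.1.1 + 1) → ℝ) =
    (P.splittingCells hR).map (P.tipCell hR c x) z := by
  refine congrArg (P.splitting (P.bounded R)).base (Prod.ext ?_ ?_)
  · exact congrArg ((P.boundedStructure hR).map c)
      (funext fun k ↦ Fin.snoc_castSucc (α := fun _ ↦ ℝ) 1 z k)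
  · exact (congrArg (fun s ↦ imuSeg x.1 (halfInterval x.2 s))
      (Fin.snoc_last (α := fun _ ↦ ℝ) 1 z)).trans (congrArg (imuSeg x.1) (halfInterval_one x.2))

lemma map_armCell_neg_one (c : boundedCells (μ := μ) R) (x : Fin μ × Bool)
    (z : Fin (C.dim c.1.1) → ℝ) : (P.splittingCells hR).map (P.armCell hR c x)
      (Fin.snoc z (-1 : ℝ) : Fin (C.dim c.1.1 + 1) → ℝ) =
    (P.splittingCells hR).map (P.centerCell hR c) z := by
  refine congrArg (P.splitting (P.bounded R)).base (Prod.ext ?_ ?_)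
  · exact congrArg ((P.boundedStructure hR).map c)
      (funext fun k ↦ Fin.snoc_castSucc (α := fun _ ↦ ℝ) (-1) z k)
  · exact (congrArg (fun s ↦ imuSeg x.1 (halfInterval x.2 s))
      (Fin.snoc_last (α := fun _ ↦ ℝ) (-1) z)).trans
        (imuSeg_zero x.1 (congrArg Subtype.val (halfInterval_neg_one x.2)))

lemma map_halfCell (i : Fin μ) (c : yIndex R i) (b : Bool)
    (z : Fin (C.dim c.1.1) → ℝ) (s : ℝ) : (P.splittingCells hR).map (P.halfCell hR i c b)
      (Fin.snoc z s : Fin (C.dim c.1.1 + 1) → ℝ) =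
    (P.splitting (P.bounded R)).tube i ((P.yStructure hR i).map c z) (halfInterval b s) := by
  refine congrArg₂ ((P.splitting (P.bounded R)).tube i) ?_ ?_
  · exact congrArg ((P.yStructure hR i).map c)
      (funext fun k ↦ Fin.snoc_castSucc (α := fun _ ↦ ℝ) s z k)
  · exact congrArg (halfInterval b) (Fin.snoc_last (α := fun _ ↦ ℝ) s z)

lemma map_halfCell_one (i : Fin μ) (c : yIndex R i) (b : Bool)
    (z : Fin (C.dim c.1.1) → ℝ) : (P.splittingCells hR).map (P.halfCell hR i c b)
      (Fin.snoc z (1 : ℝ) : Fin (C.dim c.1.1 + 1) → ℝ) =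
    (P.splittingCells hR).map (P.tipCell hR (yEnd i c b) (i, b)) z := by
  rw [map_halfCell, halfInterval_one]
  cases b
  · refine ((P.splitting (P.bounded R)).tube_neg_one i _ rfl).trans ?_
    exact congrArg (P.splitting (P.bounded R)).base (Prod.ext rfl (imuSeg_neg_one i).symm)
  · refine ((P.splitting (P.bounded R)).tube_one i _ rfl).trans ?_
    exact congrArg (P.splitting (P.bounded R)).base
      (Prod.ext (Subtype.ext (P.smul_cellMap C (of i) c.1 _)) (imuSeg_one i).symm)

lemma map_halfCell_neg_one (i : Fin μ) (c : yIndex R i) (b : Bool)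
    (z : Fin (C.dim c.1.1) → ℝ) : (P.splittingCells hR).map (P.halfCell hR i c b)
      (Fin.snoc z (-1 : ℝ) : Fin (C.dim c.1.1 + 1) → ℝ) =
    (P.splittingCells hR).map (P.midCell hR i c) z := by
  rw [map_halfCell, halfInterval_neg_one]
  rfl

lemma splittingMap_map_armCell (c : boundedCells (μ := μ) R) (x : Fin μ × Bool)
    {z : Fin (C.dim c.1.1 + 1) → ℝ} (hz : z ∈ closedBall 0 1) :
    P.splittingMap (P.bounded R) ((P.splittingCells hR).map (P.armCell hR c x) z) =
      C.map c.1.1 (Fin.init z) :=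
  (P.proj_cellMap C c.1 _).trans
    (congrArg (C.map c.1.1) (cubeClamp_of_mem (mem_closedBall_cube_succ.1 hz).1))

lemma splittingMap_map_halfCell (i : Fin μ) (c : yIndex R i) (b : Bool)
    {z : Fin (C.dim c.1.1 + 1) → ℝ} (hz : z ∈ closedBall 0 1) :
    P.splittingMap (P.bounded R) ((P.splittingCells hR).map (P.halfCell hR i c b) z) =
      C.map c.1.1 (Fin.init z) :=
  (P.proj_cellMap C c.1 _).trans
    (congrArg (C.map c.1.1) (cubeClamp_of_mem (mem_closedBall_cube_succ.1 hz).1))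

lemma splittingMap_map_centerCell (c : boundedCells (μ := μ) R)
    {z : Fin (C.dim c.1.1) → ℝ} (hz : z ∈ closedBall 0 1) :
    P.splittingMap (P.bounded R) ((P.splittingCells hR).map (P.centerCell hR c) z) =
      C.map c.1.1 z :=
  (P.proj_cellMap C c.1 _).trans (congrArg (C.map c.1.1) (cubeClamp_of_mem hz))

end Faces

/-- The cells over a cell `c` of the base that are edges of the corresponding tree. -/
abbrev TreeEdge (μ : ℕ) (R : C.ι → ℕ) : Type u :=
  (boundedCells (μ := μ) R × (Fin μ × Bool)) ⊕ (Σ i : Fin μ, yIndex R i × Bool)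

/-- The cell of the base below an edge. -/
def edgeBase : TreeEdge μ R → C.ι
  | .inl (c, _) => c.1.1
  | .inr ⟨_, c, _⟩ => c.1.1

/-- The cell given by an edge. -/
def edgeCell : TreeEdge μ R → (P.splittingCells hR).ι
  | .inl (c, x) => P.armCell hR c x
  | .inr ⟨i, c, b⟩ => P.halfCell hR i c b

/-- The direction in which an edge leads away from the root. -/
def edgeSign : TreeEdge μ R → Bool
  | .inl (c, x) => ¬ Toward c.1.2 x
  | .inr ⟨i, c, b⟩ => Toward (yEnd i c b).1.2 (i, b)

/-- The end points of an edge. -/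
def edgeEnd : TreeEdge μ R → Bool → (P.splittingCells hR).ι
  | .inl (c, x), b => if b then P.tipCell hR c x else P.centerCell hR c
  | .inr ⟨i, c, b⟩, b' => if b' then P.tipCell hR (yEnd i c b) (i, b) else P.midCell hR i c

/-- The distance from the root. -/
def treeDepth : (P.splittingCells hR).ι → ℕ
  -- Between adjacent centres lie a tip, a midpoint and a tip, so one unit of norm counts four. The
  -- depth is used only at vertices; its values on edge cells carry no meaning.
  | .inl (c, .inl none) => 4 * norm c.1.2
  | .inl (c, .inl (some x)) => if Toward c.1.2 x then 4 * norm c.1.2 - 1 else 4 * norm c.1.2 + 1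
  | .inl (_, .inr _) => 0
  | .inr ⟨i, c, _⟩ => 4 * min (norm (yEnd i c false).1.2) (norm (yEnd i c true).1.2) + 2

lemma treeDepth_tip_of_toward {c : boundedCells (μ := μ) R} {x : Fin μ × Bool}
    (h : Toward c.1.2 x) : P.treeDepth hR (P.tipCell hR c x) = 4 * norm c.1.2 - 1 := if_pos h

lemma treeDepth_tip_of_not_toward {c : boundedCells (μ := μ) R} {x : Fin μ × Bool}
    (h : ¬ Toward c.1.2 x) : P.treeDepth hR (P.tipCell hR c x) = 4 * norm c.1.2 + 1 := if_neg h

lemma treeDepth_mid (i : Fin μ) (c : yIndex R i) (b : Bool) : P.treeDepth hR (P.midCell hR i c) =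
    4 * min (norm (yEnd i c b).1.2) (norm (leg (i, b) * (yEnd i c b).1.2)) + 2 := by
  rw [leg_mul_yEnd]
  cases b
  · rfl
  · rw [min_comm]; rfl

lemma treeDepth_near_lt (q : TreeEdge μ R) : P.treeDepth hR (P.edgeEnd hR q (!edgeSign q)) <
    P.treeDepth hR (P.edgeEnd hR q (edgeSign q)) := by
  rcases q with ⟨c, x⟩ | ⟨i, c, b⟩
  · by_cases h : Toward c.1.2 x
    · have h1 : edgeSign (.inl (c, x) : TreeEdge μ R) = false := by simp [edgeSign, h]
      rw [h1]
      change P.treeDepth hR (P.tipCell hR c x) < 4 * norm c.1.2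
      rw [treeDepth_tip_of_toward _ _ h]
      have := norm_of_toward h
      omega
    · have h1 : edgeSign (.inl (c, x) : TreeEdge μ R) = true := by simp [edgeSign, h]
      rw [h1]
      change 4 * norm c.1.2 < P.treeDepth hR (P.tipCell hR c x)
      rw [treeDepth_tip_of_not_toward _ _ h]
      omega
  · by_cases h : Toward (yEnd i c b).1.2 (i, b)
    · have h1 : edgeSign (.inr ⟨i, c, b⟩ : TreeEdge μ R) = true := by simp [edgeSign, h]
      rw [h1]
      change P.treeDepth hR (P.midCell hR i c) < P.treeDepth hR (P.tipCell hR (yEnd i c b) (i, b))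
      rw [treeDepth_tip_of_toward _ _ h, treeDepth_mid _ _ i c b]
      have := norm_of_toward h
      omega
    · have h1 : edgeSign (.inr ⟨i, c, b⟩ : TreeEdge μ R) = false := by simp [edgeSign, h]
      rw [h1]
      change P.treeDepth hR (P.tipCell hR (yEnd i c b) (i, b)) < P.treeDepth hR (P.midCell hR i c)
      rw [treeDepth_tip_of_not_toward _ _ h, treeDepth_mid _ _ i c b]
      have := norm_of_not_toward h
      omega

/-- Every vertex other than the root is the far end of the edge through which the path to the root
leaves it. For a centre this is the arm in the direction of `1`. -/
lemma exists_far_eq_center (c : boundedCells (μ := μ) R) (hc : c.1.2 ≠ 1) :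
    ∃ q : TreeEdge μ R, P.edgeEnd hR q (edgeSign q) = P.centerCell hR c ∧ edgeBase q = c.1.1 := by
  obtain ⟨x, hx⟩ := exists_toward hc
  refine ⟨.inl (c, x), ?_, rfl⟩
  have h1 : edgeSign (.inl (c, x) : TreeEdge μ R) = false := by simp [edgeSign, hx]
  rw [h1]; rfl

/-- From a tip pointing to `1` the path to the root leaves into the tube; from any other tip,
possibly a free one, it returns along the arm. -/
lemma exists_far_eq_tip (c : boundedCells (μ := μ) R) (x : Fin μ × Bool) :
    ∃ q : TreeEdge μ R, P.edgeEnd hR q (edgeSign q) = P.tipCell hR c x ∧ edgeBase q = c.1.1 := by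
  by_cases h : Toward c.1.2 x
  · obtain ⟨c', hc'⟩ := exists_yEnd c x h
    refine ⟨.inr ⟨x.1, c', x.2⟩, ?_, by rw [← hc']; rfl⟩
    have h1 : edgeSign (.inr ⟨x.1, c', x.2⟩ : TreeEdge μ R) = true := by
      simp [edgeSign, hc', h]
    rw [h1, ← hc']; rfl
  · refine ⟨.inl (c, x), ?_, rfl⟩
    have h1 : edgeSign (.inl (c, x) : TreeEdge μ R) = true := by simp [edgeSign, h]
    rw [h1]; rfl

lemma exists_far_eq_mid (i : Fin μ) (c : yIndex R i) :
    ∃ q : TreeEdge μ R, P.edgeEnd hR q (edgeSign q) = P.midCell hR i c ∧ edgeBase q = c.1.1 := by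
  -- The end of the tube nearer to `1` is the one from which the tube does not lead to `1`; the half
  -- towards it is the required edge.
  obtain ⟨b, hb⟩ : ∃ b, ¬ Toward (yEnd i c b).1.2 (i, b) := by
    by_cases h : Toward (yEnd i c false).1.2 (i, false)
    · exact ⟨true, fun h' ↦ (toward_yEnd i c false).1 h' h⟩
    · exact ⟨false, h⟩
  refine ⟨.inr ⟨i, c, b⟩, ?_, rfl⟩
  have h1 : edgeSign (.inr ⟨i, c, b⟩ : TreeEdge μ R) = false := by simp [edgeSign, hb]
  rw [h1]; rfl

lemma edgeCell_injective : Function.Injective (P.edgeCell hR) := by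
  rintro (⟨c, x⟩ | ⟨i, c, b⟩) (⟨c', x'⟩ | ⟨i', c', b'⟩) h <;> cases h <;> rfl

/-- A vertex has only one edge leading to the root. At a centre this is `toward_unique`, at a
midpoint `toward_yEnd`. At a tip the arm and the half tube require opposite directions. -/
lemma edgeFar_injective :
    Function.Injective fun q : TreeEdge μ R ↦ P.edgeEnd hR q (edgeSign q) := by
  rintro (⟨c, x⟩ | ⟨i, c, b⟩) (⟨c', x'⟩ | ⟨i', c', b'⟩) h
  · simp only [edgeEnd, edgeSign] at h
    by_cases hx : Toward c.1.2 x <;> by_cases hx' : Toward c'.1.2 x' <;>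
      simp only [hx, hx', not_true_eq_false, not_false_eq_true, decide_true, decide_false,
        Bool.false_eq_true, if_true, if_false] at h
    · cases h
      rw [toward_unique hx hx']
    · cases h
    · cases h
    · cases h; rfl
  · simp only [edgeEnd, edgeSign] at h
    by_cases hx : Toward c.1.2 x <;> by_cases hx' : Toward (yEnd i' c' b').1.2 (i', b') <;>
      simp only [hx, hx', not_true_eq_false, not_false_eq_true, decide_true, decide_false,
        Bool.false_eq_true, if_true, if_false] at h
    · cases h
    · cases h
    · cases h; exact (hx hx').elim
    · cases h
  · simp only [edgeEnd, edgeSign] at h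
    by_cases hx : Toward c'.1.2 x' <;> by_cases hx' : Toward (yEnd i c b).1.2 (i, b) <;>
      simp only [hx, hx', not_true_eq_false, not_false_eq_true, decide_true, decide_false,
        Bool.false_eq_true, if_true, if_false] at h
    · cases h
    · cases h
    · cases h; exact (hx hx').elim
    · cases h
  · simp only [edgeEnd, edgeSign] at h
    by_cases hx : Toward (yEnd i c b).1.2 (i, b) <;>
      by_cases hx' : Toward (yEnd i' c' b').1.2 (i', b') <;>
      simp only [hx, hx', decide_true, decide_false, Bool.false_eq_true, if_true, if_false] at h
    · obtain ⟨h1, h2⟩ := Prod.mk.inj (Sum.inl_injective h)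
      cases h2
      rw [yEnd_injective i b h1]
    · cases h
    · cases h
    · cases h
      rcases eq_or_ne b b' with rfl | hb
      · rfl
      · obtain rfl : b' = !b := by cases b <;> cases b' <;> simp_all
        exact (hx' ((toward_yEnd i c b).2 hx)).elim

/-- The section of `h(V)` over a cell. -/
def rootCell (d : C.ι) : (P.splittingCells hR).ι := P.centerCell hR ⟨(d, 1), by simp [boundedCells]⟩

lemma rootCell_ne_far (d : C.ι) (q : TreeEdge μ R) :
    P.rootCell hR d ≠ P.edgeEnd hR q (edgeSign q) := by
  intro h
  rcases q with ⟨c, x⟩ | ⟨i, c, b⟩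
  · simp only [edgeEnd, edgeSign] at h
    by_cases hx : Toward c.1.2 x <;>
      simp only [hx, not_true_eq_false, not_false_eq_true, decide_true, decide_false,
        Bool.false_eq_true, if_true, if_false] at h
    · cases h; exact not_toward_one _ hx
    · cases h
  · simp only [edgeEnd] at h
    split_ifs at h
    · cases (Prod.mk.inj (Sum.inl_injective h)).2
    · exact Sum.inl_ne_inr h

/-- The characteristic map of an edge. -/
noncomputable def edgeMap : ∀ q : TreeEdge μ R, (Fin (C.dim (edgeBase q) + 1) → ℝ) →
    (P.splitting (P.bounded R)).X
  | .inl (c, x) => (P.splittingCells hR).map (P.armCell hR c x)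
  | .inr ⟨i, c, b⟩ => (P.splittingCells hR).map (P.halfCell hR i c b)

lemma isChar_edgeMap (q : TreeEdge μ R) :
    (P.splittingCells hR).IsChar (P.edgeCell hR q) (P.edgeMap hR q) := by
  rcases q with ⟨c, x⟩ | ⟨i, c, b⟩
  · exact (P.splittingCells hR).isChar_map (P.armCell hR c x)
  · exact (P.splittingCells hR).isChar_map (P.halfCell hR i c b)

lemma isChar_edgeEnd (q : TreeEdge μ R) (b : Bool) :
    (P.splittingCells hR).IsChar (P.edgeEnd hR q b) fun x ↦
      P.edgeMap hR q (Fin.snoc x (boolSign b) : Fin (_ + 1) → ℝ) := by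
  rcases q with ⟨c, x⟩ | ⟨i, c, b'⟩ <;> cases b
  · exact ((P.splittingCells hR).isChar_map (P.centerCell hR c)).congr
      fun z _ ↦ P.map_armCell_neg_one hR c x z
  · exact ((P.splittingCells hR).isChar_map (P.tipCell hR c x)).congr
      fun z _ ↦ P.map_armCell_one hR c x z
  · exact ((P.splittingCells hR).isChar_map (P.midCell hR i c)).congr
      fun z _ ↦ P.map_halfCell_neg_one hR i c b' z
  · exact ((P.splittingCells hR).isChar_map (P.tipCell hR (yEnd i c b') (i, b'))).congr
      fun z _ ↦ P.map_halfCell_one hR i c b' z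

lemma boolSign_not (b : Bool) : boolSign (!b) = -boolSign b := by cases b <;> simp

lemma splittingCells_cases (k : (P.splittingCells hR).ι) :
    (∃ d, k = P.rootCell hR d) ∨
      ∃ q, k = P.edgeCell hR q ∨ k = P.edgeEnd hR q (edgeSign q) := by
  rcases k with ⟨c, (_ | x) | x⟩ | ⟨i, c, ⟨(_ | b) | b, hd⟩⟩
  · by_cases hc : c.1.2 = 1
    · refine Or.inl ⟨c.1.1, congrArg (P.centerCell hR) (Subtype.ext (Prod.ext rfl hc))⟩
    · obtain ⟨q, hq, -⟩ := P.exists_far_eq_center hR c hc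
      exact Or.inr ⟨q, Or.inr hq.symm⟩
  · obtain ⟨q, hq, -⟩ := P.exists_far_eq_tip hR c x
    exact Or.inr ⟨q, Or.inr hq.symm⟩
  · exact Or.inr ⟨.inl (c, x), Or.inl rfl⟩
  · obtain ⟨q, hq, -⟩ := P.exists_far_eq_mid hR i c
    exact Or.inr ⟨q, Or.inr hq.symm⟩
  · exact (hd b rfl).elim
  · exact Or.inr ⟨.inr ⟨i, c, b⟩, Or.inl rfl⟩

lemma edgeEnd_cases (q : TreeEdge μ R) (b : Bool) : P.edgeEnd hR q b = P.rootCell hR (edgeBase q) ∨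
    ∃ q', P.edgeEnd hR q b = P.edgeEnd hR q' (edgeSign q') ∧ edgeBase q' = edgeBase q := by
  rcases q with ⟨c, x⟩ | ⟨i, c, b'⟩ <;> cases b
  · by_cases hc : c.1.2 = 1
    · exact Or.inl (congrArg (P.centerCell hR) (Subtype.ext (Prod.ext rfl hc)))
    · obtain ⟨q, hq, hq'⟩ := P.exists_far_eq_center hR c hc
      exact Or.inr ⟨q, hq.symm, hq'⟩
  · obtain ⟨q, hq, hq'⟩ := P.exists_far_eq_tip hR c x
    exact Or.inr ⟨q, hq.symm, hq'⟩
  · obtain ⟨q, hq, hq'⟩ := P.exists_far_eq_mid hR i c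
    exact Or.inr ⟨q, hq.symm, hq'⟩
  · obtain ⟨q, hq, hq'⟩ := P.exists_far_eq_tip hR (yEnd i c b') (i, b')
    exact Or.inr ⟨q, hq.symm, hq'⟩

lemma edgeCell_ne_edgeEnd (q q' : TreeEdge μ R) (b : Bool) :
    P.edgeCell hR q ≠ P.edgeEnd hR q' b := by
  rcases q with ⟨c, x⟩ | ⟨i, c, b'⟩ <;> rcases q' with ⟨c', x'⟩ | ⟨i', c', b''⟩ <;> cases b <;>
    intro h <;> cases h

variable {P} in
/-- The map `h(V)` is a simple homotopy equivalence. -/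
theorem isSimpleHomotopyEquiv_splittingMap (L : FiniteCW W) {R : L.toCells.ι → ℕ}
    (hR : P.IsBound R) [T2Space (P.splitting (P.bounded R)).X]
    [Finite (P.splittingCells hR).ι] :
    IsSimpleHomotopyEquiv (P.splittingCells hR).toFiniteCW L (P.splittingMap (P.bounded R)) := by
  have := L.t2
  have := L.compactSpace
  have := (P.splittingCells hR).compactSpace
  have := cylinder_t2Space (P.splittingMap (P.bounded R))
  have h1 : ∀ i : Fin μ, Finite (yIndex R i) := fun i ↦ (finite_boundedCells (μ := μ)
    (C := L.toCells) (R := R)).subset fun c (hc : c ∈ yIndex R i) ↦ hc.1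
  have h2 : Finite (boundedCells (μ := μ) R) := finite_boundedCells (C := L.toCells)
  refine isSimpleHomotopyEquiv_of_cylinder (P.splittingMap (P.bounded R)) (P.splittingCells hR) L
    (fun k x hx ↦ ⟨_, P.baseCell_dim_le hR k, P.splittingMap_mem_openCell hR hx⟩) ?_
  refine (isFormalInclusion_cylinderInl (P.splittingMap (P.bounded R)) (P.splittingCells hR)
    L.toCells _ (P.rootCell hR)
    (fun d ↦ (P.splittingCells hR).map (P.rootCell hR d))
    (fun d ↦ (P.splittingCells hR).isChar_map (P.rootCell hR d))
    (fun d x hx ↦ P.splittingMap_map_centerCell hR _ hx)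
    (Q := TreeEdge μ R) edgeBase (P.edgeCell hR)
    (fun q ↦ P.edgeEnd hR q (edgeSign q)) (fun q ↦ P.edgeEnd hR q (!edgeSign q)) edgeSign
    (P.edgeMap hR) (P.isChar_edgeMap hR) ?_ (fun q ↦ P.isChar_edgeEnd hR q (edgeSign q)) ?_
    (P.treeDepth hR) (P.treeDepth_near_lt hR) (fun q ↦ P.edgeEnd_cases hR q _) ?_
    (P.edgeCell_injective hR) (P.edgeFar_injective hR) ?_ (P.rootCell_ne_far hR)
    (fun q q' ↦ P.edgeCell_ne_edgeEnd hR q q' _) (P.splittingCells_cases hR)).1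
  · rintro (⟨c, x⟩ | ⟨i, c, b⟩) z hz
    · exact P.splittingMap_map_armCell hR c x hz
    · exact P.splittingMap_map_halfCell hR i c b hz
  · intro q x hx
    rw [← (P.isChar_edgeEnd hR q _).image_ball, ← boolSign_not]
    exact mem_image_of_mem _ hx
  · intro d d' h
    cases h; rfl
  · rintro d (⟨c, x⟩ | ⟨i, c, b⟩) h <;> cases h

variable {P} in
/-- The quadruple `(X(V), Y(V), Z(V), h(V))` is a simple homotopy `F_μ`-splitting. -/
theorem isSimpleHomotopySplitting (L : FiniteCW W) {R : L.toCells.ι → ℕ}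
    (hR : P.IsBound R) [T2Space (P.splitting (P.bounded R)).X]
    [Finite (P.splittingCells hR).ι] :
    (P.splitting (P.bounded R)).IsSimpleHomotopySplitting L (P.splittingCells hR).toFiniteCW
      (P.splittingMap (P.bounded R)) :=
  have := L.t2
  have h := isSimpleHomotopyEquiv_splittingMap L hR
  ⟨h.isHomotopyEquiv, isSubcomplex_YSet hR, isSubcomplex_ZSet hR, h⟩

end FCover

/-! ### The fundamental domain of the pullback cover -/

namespace FCover

variable {μ : ℕ} {W : Type u} [TopologicalSpace W] (P : FCover μ W)

section Pullback

variable {X : Type u} [TopologicalSpace X] (h : C(X, W))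

/-- The projection of the pullback to the total space. -/
def pullbackSnd : C((P.pullback h).E, P.E) :=
  ⟨fun q : P.PullbackE h ↦ q.1.2, continuous_snd.comp continuous_subtype_val⟩

/-- The point of the pullback given by a compatible pair. -/
def pullbackMk (x : X) (e : P.E) (hxe : h x = P.proj e) : (P.pullback h).E :=
  (⟨(x, e), hxe⟩ : P.PullbackE h)

lemma pullback_ext {q q' : (P.pullback h).E} (h1 : (P.pullback h).proj q = (P.pullback h).proj q')
    (h2 : P.pullbackSnd h q = P.pullbackSnd h q') : q = q' := Subtype.ext (Prod.ext h1 h2)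

lemma apply_proj_pullback (q : (P.pullback h).E) :
    h ((P.pullback h).proj q) = P.proj (P.pullbackSnd h q) := q.2

lemma pullbackSnd_smul (g : FreeGroup (Fin μ)) (q : (P.pullback h).E) :
    P.pullbackSnd h (g • q) = g • P.pullbackSnd h q := rfl

/-- A map to the pullback. -/
def pullbackLift {T : Type*} [TopologicalSpace T] (f : C(T, X)) (k : C(T, P.E))
    (hfk : ∀ t, h (f t) = P.proj (k t)) : C(T, (P.pullback h).E) :=
  ⟨fun t ↦ P.pullbackMk h (f t) (k t) (hfk t),
    (f.continuous.prodMk k.continuous).subtype_mk hfk⟩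

end Pullback

/-- The translation from `Y_i` at the end `-1` or `1` of `Y_i × [-1, 1]` to `V`. -/
def sideElt (i : Fin μ) (b : Bool) : FreeGroup (Fin μ) := if b then FreeGroup.of i else 1

variable (V : Set P.E)

/-- The fundamental domain of `h(V)^* E`: the lift of `Z(V)` given by the projection to `V` together
with both halves of `Y(V) × [-1, 1]`, lifted compatibly. -/
def fundamentalDomain : Set (P.pullback (P.splittingMap V)).E :=
  {q | (∃ (v : V) (s : Imu μ), (P.pullback (P.splittingMap V)).proj q =
      (P.splitting V).base (v, s) ∧ P.pullbackSnd _ q = v) ∨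
    ∃ (i : Fin μ) (y : P.ySet V i) (t : Icc (-1 : ℝ) 1) (b : Bool), 0 ≤ boolSign b * (t : ℝ) ∧
      (P.pullback (P.splittingMap V)).proj q = (P.splitting V).tube i y t ∧
      P.pullbackSnd _ q = sideElt i b • (y : P.E)}

variable {V}

/-- A point of `Z` may also be the end of a tube. The half labelled `b` contains only the end with
sign `b`, and `sideElt` makes its lift agree with the attaching map there, so no second lift arises.
-/
lemma mem_fundamentalDomain_base {q : (P.pullback (P.splittingMap V)).E} {v : V} {s : Imu μ}
    (hq : (P.pullback (P.splittingMap V)).proj q = (P.splitting V).base (v, s)) :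
    q ∈ P.fundamentalDomain V ↔ P.pullbackSnd _ q = v := by
  constructor
  · rintro (⟨v', s', h1, h2⟩ | ⟨i, y, t, b, hb, h1, h2⟩)
    · obtain ⟨rfl, rfl⟩ := Prod.mk.inj ((P.splitting V).base_injective (hq.symm.trans h1))
      exact h2
    · by_cases ht : |(t : ℝ)| < 1
      · exact ((P.splitting V).tube_ne_base ht _ (h1.symm.trans hq)).elim
      · obtain ⟨b', rfl⟩ := exists_intervalEnd ht
        cases b'
        · rw [(P.splitting V).tube_neg_one i y rfl] at h1
          have h3 := congrArg Prod.fst ((P.splitting V).base_injective (hq.symm.trans h1))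
          cases b
          · rw [h2, sideElt, if_neg (by simp), one_smul]
            exact (congrArg Subtype.val h3).symm
          · exact absurd hb (by simp [intervalEnd])
        · rw [(P.splitting V).tube_one i y rfl] at h1
          have h3 := congrArg Prod.fst ((P.splitting V).base_injective (hq.symm.trans h1))
          cases b
          · exact absurd hb (by simp [intervalEnd])
          · rw [h2, sideElt, if_pos rfl]
            exact (congrArg Subtype.val h3).symm
  · exact fun h ↦ Or.inl ⟨v, s, hq, h⟩

lemma mem_fundamentalDomain_tube {q : (P.pullback (P.splittingMap V)).E} {i : Fin μ}
    {y : P.ySet V i} {t : Icc (-1 : ℝ) 1} (ht : |(t : ℝ)| < 1)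
    (hq : (P.pullback (P.splittingMap V)).proj q = (P.splitting V).tube i y t) :
    q ∈ P.fundamentalDomain V ↔
      ∃ b, 0 ≤ boolSign b * (t : ℝ) ∧ P.pullbackSnd _ q = sideElt i b • (y : P.E) := by
  constructor
  · rintro (⟨v', s', h1, h2⟩ | ⟨i', y', t', b, hb, h1, h2⟩)
    · exact ((P.splitting V).tube_ne_base ht _ (hq.symm.trans h1)).elim
    · by_cases ht' : |(t' : ℝ)| < 1
      · obtain ⟨h3, rfl⟩ := (P.splitting V).tube_eq_tube ht ht' (hq.symm.trans h1)
        obtain ⟨rfl, h3⟩ := Sigma.mk.inj h3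
        obtain rfl := eq_of_heq h3
        exact ⟨b, hb, h2⟩
      · obtain ⟨b', rfl⟩ := exists_intervalEnd ht'
        cases b'
        · rw [(P.splitting V).tube_neg_one i' y' rfl] at h1
          exact ((P.splitting V).tube_ne_base ht _ (hq.symm.trans h1)).elim
        · rw [(P.splitting V).tube_one i' y' rfl] at h1
          exact ((P.splitting V).tube_ne_base ht _ (hq.symm.trans h1)).elim
  · rintro ⟨b, hb, h⟩
    exact Or.inr ⟨i, y, t, b, hb, hq, h⟩

lemma exists_boolSign_mul_nonneg (t : ℝ) : ∃ b, 0 ≤ boolSign b * t := by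
  rcases le_total 0 t with h | h
  · exact ⟨true, by simpa using h⟩
  · exact ⟨false, by simpa using h⟩

/-- Over `Z` the domain contains exactly one lift. Over a tube the possible lifts are `y` and `z_i
y`, so two lifts of the same point differ by `1` or by `z_i` or its inverse. Only the midpoint of
the tube has both. -/
lemma eq_of_smul_mem_fundamentalDomain {q : (P.pullback (P.splittingMap V)).E}
    {g k : FreeGroup (Fin μ)} (hg : g⁻¹ • q ∈ P.fundamentalDomain V)
    (hk : k⁻¹ • q ∈ P.fundamentalDomain V) : g = k ∨ (∃ i, g = k * FreeGroup.of i) ∨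
      ∃ i, g = k * (FreeGroup.of i)⁻¹ := by
  have hpg : (P.pullback (P.splittingMap V)).proj (g⁻¹ • q) =
    (P.pullback (P.splittingMap V)).proj q := (P.pullback _).proj_smul _ _
  have hpk : (P.pullback (P.splittingMap V)).proj (k⁻¹ • q) =
    (P.pullback (P.splittingMap V)).proj q := (P.pullback _).proj_smul _ _
  have key : ∀ (a b : FreeGroup (Fin μ)) (y : P.E), g⁻¹ • P.pullbackSnd _ q = a • y →
      k⁻¹ • P.pullbackSnd _ q = b • y → g * a = k * b := by
    intro a b y h1 h2
    refine P.smul_right_injective y ?_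
    change (g * a) • y = (k * b) • y
    rw [mul_smul, mul_smul, ← h1, ← h2, smul_inv_smul, smul_inv_smul]
  rcases (P.splitting V).base_or_tube ((P.pullback (P.splittingMap V)).proj q) with
    ⟨⟨v, s⟩, h⟩ | ⟨i, y, t, ht, h⟩
  · rw [P.mem_fundamentalDomain_base (hpg.trans h), pullbackSnd_smul] at hg
    rw [P.mem_fundamentalDomain_base (hpk.trans h), pullbackSnd_smul] at hk
    have := key 1 1 v (by rwa [one_smul]) (by rwa [one_smul])
    rw [mul_one, mul_one] at this
    exact Or.inl this
  · rw [P.mem_fundamentalDomain_tube ht (hpg.trans h)] at hg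
    rw [P.mem_fundamentalDomain_tube ht (hpk.trans h)] at hk
    obtain ⟨b, -, hb⟩ := hg
    obtain ⟨b', -, hb'⟩ := hk
    have := key _ _ _ hb hb'
    cases b <;> cases b' <;> simp only [sideElt, Bool.false_eq_true, if_true, if_false, mul_one]
      at this
    · exact Or.inl this
    · exact Or.inr (Or.inl ⟨i, this⟩)
    · exact Or.inr (Or.inr ⟨i, eq_mul_inv_of_mul_eq this⟩)
    · exact Or.inl (mul_right_cancel this)

lemma iUnion_smul_fundamentalDomain :
    ⋃ g : FreeGroup (Fin μ), g • P.fundamentalDomain V = univ := by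
  refine eq_univ_of_forall fun q ↦ mem_iUnion.2 ?_
  have key : ∀ y : P.E, P.proj (P.pullbackSnd _ q) = P.proj y → ∀ a : FreeGroup (Fin μ),
      ∃ g : FreeGroup (Fin μ), P.pullbackSnd _ (g⁻¹ • q) = a • y := by
    intro y hy a
    obtain ⟨g, hg⟩ := P.exists_smul_eq hy
    refine ⟨g * a⁻¹, ?_⟩
    rw [pullbackSnd_smul, ← hg, mul_inv_rev, inv_inv, mul_smul, inv_smul_smul]
  have hp := P.apply_proj_pullback (P.splittingMap V) q
  have hpg : ∀ g : FreeGroup (Fin μ), (P.pullback (P.splittingMap V)).proj (g⁻¹ • q) =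
    (P.pullback (P.splittingMap V)).proj q := fun g ↦ (P.pullback _).proj_smul _ _
  rcases (P.splitting V).base_or_tube ((P.pullback (P.splittingMap V)).proj q) with
    ⟨⟨v, s⟩, h⟩ | ⟨i, (y : P.ySet V i), t, ht, h⟩
  · rw [h] at hp
    obtain ⟨g, hg⟩ := key v hp.symm 1
    refine ⟨g, mem_smul_set_iff_inv_smul_mem.2 ?_⟩
    rw [P.mem_fundamentalDomain_base ((hpg g).trans h), hg, one_smul]
  · rw [h] at hp
    obtain ⟨b, hb⟩ := exists_boolSign_mul_nonneg (t : ℝ)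
    obtain ⟨g, hg⟩ := key y hp.symm (sideElt i b)
    refine ⟨g, mem_smul_set_iff_inv_smul_mem.2 ?_⟩
    rw [P.mem_fundamentalDomain_tube ht ((hpg g).trans h)]
    exact ⟨b, hb, hg⟩

/-- Seen in `X(V) × E`, the domain is the preimage of a finite union of compact sets, one for `Z(V)`
and one for each half tube. -/
lemma isClosed_fundamentalDomain [T2Space P.E] [T2Space (P.splitting V).X]
    (hV : IsCompact V) (hY : ∀ i, IsCompact (P.ySet V i)) [CompactSpace (Imu μ)] :
    IsClosed (P.fundamentalDomain V) := by
  have hV' : CompactSpace V := isCompact_iff_compactSpace.1 hV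
  have hY' : ∀ i, CompactSpace (P.ySet V i) := fun i ↦ isCompact_iff_compactSpace.1 (hY i)
  have h0 : Continuous fun p : V × Imu μ ↦ ((P.splitting V).base p, (p.1 : P.E)) :=
    Continuous.prodMk (P.splitting V).baseMap.continuous
      (continuous_subtype_val.comp continuous_fst)
  have h1 := isCompact_range h0
  have h2 : ∀ i b, IsCompact ((fun p : P.ySet V i × Icc (-1 : ℝ) 1 ↦
      ((P.splitting V).tube i p.1 p.2, sideElt i b • (p.1 : P.E))) ''
        {p | 0 ≤ boolSign b * (p.2 : ℝ)}) := by
    intro i b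
    refine IsCompact.image (IsClosed.isCompact ?_) (Continuous.prodMk
      ((P.splitting V).tubeMap i).continuous
      ((P.continuous_smul _).comp (continuous_subtype_val.comp continuous_fst)))
    exact isClosed_le continuous_const (by fun_prop)
  have h3 : IsClosed ((range fun p : V × Imu μ ↦ ((P.splitting V).base p, (p.1 : P.E))) ∪
      ⋃ i, ⋃ b, ((fun p : P.ySet V i × Icc (-1 : ℝ) 1 ↦
        ((P.splitting V).tube i p.1 p.2, sideElt i b • (p.1 : P.E))) ''
          {p | 0 ≤ boolSign b * (p.2 : ℝ)})) :=
    h1.isClosed.union (isClosed_iUnion_of_finite fun i ↦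
      isClosed_iUnion_of_finite fun b ↦ (h2 i b).isClosed)
  have h4 : Continuous fun q : (P.pullback (P.splittingMap V)).E ↦
      ((P.pullback (P.splittingMap V)).proj q, P.pullbackSnd _ q) :=
    (P.pullback _).continuous_proj.prodMk (P.pullbackSnd _).continuous
  convert h3.preimage h4 using 1
  ext q
  simp only [fundamentalDomain, mem_ofPred_eq, mem_preimage, mem_union, mem_range, mem_iUnion,
    mem_image, Prod.mk.injEq, Prod.exists]
  constructor
  · rintro (⟨v, s, h1, h2⟩ | ⟨i, y, t, b, hb, h1, h2⟩)
    · exact Or.inl ⟨v, s, h1.symm, h2.symm⟩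
    · exact Or.inr ⟨i, b, y, t, hb, h1.symm, h2.symm⟩
  · rintro (⟨v, s, h1, h2⟩ | ⟨i, b, y, t, hb, h1, h2⟩)
    · exact Or.inl ⟨v, s, h1.symm, h2.symm⟩
    · exact Or.inr ⟨i, y, t, b, hb, h1.symm, h2.symm⟩

lemma isFundamentalDomain [T2Space P.E] [T2Space (P.splitting V).X]
    (hV : IsCompact V) (hY : ∀ i, IsCompact (P.ySet V i)) [CompactSpace (Imu μ)] :
    (P.pullback (P.splittingMap V)).IsFundamentalDomain (P.fundamentalDomain V) where
  isClosed := P.isClosed_fundamentalDomain hV hY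
  cover := P.iUnion_smul_fundamentalDomain
  -- The two formulas for neighbouring translates hold for every subset; the content of a
  -- fundamental domain lies in the covering and the emptiness conditions.
  inter_right g k i h := by
    rw [smul_set_inter, smul_smul, h, mul_inv_cancel_right]
  inter_left g k i h := by
    rw [smul_set_inter, smul_smul, h, inter_comm]
  inter_empty g k h1 h2 h3 := by
    refine eq_empty_of_forall_notMem fun q ⟨hg, hk⟩ ↦ ?_
    rcases P.eq_of_smul_mem_fundamentalDomain (mem_smul_set_iff_inv_smul_mem.1 hg)
      (mem_smul_set_iff_inv_smul_mem.1 hk) with h | ⟨i, h⟩ | ⟨i, h⟩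
    · exact h1 h
    · exact h2 i h
    · exact h3 i h

/-! ### The fundamental domain is a subcomplex -/

lemma side_of_mem_closedCell {d : subdividedCells.ι} {b : Bool} (hd : d ≠ Sum.inr (!b))
    (hd' : d ∈ subdividedInterior) (x : Fin (subdividedCells.dim d) → ℝ) :
    0 ≤ boolSign b * (subdividedCells.map d x : ℝ) := by
  rcases d with (_ | w) | c
  · change 0 ≤ boolSign b * 0
    simp
  · exact (hd' w rfl).elim
  · obtain rfl : c = b := by cases c <;> cases b <;> simp_all
    change 0 ≤ boolSign c * (boolSign c * toUnit (x (0 : Fin 1)))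
    rw [boolSign_mul_self]
    exact (toUnit_mem _).1

lemma ne_of_mem_openCell {d : subdividedCells.ι} {b : Bool} {t : Icc (-1 : ℝ) 1}
    (ht : t ∈ subdividedCells.openCell d) (hb : 0 ≤ boolSign b * (t : ℝ)) : d ≠ Sum.inr (!b) := by
  rintro rfl
  obtain ⟨x, hx, rfl⟩ := ht
  have h1 := (toUnit_mem_Ioo (mem_ball_cube.1 hx (0 : Fin 1))).1
  change 0 ≤ boolSign b * (boolSign (!b) * toUnit (x (0 : Fin 1))) at hb
  rw [boolSign_not, neg_mul, mul_neg, boolSign_mul_self] at hb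
  linarith

variable [NeZero μ] {C : CellStructure W} {R : C.ι → ℕ} (hR : P.IsBound R)

/-- The lift of a cell of `Z(V)` to the fundamental domain. -/
noncomputable def zLift (c : (P.zStructure hR).ι) :
    C(Fin ((P.zStructure hR).dim c) → ℝ, (P.pullback (P.splittingMap (P.bounded R))).E) :=
  P.pullbackLift _ ((P.splitting (P.bounded R)).baseMap.comp ((P.zStructure hR).map c))
    ⟨fun x ↦ ((P.zStructure hR).map c x).1, by fun_prop⟩ fun _ ↦ rfl

/-- The lifts of a cell of `Y_i(V) × (-1, 1)` to the fundamental domain. -/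
noncomputable def yLift (i : Fin μ) (c : yIndex R i) (d : subdividedInterior) (b : Bool) :
    C(Fin (((P.yStructure hR i).dim c) + subdividedCells.dim d) → ℝ,
      (P.pullback (P.splittingMap (P.bounded R))).E) :=
  P.pullbackLift _ ((P.splittingCells hR).map (Sum.inr ⟨i, c, d⟩))
    ⟨fun x ↦ sideElt i b • ((CellStructure.prodMap (P.yStructure hR i) subdividedCells c d x).1 : P.E),
      (P.continuous_smul _).comp (by fun_prop)⟩ fun _ ↦ (P.proj_smul _ _).symm

/-- The fundamental domain is a finite subcomplex. -/
theorem isFiniteSubcomplex_fundamentalDomain [Finite C.ι]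
    [T2Space (P.splitting (P.bounded R)).X] [Finite (P.splittingCells hR).ι] :
    (P.pullback (P.splittingMap (P.bounded R))).IsFiniteSubcomplex
      (P.splittingCells hR).toFiniteCW (P.fundamentalDomain (P.bounded R)) := by
  let J : Type u := (P.zStructure hR).ι ⊕
    -- A tube cell is lifted once for every closed half containing it: the half edges once, the
    -- midpoint twice.
    Σ i : Fin μ, yIndex R i × {p : subdividedInterior × Bool // p.1.1 ≠ Sum.inr (!p.2)}
  have hJ : Finite J := by
    have h1 : ∀ i : Fin μ, Finite (yIndex R i) := fun i ↦ (finite_boundedCells (μ := μ)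
      (R := R)).subset fun c (hc : c ∈ yIndex R i) ↦ hc.1
    have h2 : Finite subdividedCells.ι := inferInstanceAs (Finite (Option Bool ⊕ Bool))
    have h3 : Finite (P.zStructure hR).ι :=
      inferInstanceAs (Finite (boundedCells (μ := μ) R × (Option (Fin μ × Bool) ⊕ (Fin μ × Bool))))
    infer_instance
  let A := P.splittingCells hR
  let k : J → A.ι := Sum.elim Sum.inl fun j ↦ Sum.inr ⟨j.1, j.2.1, j.2.2.1.1⟩
  refine (P.pullback _).isFiniteSubcomplex_of A.toFiniteCW (J := J)
    (fun j ↦ ⟨A.dim (k j), ⟨k j, rfl⟩⟩)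
    (Sum.rec (P.zLift hR) fun j ↦ P.yLift hR j.1 j.2.1 j.2.2.1.1 j.2.2.1.2) ?_ ?_ ?_
  · rintro (c | j) x hx <;> rfl
  · intro q
    rcases (P.splitting (P.bounded R)).base_or_tube
      ((P.pullback (P.splittingMap (P.bounded R))).proj q) with ⟨⟨v, s⟩, h⟩ | ⟨i, y, t, ht, h⟩
    · rw [P.mem_fundamentalDomain_base h]
      constructor
      · intro hq
        obtain ⟨c, x, hx, hc⟩ := (P.zStructure hR).exists_mem_openCell (v, s)
        refine ⟨Sum.inl c, x, hx, P.pullback_ext _ ?_ ?_⟩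
        · exact (congrArg _ hc).trans h.symm
        · exact (congrArg (fun p : P.bounded R × Imu μ ↦ (p.1 : P.E)) hc).trans hq.symm
      · rintro ⟨c | ⟨i, c, ⟨d, b⟩, hd⟩, x, hx, rfl⟩
        · have h1 := (P.splitting (P.bounded R)).base_injective h
          exact congrArg (fun p : P.bounded R × Imu μ ↦ (p.1 : P.E)) h1
        · refine (FSplitting.tube_ne_base _ ?_ _ h).elim
          refine (mem_subdividedInterior d _ ⟨fun k ↦ x (Fin.natAdd _ k), ?_, rfl⟩).1 d.2
          exact (mem_ball_cube_append.1 hx).2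
    · rw [P.mem_fundamentalDomain_tube ht h]
      constructor
      · rintro ⟨b, hb, hq⟩
        obtain ⟨⟨c, d⟩, x, hx, hc⟩ := ((P.yStructure hR i).prod subdividedCells).exists_mem_openCell
          (y, t)
        have hd : t ∈ subdividedCells.openCell d :=
          ⟨fun k ↦ x (Fin.natAdd _ k), (mem_ball_cube_append.1 hx).2, congrArg Prod.snd hc⟩
        refine ⟨Sum.inr ⟨i, c, ⟨⟨d, (mem_subdividedInterior d t hd).2 ht⟩, b⟩,
          ne_of_mem_openCell hd hb⟩, x, hx, P.pullback_ext _ ?_ ?_⟩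
        · exact (congrArg ((P.splitting (P.bounded R)).tubeMap i) hc).trans h.symm
        · exact (congrArg (fun p : P.ySet (P.bounded R) i × Icc (-1 : ℝ) 1 ↦
            sideElt i b • (p.1 : P.E)) hc).trans hq.symm
      · rintro ⟨c | ⟨i', c, ⟨d, b⟩, hd⟩, x, hx, rfl⟩
        · exact (FSplitting.tube_ne_base _ ht _ h.symm).elim
        · have hx' := (mem_subdividedInterior d _ ⟨fun k ↦ x (Fin.natAdd _ k),
            (mem_ball_cube_append.1 hx).2, rfl⟩).1 d.2
          obtain ⟨h1, rfl⟩ := FSplitting.tube_eq_tube _ hx' ht h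
          obtain ⟨rfl, h1⟩ := Sigma.mk.inj h1
          obtain rfl := eq_of_heq h1
          exact ⟨b, side_of_mem_closedCell hd d.2 _, rfl⟩
  · rintro (c | ⟨i, c, ⟨d, b⟩, hd⟩) _ ⟨x, hx, rfl⟩
    · exact Or.inl ⟨_, _, rfl, rfl⟩
    · exact Or.inr ⟨i, _, _, b, side_of_mem_closedCell hd d.2 _, rfl, rfl⟩

end FCover

/-! ### The inclusions `X(V) → X(∞)` -/

namespace FCover

variable {μ : ℕ} {W : Type u} [TopologicalSpace W] (P : FCover μ W)

lemma incl_injective (V : Set P.E) : Function.Injective (P.incl V) := by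
  intro p q h
  rcases (P.splitting V).base_or_tube p with ⟨⟨v, s⟩, rfl⟩ | ⟨i, (y : P.ySet V i), t, ht, rfl⟩ <;>
    rcases (P.splitting V).base_or_tube q with
      ⟨⟨v', s'⟩, rfl⟩ | ⟨i', (y' : P.ySet V i'), t', ht', rfl⟩
  · obtain ⟨h1, h2⟩ := Prod.mk.inj (P.canonical.base_injective h)
    obtain rfl : v = v' := Subtype.ext h1
    obtain rfl : s = s' := h2
    rfl
  · exact (P.canonical.tube_ne_base ht' _ h.symm).elim
  · exact (P.canonical.tube_ne_base ht _ h).elim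
  · obtain ⟨h1, rfl⟩ := P.canonical.tube_eq_tube ht ht' h
    obtain ⟨rfl, h1⟩ := Sigma.mk.inj h1
    rw [show y = y' from Subtype.ext (eq_of_heq h1)]

/-- `E` need not be compact, but both attaching maps have continuous left inverses, hence are closed
embeddings. -/
lemma isClosedMap_canonical_mk [T2Space P.E] :
    IsClosedMap (Quot.mk P.canonical.Rel : P.canonical.Pre → P.canonical.X) := by
  have : ∀ (i : Fin μ), T2Space (P.canonical.Y i) := fun i ↦ inferInstanceAs (T2Space P.E)
  refine P.canonical.isClosedMap_mk (fun i ↦ ?_) fun i ↦ ?_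
  · exact (Function.LeftInverse.isClosedEmbedding (f := fun p : P.E × Imu μ ↦ p.1) (fun _ ↦ rfl)
      continuous_fst (P.canonical.αminus i).continuous).isClosedMap
  · exact (Function.LeftInverse.isClosedEmbedding
      (f := fun p : P.E × Imu μ ↦ (FreeGroup.of i)⁻¹ • p.1) (fun _ ↦ inv_smul_smul _ _)
      ((P.continuous_smul _).comp continuous_fst) (P.canonical.αplus i).continuous).isClosedMap

/-- The map that induces the inclusion `X(V) → X(∞)`. -/
def preIncl (V : Set P.E) : (P.splitting V).Pre → P.canonical.Pre :=
  Sum.map (fun q ↦ (⟨q.1.1, (q.1.2 : P.ySet V q.1.1).1⟩, q.2))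
    fun z : V × Imu μ ↦ ((z.1 : P.E), z.2)

lemma continuous_preIncl (V : Set P.E) : Continuous (P.preIncl V) :=
  Continuous.sumMap (((continuous_sigma fun _ ↦ continuous_sigmaMk.comp continuous_subtype_val :
          Continuous fun s : (Σ i, P.ySet V i) ↦ (⟨s.1, s.2.1⟩ : Σ _ : Fin μ, P.E)).comp
            continuous_fst).prodMk continuous_snd)
    ((continuous_subtype_val.comp continuous_fst).prodMk continuous_snd)

/-- Before passing to quotients the inclusion goes from a compact to a Hausdorff space and is
closed. The quotient map onto `X(∞)` is closed too, so the induced injection is closed. -/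
lemma isClosedEmbedding_incl [T2Space P.E] {V : Set P.E} (hV : IsCompact V)
    (hY : ∀ i, IsCompact (P.ySet V i)) [CompactSpace (Imu μ)] : IsClosedEmbedding (P.incl V) := by
  have h1 : ∀ i, CompactSpace ((P.splitting V).Y i) := fun i ↦ isCompact_iff_compactSpace.1 (hY i)
  have h2 : CompactSpace V := isCompact_iff_compactSpace.1 hV
  have h3 : CompactSpace (P.splitting V).Z := inferInstanceAs (CompactSpace (V × Imu μ))
  have h4 : ∀ (i : Fin μ), T2Space (P.canonical.Y i) := fun i ↦ inferInstanceAs (T2Space P.E)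
  have h5 : T2Space P.canonical.Z := inferInstanceAs (T2Space (P.E × Imu μ))
  refine .of_continuous_injective_isClosedMap (P.incl V).continuous (P.incl_injective V) ?_
  intro A hA
  have h6 := P.isClosedMap_canonical_mk _ ((P.continuous_preIncl V).isClosedMap _
    (hA.preimage (continuous_quot_mk (r := (P.splitting V).Rel))))
  have h7 : P.incl V '' A = Quot.mk P.canonical.Rel ''
      (P.preIncl V '' (Quot.mk (P.splitting V).Rel ⁻¹' A)) := by
    refine subset_antisymm ?_ ?_
    · rintro _ ⟨⟨⟨⟨i, y⟩, t⟩ | z⟩, hp, rfl⟩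
      · exact ⟨_, ⟨Sum.inl (⟨i, y⟩, t), hp, rfl⟩, rfl⟩
      · exact ⟨_, ⟨Sum.inr z, hp, rfl⟩, rfl⟩
    · rintro _ ⟨_, ⟨⟨⟨i, y⟩, t⟩ | z, hp, rfl⟩, rfl⟩ <;> exact ⟨_, hp, rfl⟩
  exact h7 ▸ h6

variable {C : CellStructure W}

lemma exists_mem_bounded (p : P.E) :
    ∃ r, ∀ R : C.ι → ℕ, (∀ c, r ≤ R c) → p ∈ P.bounded R := by
  obtain ⟨⟨c, g⟩, h⟩ := (P.cells C).exists_mem_openCell p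
  exact ⟨FreeGroup.norm g, fun R hR ↦ P.mem_bounded.2 ⟨(c, g), hR c, h⟩⟩

variable (C) in
-- Two points are needed for the tubes: a point of `Y(∞)_i` belongs to `Y(V)_i` when `V` contains
-- both it and its translate by `z_i`.
lemma exists_isBound_mem [T2Space W] [Finite C.ι] (p q : P.E) :
    ∃ R : C.ι → ℕ, P.IsBound R ∧ p ∈ P.bounded R ∧ q ∈ P.bounded R := by
  obtain ⟨r, hr⟩ := P.exists_mem_bounded (C := C) p
  obtain ⟨r', hr'⟩ := P.exists_mem_bounded (C := C) q
  obtain ⟨R, hR, h⟩ := P.exists_isBound C (max r r')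
  exact ⟨R, hR, hr R fun c ↦ (le_max_left _ _).trans (h c),
    hr' R fun c ↦ (le_max_right _ _).trans (h c)⟩

/-- Everything that the theorem asserts about the splitting given by a finite subcomplex `V`. -/
theorem exists_splitting_of_isBound [NeZero μ] (L : FiniteCW W) {R : L.toCells.ι → ℕ}
    (hR : P.IsBound R) : ∃ K : FiniteCW (P.splitting (P.bounded R)).X,
      (P.splitting (P.bounded R)).IsSimpleHomotopySplitting L K (P.splittingMap (P.bounded R)) ∧
      ∃ U : Set (P.pullback (P.splittingMap (P.bounded R))).E,
        (P.pullback (P.splittingMap (P.bounded R))).IsFiniteSubcomplex K U ∧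
        (P.pullback (P.splittingMap (P.bounded R))).IsFundamentalDomain U := by
  have := L.t2
  have : Finite L.toCells.ι := inferInstance
  have := hR.t2Space_X
  have := P.finite_splittingCells hR
  exact ⟨(P.splittingCells hR).toFiniteCW, isSimpleHomotopySplitting L hR, _,
    P.isFiniteSubcomplex_fundamentalDomain hR,
    P.isFundamentalDomain hR.isCompact hR.isCompact_ySet⟩

/-- The finite subcomplexes of bounded norm. -/
def boundedSets (C : CellStructure W) : Set (Set P.E) :=
  {V | ∃ R : C.ι → ℕ, P.IsBound R ∧ V = P.bounded R}

variable [T2Space W] [Finite C.ι]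

lemma iUnion_boundedSets : ⋃ V ∈ P.boundedSets C, V = univ := by
  refine eq_univ_of_forall fun p ↦ ?_
  obtain ⟨R, hR, hp, -⟩ := P.exists_isBound_mem C p p
  exact mem_biUnion ⟨R, hR, rfl⟩ hp

lemma iUnion_ySet_boundedSets (i : Fin μ) : ⋃ V ∈ P.boundedSets C, P.ySet V i = univ := by
  refine eq_univ_of_forall fun p ↦ ?_
  obtain ⟨R, hR, hp, hq⟩ := P.exists_isBound_mem C p (FreeGroup.of i • p)
  exact mem_iUnion₂.2 ⟨_, ⟨R, hR, rfl⟩, hp, mem_inv_smul_set_iff.2 hq⟩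

lemma iUnion_prod_boundedSets :
    ⋃ V ∈ P.boundedSets C, V ×ˢ (univ : Set (Imu μ)) = univ := by
  refine eq_univ_of_forall fun p ↦ ?_
  obtain ⟨R, hR, hp, -⟩ := P.exists_isBound_mem C p.1 p.1
  exact mem_iUnion₂.2 ⟨_, ⟨R, hR, rfl⟩, hp, trivial⟩

lemma iUnion_range_incl_boundedSets : ⋃ V ∈ P.boundedSets C, range (P.incl V) = univ := by
  refine eq_univ_of_forall fun p ↦ ?_
  rcases P.canonical.base_or_tube p with ⟨⟨v, s⟩, rfl⟩ | ⟨i, (y : P.E), t, -, rfl⟩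
  · obtain ⟨R, hR, hp, -⟩ := P.exists_isBound_mem C v v
    exact mem_iUnion₂.2 ⟨_, ⟨R, hR, rfl⟩, (P.splitting _).base (⟨v, hp⟩, s), rfl⟩
  · obtain ⟨R, hR, hp, hq⟩ := P.exists_isBound_mem C y (FreeGroup.of i • y)
    exact mem_iUnion₂.2 ⟨_, ⟨R, hR, rfl⟩,
      (P.splitting _).tube i (⟨y, hp, mem_inv_smul_set_iff.2 hq⟩ : P.ySet _ i) t, rfl⟩

end FCover

/-! ### The map `h(∞)` is a homotopy equivalence -/

namespace FCover

open FreeGroup unitInterval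

variable {μ : ℕ} [NeZero μ] {W : Type u} [TopologicalSpace W] (P : FCover μ W)

/-- The centre of the star at a point of `E`. -/
def center : C(P.E, P.canonical.X) :=
  P.canonical.baseMap.comp ⟨fun x ↦ (x, imuCenter), continuous_id.prodMk continuous_const⟩

/-- The path from the centre at `y` to the centre at `z_i y`, parametrized by `[-3, 3]`. -/
noncomputable def edgePath (i : Fin μ) : C(P.E × ℝ, P.canonical.X) where
  -- The parameter runs through the arm at `y` on `[-3, -1]`, the tube on `[-1, 1]` and the arm at
  -- `z_i y` on `[1, 3]`.
  toFun p := if p.2 ≤ -1 then P.canonical.base (p.1, imuSeg i (intervalClamp (-(3 + p.2) / 2)))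
    else if p.2 ≤ 1 then P.canonical.tube i p.1 (intervalClamp p.2)
    else P.canonical.base (of i • p.1, imuSeg i (intervalClamp ((3 - p.2) / 2)))
  continuous_toFun := by
    have hs : Continuous fun p : P.E × ℝ ↦ (of i : FreeGroup (Fin μ)) • p.1 :=
      (P.continuous_smul _).comp continuous_fst
    refine Continuous.if_le ?_ (Continuous.if_le ?_ ?_ continuous_snd continuous_const ?_)
      continuous_snd continuous_const ?_
    · exact P.canonical.baseMap.continuous.comp (continuous_fst.prodMk (by fun_prop))
    · exact (P.canonical.tubeMap i).continuous.comp (continuous_fst.prodMk (by fun_prop))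
    · exact P.canonical.baseMap.continuous.comp (hs.prodMk (by fun_prop))
    · rintro ⟨y, t⟩ rfl
      refine (P.canonical.tube_one i y (coe_intervalClamp (by simp))).trans ?_
      refine congrArg P.canonical.base (Prod.ext rfl ((imuSeg_one i).symm.trans ?_))
      refine congrArg (imuSeg i) (Subtype.ext ?_)
      rw [coe_intervalClamp (by norm_num)]
      norm_num [intervalEnd]
    · rintro ⟨y, t⟩ rfl
      simp only
      rw [if_pos (by norm_num)]
      refine Eq.trans ?_ (P.canonical.tube_neg_one i y (coe_intervalClamp (by simp))).symm
      refine congrArg P.canonical.base (Prod.ext rfl (Eq.trans ?_ (imuSeg_neg_one i)))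
      refine congrArg (imuSeg i) (Subtype.ext ?_)
      rw [coe_intervalClamp (by norm_num)]
      norm_num [intervalEnd]

lemma edgePath_of_le {i : Fin μ} {y : P.E} {t : ℝ} (ht : t ≤ -1) : P.edgePath i (y, t) =
    P.canonical.base (y, imuSeg i (intervalClamp (-(3 + t) / 2))) := if_pos ht

lemma edgePath_of_mem {i : Fin μ} {y : P.E} (t : Icc (-1 : ℝ) 1) :
    P.edgePath i (y, t) = P.canonical.tube i y t := by
  have hc : intervalClamp (t : ℝ) = t := Subtype.ext (coe_intervalClamp (abs_le.2 t.2))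
  rcases eq_or_lt_of_le t.2.1 with h | h
  · rw [edgePath_of_le _ h.ge, P.canonical.tube_neg_one i y h.symm]
    refine congrArg P.canonical.base (Prod.ext rfl (Eq.trans ?_ (imuSeg_neg_one i)))
    refine congrArg (imuSeg i) (Subtype.ext ?_)
    rw [← h, coe_intervalClamp (by norm_num)]
    norm_num [intervalEnd]
  · refine (if_neg h.not_ge).trans ((if_pos t.2.2).trans ?_)
    exact congrArg _ hc

lemma edgePath_of_ge {i : Fin μ} {y : P.E} {t : ℝ} (ht : 1 ≤ t) : P.edgePath i (y, t) =
    P.canonical.base (of i • y, imuSeg i (intervalClamp ((3 - t) / 2))) := by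
  rcases eq_or_lt_of_le ht with rfl | h
  · refine (P.edgePath_of_mem (intervalEnd true)).trans ((P.canonical.tube_one i y rfl).trans ?_)
    refine congrArg P.canonical.base (Prod.ext rfl ((imuSeg_one i).symm.trans ?_))
    refine congrArg (imuSeg i) (Subtype.ext ?_)
    rw [coe_intervalClamp (by norm_num)]
    norm_num [intervalEnd]
  · exact (if_neg (by linarith)).trans (if_neg h.not_ge)

lemma edgePath_neg_three (i : Fin μ) (y : P.E) : P.edgePath i (y, -3) = P.center y := by
  rw [P.edgePath_of_le (by norm_num)]
  exact congrArg P.canonical.base (Prod.ext rfl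
    (imuSeg_zero i (by rw [coe_intervalClamp] <;> norm_num)))

lemma edgePath_three (i : Fin μ) (y : P.E) : P.edgePath i (y, 3) = P.center (of i • y) := by
  rw [P.edgePath_of_ge (by norm_num)]
  exact congrArg P.canonical.base (Prod.ext rfl
    (imuSeg_zero i (by rw [coe_intervalClamp] <;> norm_num)))

lemma canonicalMap_edgePath (i : Fin μ) (p : P.E × ℝ) :
    P.canonicalMap (P.edgePath i p) = P.proj p.1 := by
  obtain ⟨y, t⟩ := p
  rcases le_total t (-1) with h | h
  · rw [P.edgePath_of_le h]; rfl
  · rcases le_total 1 t with h' | h'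
    · rw [P.edgePath_of_ge h']; exact P.proj_smul _ _
    · rw [P.edgePath_of_mem ⟨t, h, h'⟩]; rfl

/-- The path from the centre at `y` to the adjacent centre in a given direction. -/
noncomputable def legPath : Fin μ × Bool → C(P.E × ℝ, P.canonical.X)
  | (i, false) => (P.edgePath i).comp ⟨fun p ↦ (p.1, 3 * (2 * p.2 - 1)), by fun_prop⟩
  | (i, true) => (P.edgePath i).comp ⟨fun p ↦ ((of i)⁻¹ • p.1, 3 * (1 - 2 * p.2)),
      ((P.continuous_smul _).comp continuous_fst).prodMk (by fun_prop)⟩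

lemma legPath_zero (x : Fin μ × Bool) (y : P.E) : P.legPath x (y, 0) = P.center y := by
  obtain ⟨i, _ | _⟩ := x
  · change P.edgePath i (y, 3 * (2 * 0 - 1)) = _
    rw [show (3 * (2 * 0 - 1) : ℝ) = -3 by norm_num, edgePath_neg_three]
  · change P.edgePath i (_, 3 * (1 - 2 * 0)) = _
    rw [show (3 * (1 - 2 * 0) : ℝ) = 3 by norm_num, edgePath_three, smul_inv_smul]

lemma legPath_one (x : Fin μ × Bool) (y : P.E) : P.legPath x (y, 1) = P.center (leg x • y) := by
  obtain ⟨i, _ | _⟩ := x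
  · change P.edgePath i (y, 3 * (2 * 1 - 1)) = _
    rw [show (3 * (2 * 1 - 1) : ℝ) = 3 by norm_num, edgePath_three, leg_false]
  · change P.edgePath i (_, 3 * (1 - 2 * 1)) = _
    rw [show (3 * (1 - 2 * 1) : ℝ) = -3 by norm_num, edgePath_neg_three, leg_true]

lemma canonicalMap_legPath (x : Fin μ × Bool) (p : P.E × ℝ) :
    P.canonicalMap (P.legPath x p) = P.proj p.1 := by
  obtain ⟨i, _ | _⟩ := x
  · exact P.canonicalMap_edgePath i _
  · exact (P.canonicalMap_edgePath i _).trans (P.proj_smul _ _)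

/-- The path that follows the directions given by a word. -/
noncomputable def trail : List (Fin μ × Bool) → {f : C(P.E × ℝ, P.canonical.X) //
    ∀ y, f (y, 0) = P.center y}
  | [] => ⟨P.center.comp ⟨Prod.fst, continuous_fst⟩, fun _ ↦ rfl⟩
  -- The starting point of a trail is carried along with the map, because continuity at the junction
  -- `t = 1` needs it for the remaining word.
  | x :: l => ⟨⟨fun p ↦ if p.2 ≤ 1 then P.legPath x p else (trail l).1 (leg x • p.1, p.2 - 1), by
      refine Continuous.if_le (P.legPath x).continuous ((trail l).1.continuous.comp
        (((P.continuous_smul _).comp continuous_fst).prodMk (by fun_prop)))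
        continuous_snd continuous_const ?_
      rintro ⟨y, t⟩ rfl
      rw [sub_self, (trail l).2, legPath_one]⟩,
      fun y ↦ (if_pos zero_le_one).trans (P.legPath_zero x y)⟩

lemma trail_zero (l : List (Fin μ × Bool)) (y : P.E) : (P.trail l).1 (y, 0) = P.center y :=
  (P.trail l).2 y

lemma trail_cons_of_le {x : Fin μ × Bool} {l : List (Fin μ × Bool)} {y : P.E} {t : ℝ} (ht : t ≤ 1) :
    (P.trail (x :: l)).1 (y, t) = P.legPath x (y, t) := if_pos ht

lemma trail_cons_add {x : Fin μ × Bool} {l : List (Fin μ × Bool)} {y : P.E} {t : ℝ} (ht : 0 ≤ t) :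
    (P.trail (x :: l)).1 (y, 1 + t) = (P.trail l).1 (leg x • y, t) := by
  rcases eq_or_lt_of_le ht with rfl | h
  · rw [add_zero, trail_cons_of_le _ le_rfl, legPath_one, trail_zero]
  · refine (if_neg (by simpa using h)).trans ?_
    rw [add_sub_cancel_left]

lemma canonicalMap_trail (l : List (Fin μ × Bool)) (p : P.E × ℝ) :
    P.canonicalMap ((P.trail l).1 p) = P.proj p.1 := by
  induction l generalizing p with
  | nil => rfl
  | cons x l ih =>
    by_cases h : p.2 ≤ 1
    · rw [show (P.trail (x :: l)).1 p = P.legPath x p from if_pos h, canonicalMap_legPath]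
    · rw [show (P.trail (x :: l)).1 p = (P.trail l).1 (leg x • p.1, p.2 - 1) from if_neg h, ih]
      exact P.proj_smul _ _

/-- Each letter of the word moves the centre by the inverse of that letter, so the reduced word of
`g` leads from `y` to `g⁻¹ • y` in `norm g` steps. -/
lemma trail_toWord_norm (g : FreeGroup (Fin μ)) (y : P.E) :
    (P.trail g.toWord).1 (y, norm g) = P.center (g⁻¹ • y) := by
  suffices h : ∀ (l : List (Fin μ × Bool)) (g : FreeGroup (Fin μ)) (y : P.E), g.toWord = l →
      (P.trail l).1 (y, (l.length : ℝ)) = P.center (g⁻¹ • y) from h _ g y rfl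
  intro l
  induction l with
  | nil =>
    intro g y hg
    rw [toWord_eq_nil_iff.1 hg, inv_one, one_smul]
    rfl
  | cons x l ih =>
    intro g y hg
    have h1 : (leg x * g).toWord = l := by
      rcases toWord_leg_mul x g with ⟨-, h⟩ | ⟨h, -⟩
      · exact (List.cons.inj (h.symm.trans hg)).2
      · exact (h (by simp [Toward, hg])).elim
    rw [List.length_cons, Nat.cast_add, Nat.cast_one, add_comm, P.trail_cons_add (Nat.cast_nonneg _),
      ih _ _ h1, smul_smul, mul_inv_rev, inv_mul_cancel_right]

/-- The homotopy that shrinks a star to its centre. -/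
def imuScale : C(Imu μ × I, Imu μ) :=
  ⟨fun p ↦ ⟨(1 - (p.2 : ℝ)) • p.1.1, by
    obtain ⟨i, t, ht⟩ := exists_imuSeg p.1
    have h2 := p.2.2
    have h3 : |(1 - (p.2 : ℝ)) * t| ≤ 1 := by
      rw [abs_mul, abs_of_nonneg (by linarith [h2.2])]
      exact mul_le_one₀ (by linarith [h2.1]) (abs_nonneg _) (abs_le.2 t.2)
    have h4 : (1 - (p.2 : ℝ)) • p.1.1 = (imuSeg i ⟨_, abs_le.1 h3⟩).1 := by
      rw [← ht]
      exact (Pi.single_smul (f := fun _ ↦ ℝ) i (1 - (p.2 : ℝ)) (t : ℝ)).symm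
    exact h4 ▸ (imuSeg i ⟨_, abs_le.1 h3⟩).2⟩, by fun_prop⟩

lemma imuScale_imuSeg (i : Fin μ) (t t' : Icc (-1 : ℝ) 1) (b : I)
    (h : (t' : ℝ) = (1 - (b : ℝ)) * t) : imuScale (imuSeg i t, b) = imuSeg i t' := by
  refine Subtype.ext ?_
  change (1 - (b : ℝ)) • (Pi.single i (t : ℝ) : Fin μ → ℝ) = Pi.single i (t' : ℝ)
  rw [← Pi.single_smul, h, smul_eq_mul]

lemma imuScale_zero (s : Imu μ) : imuScale (s, 0) = s := Subtype.ext (by simp [imuScale])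

lemma imuScale_one (s : Imu μ) : imuScale (s, 1) = imuCenter := Subtype.ext (by
  change (1 - (1 : ℝ)) • s.1 = Pi.single 0 0
  simp)

/-- The homotopy that shrinks the stars and stretches the edges. -/
noncomputable def squash : C(I × P.canonical.X, P.canonical.X) :=
  P.canonical.descHomotopy
    -- At time `b` the tube covers `[-(1 + 2b), 1 + 2b]`, and its ends lie at height `1 - b` in the
    -- arms, matching the tips of the shrunken stars.
    (fun i ↦ (P.edgePath i).comp ⟨fun p : P.E × (Icc (-1 : ℝ) 1 × I) ↦
      (p.1, (1 + 2 * (p.2.2 : ℝ)) * p.2.1), by fun_prop⟩)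
    (P.canonical.baseMap.comp ⟨fun p : (P.E × Imu μ) × I ↦ (p.1.1, imuScale (p.1.2, p.2)),
      by fun_prop⟩)
    (fun i (y : P.E) b ↦ by
      change P.edgePath i (y, (1 + 2 * (b : ℝ)) * (-1)) = P.canonical.base (y, imuScale (eMinus i, b))
      have := b.2.1
      rw [P.edgePath_of_le (by linarith)]
      refine congrArg P.canonical.base (Prod.ext rfl ?_)
      rw [← imuSeg_neg_one]
      refine (imuScale_imuSeg i _ _ b ?_).symm
      rw [coe_intervalClamp (by rw [abs_le]; constructor <;> linarith [b.2.2])]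
      simp [intervalEnd]
      ring)
    (fun i (y : P.E) b ↦ by
      change P.edgePath i (y, (1 + 2 * (b : ℝ)) * 1) =
        P.canonical.base (of i • y, imuScale (ePlus i, b))
      have := b.2.1
      rw [P.edgePath_of_ge (by linarith)]
      refine congrArg P.canonical.base (Prod.ext rfl ?_)
      rw [← imuSeg_one]
      refine (imuScale_imuSeg i _ _ b ?_).symm
      rw [coe_intervalClamp (by rw [abs_le]; constructor <;> linarith [b.2.2])]
      simp [intervalEnd]
      ring)

lemma squash_zero (x : P.canonical.X) : P.squash (0, x) = x := by
  refine FSplitting.induction_X (p := fun x ↦ P.squash (0, x) = x) ?_ ?_ x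
  · intro z
    exact congrArg P.canonical.base (Prod.ext rfl (imuScale_zero z.2))
  · intro i y t
    refine Eq.trans ?_ (P.edgePath_of_mem t)
    exact congrArg (fun r ↦ P.edgePath i (y, r)) (by simp)

lemma squash_one_base (z : P.E × Imu μ) : P.squash (1, P.canonical.base z) = P.center z.1 :=
  congrArg P.canonical.base (Prod.ext rfl (imuScale_one z.2))

lemma squash_one_tube (i : Fin μ) (y : P.E) (t : Icc (-1 : ℝ) 1) :
    P.squash (1, P.canonical.tube i y t) = P.edgePath i (y, 3 * t) :=
  congrArg (fun r ↦ P.edgePath i (y, r)) (by simp; norm_num)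

/-! ### Composing fibrewise deformations -/

/-- There is a fibrewise deformation of `X(∞)` that collapses the fibres over `C`. -/
def Collapses (C : Set W) : Prop :=
  ∃ D : C(P.canonical.X, P.canonical.X), D.Homotopic (ContinuousMap.id _) ∧
    (∀ x, P.canonicalMap (D x) = P.canonicalMap x) ∧
    ∀ x y, P.canonicalMap x = P.canonicalMap y → P.canonicalMap x ∈ C → D x = D y

lemma collapses_empty : P.Collapses ∅ :=
  ⟨ContinuousMap.id _, .refl _, fun _ ↦ rfl, fun _ _ _ h ↦ h.elim⟩

variable {P} in
lemma Collapses.mono {C C' : Set W} (h : C ⊆ C') (hC : P.Collapses C') : P.Collapses C := by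
  obtain ⟨D, h1, h2, h3⟩ := hC
  exact ⟨D, h1, h2, fun x y hxy hx ↦ h3 x y hxy (h hx)⟩

variable {P} in
-- Since `D` preserves the fibres of `h(∞)`, the images of two points of a fibre over `C'` are still
-- in one fibre over `C'`, where `D'` identifies them. Over `C` they are already identified by `D`.
lemma Collapses.union {C C' : Set W} (h : P.Collapses C) (h' : P.Collapses C') :
    P.Collapses (C ∪ C') := by
  obtain ⟨D, h1, h2, h3⟩ := h
  obtain ⟨D', h1', h2', h3'⟩ := h'
  refine ⟨D'.comp D, by simpa using h1'.comp h1, fun x ↦ (h2' _).trans (h2 x), ?_⟩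
  rintro x y hxy (hx | hx)
  · exact congrArg D' (h3 x y hxy hx)
  · exact h3' _ _ ((h2 x).trans (hxy.trans (h2 y).symm)) ((h2 x).symm ▸ hx)

/-- On centres, `D` takes the same value at all points of a fibre of the covering and descends to `s
: W → X(∞)`. Constancy on fibres gives `s ∘ h(∞) = D`, which is homotopic to the identity;
preservation of fibres makes `s` a section. -/
lemma isHomotopyEquiv_of_collapses (h : P.Collapses univ) : IsHomotopyEquiv P.canonicalMap := by
  obtain ⟨D, h1, h2, h3⟩ := h
  have hq := P.isCover.toIsQuotientMap
  have hlift : ∀ e e', P.proj e = P.proj e' → D (P.center e) = D (P.center e') := fun e e' h ↦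
    h3 _ _ h trivial
  let s : C(W, P.canonical.X) := hq.lift (f := ⟨P.proj, P.continuous_proj⟩) (D.comp P.center) hlift
  have hs : ∀ e, s (P.proj e) = D (P.center e) := fun e ↦
    DFunLike.congr_fun (hq.lift_comp (f := ⟨P.proj, P.continuous_proj⟩) (D.comp P.center) hlift) e
  refine isHomotopyEquiv_of_inverse s ?_ ?_
  · have : s.comp P.canonicalMap = D := by
      ext x
      obtain ⟨e, he⟩ := P.isCover.surjective (P.canonicalMap x)
      rw [ContinuousMap.comp_apply, ← he, hs]
      exact h3 _ _ he trivial
    rw [this]; exact h1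
  · have : P.canonicalMap.comp s = ContinuousMap.id W := by
      ext w
      obtain ⟨e, rfl⟩ := P.isCover.surjective w
      rw [ContinuousMap.comp_apply, hs, h2]
      rfl
    rw [this]

/-! ### Sliding the Cayley trees to one sheet -/

section Local

variable {P} (τ : C(W, ℝ))

/-- The deformation of the centres over a sheet. -/
noncomputable def sheetCenter (g : FreeGroup (Fin μ)) : C((P.E × Imu μ) × I, P.canonical.X) :=
  (P.trail g.toWord).1.comp ⟨fun p ↦ (p.1.1, p.2 * τ (P.proj p.1.1) * norm g), by
    have := P.continuous_proj; fun_prop⟩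

/-- The deformation of the edges over a sheet. -/
noncomputable def sheetEdge (i : Fin μ) (g : FreeGroup (Fin μ)) :
    C(P.E × (Icc (-1 : ℝ) 1 × I), P.canonical.X) :=
  -- On sheet `g` the target is `g⁻¹ • y`. The edge from `y` to `z_i y` is the first unit of the
  -- trail starting at whichever of its ends is farther from the target. A point of the edge moves
  -- along this trail from its own position to the end.
  if Toward g (i, false) then
    (P.trail g.toWord).1.comp ⟨fun p ↦ (p.1, (1 + p.2.1) / 2 +
      p.2.2 * τ (P.proj p.1) * (norm g - (1 + p.2.1) / 2)), by
        have := P.continuous_proj; fun_prop⟩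
  else
    (P.trail (of i * g).toWord).1.comp ⟨fun p ↦ (of i • p.1, (1 - p.2.1) / 2 +
      p.2.2 * τ (P.proj p.1) * (norm (of i * g) - (1 - p.2.1) / 2)),
        ((P.continuous_smul _).comp continuous_fst).prodMk (by
          have := P.continuous_proj; fun_prop)⟩

variable {τ}

lemma sheetEdge_of_toward {i : Fin μ} {g : FreeGroup (Fin μ)} (h : Toward g (i, false)) (y : P.E)
    (t : Icc (-1 : ℝ) 1) (a : I) : sheetEdge τ i g (y, t, a) = (P.trail g.toWord).1
      (y, (1 + t) / 2 + a * τ (P.proj y) * (norm g - (1 + t) / 2)) := by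
  rw [sheetEdge, if_pos h]; rfl

lemma sheetEdge_of_not_toward {i : Fin μ} {g : FreeGroup (Fin μ)} (h : ¬ Toward g (i, false))
    (y : P.E) (t : Icc (-1 : ℝ) 1) (a : I) : sheetEdge τ i g (y, t, a) =
      (P.trail (of i * g).toWord).1
      (of i • y, (1 - t) / 2 + a * τ (P.proj y) * (norm (of i * g) - (1 - t) / 2)) := by
  rw [sheetEdge, if_neg h]; rfl

lemma toWord_of_toward {i : Fin μ} {g : FreeGroup (Fin μ)} (h : Toward g (i, false)) :
    g.toWord = (i, false) :: (of i * g).toWord ∧ (norm g : ℝ) = norm (of i * g) + 1 := by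
  refine ⟨?_, mod_cast norm_of_toward h⟩
  rcases toWord_leg_mul (i, false) g with ⟨-, h'⟩ | ⟨h', -⟩
  · exact h'
  · exact (h' h).elim

lemma toWord_of_not_toward {i : Fin μ} {g : FreeGroup (Fin μ)} (h : ¬ Toward g (i, false)) :
    (of i * g).toWord = (i, true) :: g.toWord ∧ (norm (of i * g) : ℝ) = norm g + 1 := by
  rcases toWord_leg_mul (i, false) g with ⟨h', -⟩ | ⟨-, h'⟩
  · exact (h h').elim
  · exact ⟨h', mod_cast congrArg List.length h'⟩

lemma sheetCenter_apply (g : FreeGroup (Fin μ)) (y : P.E) (a : I) (s : Imu μ) :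
    sheetCenter τ g ((y, s), a) = (P.trail g.toWord).1 (y, a * τ (P.proj y) * norm g) := rfl

/-- If `z_i y` is the farther end, the trail from it passes through `y` at time `1` and then follows
the trail from `y`, so both formulas describe the same motion. `sheetEdge_one` is the same at the
other end. -/
lemma sheetEdge_neg_one (hτ : ∀ w, 0 ≤ τ w) (i : Fin μ) (g : FreeGroup (Fin μ)) (y : P.E) (a : I)
    (s : Imu μ) {t : Icc (-1 : ℝ) 1} (ht : (t : ℝ) = -1) :
    sheetEdge τ i g (y, t, a) = sheetCenter τ g ((y, s), a) := by
  rw [sheetCenter_apply]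
  by_cases h : Toward g (i, false)
  · rw [sheetEdge_of_toward h, ht]
    congr 2; ring
  · obtain ⟨h1, h2⟩ := toWord_of_not_toward h
    rw [sheetEdge_of_not_toward h, ht, h1, h2, show (1 - -1 : ℝ) / 2 + a * τ (P.proj y) *
      (norm g + 1 - (1 - -1) / 2) = 1 + a * τ (P.proj y) * norm g by ring,
      P.trail_cons_add (mul_nonneg (mul_nonneg a.2.1 (hτ _)) (Nat.cast_nonneg _)), leg_true,
      inv_smul_smul]

lemma sheetEdge_one (hτ : ∀ w, 0 ≤ τ w) (i : Fin μ) (g : FreeGroup (Fin μ)) (y : P.E) (a : I)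
    (s : Imu μ) {t : Icc (-1 : ℝ) 1} (ht : (t : ℝ) = 1) :
    sheetEdge τ i g (y, t, a) = sheetCenter τ (of i * g) ((of i • y, s), a) := by
  rw [sheetCenter_apply, P.proj_smul]
  by_cases h : Toward g (i, false)
  · obtain ⟨h1, h2⟩ := toWord_of_toward h
    rw [sheetEdge_of_toward h, ht, h1, h2, show (1 + 1 : ℝ) / 2 + a * τ (P.proj y) *
      (norm (of i * g) + 1 - (1 + 1) / 2) = 1 + a * τ (P.proj y) * norm (of i * g) by ring,
      P.trail_cons_add (mul_nonneg (mul_nonneg a.2.1 (hτ _)) (Nat.cast_nonneg _)), leg_false]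
  · rw [sheetEdge_of_not_toward h, ht]
    congr 2; ring

/-- The product vanishes at time `0` and also wherever the bump function vanishes; the two cases
give the initial map and the gluing with the undeformed part. -/
lemma sheetCenter_of_eq_zero (g : FreeGroup (Fin μ)) (y : P.E) (a : I) (s : Imu μ)
    (h : a * τ (P.proj y) = 0) : sheetCenter τ g ((y, s), a) = P.center y := by
  rw [sheetCenter_apply, h, zero_mul, trail_zero]

lemma sheetEdge_of_eq_zero (i : Fin μ) (g : FreeGroup (Fin μ)) (y : P.E) (t : Icc (-1 : ℝ) 1) (a : I)
    (h : a * τ (P.proj y) = 0) : sheetEdge τ i g (y, t, a) = P.edgePath i (y, 3 * t) := by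
  have ht := t.2
  by_cases h' : Toward g (i, false)
  · rw [sheetEdge_of_toward h', h, (toWord_of_toward h').1,
      P.trail_cons_of_le (by linarith [ht.2])]
    change P.edgePath i (y, _) = _
    congr 2; ring
  · rw [sheetEdge_of_not_toward h', h, (toWord_of_not_toward h').1,
      P.trail_cons_of_le (by linarith [ht.1])]
    change P.edgePath i ((of i)⁻¹ • of i • y, _) = _
    rw [inv_smul_smul]
    congr 2; ring

lemma sheetCenter_of_eq_one (g : FreeGroup (Fin μ)) (y : P.E) (a : I) (s : Imu μ)
    (h : a * τ (P.proj y) = 1) : sheetCenter τ g ((y, s), a) = P.center (g⁻¹ • y) := by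
  rw [sheetCenter_apply, h, one_mul, trail_toWord_norm]

lemma sheetEdge_of_eq_one (i : Fin μ) (g : FreeGroup (Fin μ)) (y : P.E) (t : Icc (-1 : ℝ) 1) (a : I)
    (h : a * τ (P.proj y) = 1) : sheetEdge τ i g (y, t, a) = P.center (g⁻¹ • y) := by
  by_cases h' : Toward g (i, false)
  · rw [sheetEdge_of_toward h', h, one_mul, add_sub_cancel, trail_toWord_norm]
  · rw [sheetEdge_of_not_toward h', h, one_mul, add_sub_cancel, trail_toWord_norm, smul_smul,
      mul_inv_rev, inv_mul_cancel_right]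

lemma canonicalMap_sheetCenter (g : FreeGroup (Fin μ)) (p : (P.E × Imu μ) × I) :
    P.canonicalMap (sheetCenter τ g p) = P.proj p.1.1 := P.canonicalMap_trail _ _

lemma canonicalMap_sheetEdge (i : Fin μ) (g : FreeGroup (Fin μ)) (p : P.E × (Icc (-1 : ℝ) 1 × I)) :
    P.canonicalMap (sheetEdge τ i g p) = P.proj p.1 := by
  rw [sheetEdge]
  split_ifs
  · exact P.canonicalMap_trail _ _
  · exact (P.canonicalMap_trail _ _).trans (P.proj_smul _ _)

end Local

/-- Maps over the sheets above an open set and a map over a further open set glue. -/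
lemma exists_glue {Q T : Type*} [TopologicalSpace Q] [TopologicalSpace T] {π : Q → P.E}
    (hπ : Continuous π) {O : Set P.E} (hO : IsOpen O)
    (hd : ∀ g : FreeGroup (Fin μ), (g • O ∩ O).Nonempty → g = 1) {B : Set W} (hB : IsOpen B)
    (hc : ∀ x, (∃ g : FreeGroup (Fin μ), x ∈ g • O) ∨ P.proj x ∈ B)
    (φ : FreeGroup (Fin μ) → C(Q, T)) (ψ : C(Q, T))
    (h : ∀ g q, P.proj (π q) ∈ B → φ g q = ψ q) :
    ∃ F : C(Q, T), (∀ (g : FreeGroup (Fin μ)) q, π q ∈ g • O → F q = φ g q) ∧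
      ∀ q, P.proj (π q) ∈ B → F q = ψ q := by
  let S : Option (FreeGroup (Fin μ)) → Set Q := fun j ↦
    j.elim (π ⁻¹' (P.proj ⁻¹' B)) fun g ↦ π ⁻¹' (g • O)
  let Φ : Option (FreeGroup (Fin μ)) → C(Q, T) := fun j ↦ j.elim ψ φ
  have := P.isCover.toContinuousConstSMul
  have hS : ∀ x, ∃ j, S j ∈ 𝓝 x := fun x ↦ by
    rcases hc (π x) with ⟨g, hg⟩ | hx
    · exact ⟨some g, ((hO.smul g).preimage hπ).mem_nhds hg⟩
    · exact ⟨none, ((hB.preimage P.continuous_proj).preimage hπ).mem_nhds hx⟩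
  have hΦ : ∀ (i j) (x : Q) (hxi : x ∈ S i) (hxj : x ∈ S j),
      (Φ i).restrict (S i) ⟨x, hxi⟩ = (Φ j).restrict (S j) ⟨x, hxj⟩ := by
    rintro (_ | g) (_ | k) x hi hj
    · rfl
    · exact (h k x hi).symm
    · exact h g x hj
    -- A point on two sheets forces them to coincide, so the maps on different sheets need no
    -- compatibility.
    · have : k⁻¹ * g = 1 := hd _ ⟨k⁻¹ • π x, by
        rw [mul_smul]; exact smul_mem_smul_set hi, mem_smul_set_iff_inv_smul_mem.1 hj⟩
      rw [inv_mul_eq_one] at this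
      subst this
      rfl
  exact ⟨.liftCover S (fun j ↦ (Φ j).restrict (S j)) hΦ hS,
    fun g q hq ↦ ContinuousMap.liftCover_coe (i := some g) ⟨q, hq⟩,
    fun q hq ↦ ContinuousMap.liftCover_coe (i := none) ⟨q, hq⟩⟩

lemma exists_mem_nhds_collapses [T2Space W] [CompactSpace W] (w : W) :
    ∃ N ∈ 𝓝 w, P.Collapses N := by
  have := P.isCover.toContinuousConstSMul
  obtain ⟨e, rfl⟩ := P.isCover.surjective w
  obtain ⟨O', hO', hd'⟩ := P.isCover.disjoint e
  obtain ⟨O, hOO', hO, heO⟩ := mem_nhds_iff.1 hO'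
  have hd : ∀ g : FreeGroup (Fin μ), (g • O ∩ O).Nonempty → g = 1 := fun g hg ↦
    hd' g (hg.mono (inter_subset_inter (image_mono hOO') hOO'))
  -- Neighbourhoods with `closure u'` in `u` and `closure u` in the image of the sheet. The bump
  -- function is `1` on `closure u'` and vanishes off `u`, so the formulas over the sheets agree
  -- with the undeformed map over the open complement of `closure u`.
  obtain ⟨u, hu, heu, huO⟩ := normal_exists_closure_subset isClosed_singleton
    (P.isCover.isOpenQuotientMap.isOpenMap O hO) (singleton_subset_iff.2 (mem_image_of_mem _ heO))
  obtain ⟨u', hu', heu', hu'u⟩ := normal_exists_closure_subset isClosed_singleton hu heu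
  obtain ⟨τ, hτ0, hτ1, hτ⟩ := exists_continuous_zero_one_of_isClosed hu.isClosed_compl
    isClosed_closure (disjoint_compl_left_iff_subset.2 hu'u)
  have hB : ∀ w ∈ (closure u)ᶜ, ∀ a : I, a * τ w = 0 := fun w hw a ↦ by
    rw [hτ0 fun h ↦ hw (subset_closure h)]; exact mul_zero _
  have hc : ∀ x, (∃ g : FreeGroup (Fin μ), x ∈ g • O) ∨ P.proj x ∈ (closure u)ᶜ := fun x ↦ by
    by_cases hx : P.proj x ∈ closure u
    · obtain ⟨e', he', h⟩ := huO hx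
      obtain ⟨g, rfl⟩ := P.isCover.apply_eq_iff_mem_orbit.1 h.symm
      exact Or.inl ⟨g, smul_mem_smul_set he'⟩
    · exact Or.inr hx
  obtain ⟨K, hK, hKB⟩ := P.exists_glue (π := fun q : (P.E × Imu μ) × I ↦ q.1.1) (by fun_prop)
    hO hd isClosed_closure.isOpen_compl hc (sheetCenter τ)
    (P.center.comp ⟨fun q : (P.E × Imu μ) × I ↦ q.1.1, by fun_prop⟩)
    fun g q hq ↦ sheetCenter_of_eq_zero _ _ _ _ (hB _ hq _)
  choose F hF hFB using fun i : Fin μ ↦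
    P.exists_glue (π := fun q : P.E × (Icc (-1 : ℝ) 1 × I) ↦ q.1) (by fun_prop)
    hO hd isClosed_closure.isOpen_compl hc (sheetEdge τ i)
    ((P.edgePath i).comp ⟨fun q : P.E × (Icc (-1 : ℝ) 1 × I) ↦ (q.1, 3 * q.2.1), by fun_prop⟩)
    fun g q hq ↦ sheetEdge_of_eq_zero _ _ _ _ _ (hB _ hq _)
  let H : C(I × P.canonical.X, P.canonical.X) := P.canonical.descHomotopy F K
    (fun i (y : P.E) a ↦ by
      rcases hc y with ⟨g, hg⟩ | hy
      · refine (hF i g (y, _, a) hg).trans ?_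
        refine Eq.trans ?_ (hK g ((y, eMinus i), a) hg).symm
        exact sheetEdge_neg_one (fun w ↦ (hτ w).1) _ _ _ _ _ rfl
      · refine (hFB i (y, _, a) hy).trans ?_
        refine Eq.trans ?_ (hKB ((y, eMinus i), a) hy).symm
        refine Eq.trans ?_ (P.edgePath_neg_three i y)
        exact congrArg (fun r ↦ P.edgePath i (y, r)) (by norm_num))
    (fun i (y : P.E) a ↦ by
      rcases hc y with ⟨g, hg⟩ | hy
      · refine (hF i g (y, _, a) hg).trans ?_
        -- If `y` lies on sheet `g`, the other end `z_i y` of the edge lies on sheet `z_i g`.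
        refine Eq.trans ?_ (hK (of i * g) ((of i • y, ePlus i), a)
          ((mul_smul (of i) g O).symm ▸ smul_mem_smul_set hg)).symm
        exact sheetEdge_one (fun w ↦ (hτ w).1) _ _ _ _ _ rfl
      · refine (hFB i (y, _, a) hy).trans ?_
        refine Eq.trans ?_ (hKB ((of i • y, ePlus i), a) ((P.proj_smul _ _).symm ▸ hy)).symm
        refine Eq.trans ?_ (P.edgePath_three i y)
        exact congrArg (fun r ↦ P.edgePath i (y, r)) (by norm_num))
  have h0 : ∀ x, H (0, x) = P.squash (1, x) := FSplitting.induction_X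
    (fun (z : P.E × Imu μ) ↦ by
      refine Eq.trans ?_ (P.squash_one_base z).symm
      rcases hc z.1 with ⟨g, hg⟩ | hy
      · exact (hK g (z, 0) hg).trans (sheetCenter_of_eq_zero _ _ _ _ (zero_mul _))
      · exact hKB (z, 0) hy)
    fun i (y : P.E) t ↦ by
      refine Eq.trans ?_ (P.squash_one_tube i y t).symm
      rcases hc y with ⟨g, hg⟩ | hy
      · exact (hF i g (y, t, 0) hg).trans (sheetEdge_of_eq_zero _ _ _ _ _ (zero_mul _))
      · exact hFB i (y, t, 0) hy
  -- Over `closure u'` the whole fibre ends at the centre over the one point of the fibre of the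
  -- covering that lies on the sheet `O`.
  have h1 : ∀ x, ∀ e' ∈ O, P.proj e' = P.canonicalMap x → P.canonicalMap x ∈ closure u' →
      H (1, x) = P.center e' := FSplitting.induction_X
    (fun (z : P.E × Imu μ) e' he' h hx ↦ by
      obtain ⟨g, hg⟩ := P.isCover.apply_eq_iff_mem_orbit.1 (show P.proj z.1 = P.proj e' from h.symm)
      refine (hK g (z, 1) ⟨e', he', hg⟩).trans ((sheetCenter_of_eq_one _ _ _ _ ?_).trans ?_)
      · exact (one_mul _).trans (hτ1 hx)
      · rw [← show g • e' = z.1 from hg, inv_smul_smul])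
    fun i (y : P.E) t e' he' h hx ↦ by
      obtain ⟨g, hg⟩ := P.isCover.apply_eq_iff_mem_orbit.1 (show P.proj y = P.proj e' from h.symm)
      refine (hF i g (y, t, 1) ⟨e', he', hg⟩).trans ((sheetEdge_of_eq_one _ _ _ _ _ ?_).trans ?_)
      · exact (one_mul _).trans (hτ1 hx)
      · rw [← show g • e' = y from hg, inv_smul_smul]
  have h2 : ∀ x, P.canonicalMap (H (1, x)) = P.canonicalMap x := FSplitting.induction_X
    (fun (z : P.E × Imu μ) ↦ by
      rcases hc z.1 with ⟨g, hg⟩ | hy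
      · exact (congrArg P.canonicalMap (hK g (z, 1) hg)).trans (canonicalMap_sheetCenter g (z, 1))
      · exact (congrArg P.canonicalMap (hKB (z, 1) hy)).trans rfl)
    fun i (y : P.E) t ↦ by
      rcases hc y with ⟨g, hg⟩ | hy
      · exact (congrArg P.canonicalMap (hF i g (y, t, 1) hg)).trans
          (canonicalMap_sheetEdge i g (y, t, 1))
      · exact (congrArg P.canonicalMap (hFB i (y, t, 1) hy)).trans (P.canonicalMap_edgePath i _)
  let H1 : C(P.canonical.X, P.canonical.X) := H.comp ⟨fun x ↦ (1, x), by fun_prop⟩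
  let S1 : C(P.canonical.X, P.canonical.X) := P.squash.comp ⟨fun x ↦ (1, x), by fun_prop⟩
  have hH : S1.Homotopic H1 := ⟨⟨H, h0, fun _ ↦ rfl⟩⟩
  have hS : (ContinuousMap.id _).Homotopic S1 := ⟨⟨P.squash, P.squash_zero, fun _ ↦ rfl⟩⟩
  refine ⟨closure u', Filter.mem_of_superset (hu'.mem_nhds (heu' rfl)) subset_closure, H1,
    (hS.trans hH).symm, h2, fun x y hxy hx ↦ ?_⟩
  obtain ⟨e', he', h⟩ := huO (subset_closure (hu'u hx))
  exact (h1 x e' he' h hx).trans (h1 y e' he' (h.trans hxy) (hxy ▸ hx)).symm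

theorem isHomotopyEquiv_canonicalMap [T2Space W] [CompactSpace W] :
    IsHomotopyEquiv P.canonicalMap := by
  refine P.isHomotopyEquiv_of_collapses (isCompact_univ.induction_on (p := P.Collapses)
    P.collapses_empty (fun _ _ h ↦ .mono h) (fun _ _ ↦ .union) fun w _ ↦ ?_)
  rw [nhdsWithin_univ]
  exact P.exists_mem_nhds_collapses w

end FCover

theorem mainTheorem6 (μ : ℕ) (hμ : 1 ≤ μ) (W : Type u) [TopologicalSpace W] [ConnectedSpace W]
    (L : FiniteCW W) (P : FCover μ W) [ConnectedSpace P.E] :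
    P.canonical.IsHomotopySplitting P.canonicalMap ∧
    (∃ 𝒱 : Set (Set P.E),
      (∀ V ∈ 𝒱, P.IsFiniteSubcomplex L V ∧ P.proj '' V = univ ∧
        IsClosedEmbedding (P.incl V) ∧
        ∃ K : FiniteCW (P.splitting V).X,
          (P.splitting V).IsSimpleHomotopySplitting L K (P.splittingMap V) ∧
          ∃ U : Set (P.pullback (P.splittingMap V)).E,
            (P.pullback (P.splittingMap V)).IsFiniteSubcomplex K U ∧
            (P.pullback (P.splittingMap V)).IsFundamentalDomain U) ∧
      (⋃ V ∈ 𝒱, V) = univ ∧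
      (∀ i, (⋃ V ∈ 𝒱, P.ySet V i) = univ) ∧
      (⋃ V ∈ 𝒱, V ×ˢ (univ : Set (Imu μ))) = univ ∧
      (⋃ V ∈ 𝒱, range (P.incl V)) = univ) ∧
    (∃ (S : FSplitting.{u} μ) (h : C(S.X, W)) (K : FiniteCW S.X),
      S.IsSimpleHomotopySplitting L K h ∧
      ∃ U : Set (P.pullback h).E,
        (P.pullback h).IsFiniteSubcomplex K U ∧ (P.pullback h).IsFundamentalDomain U) := by
  have : NeZero μ := ⟨by omega⟩
  have := L.t2
  have : CompactSpace W := L.compactSpace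
  have : Finite L.toCells.ι := inferInstance
  refine ⟨P.isHomotopyEquiv_canonicalMap, ⟨P.boundedSets L.toCells, ?_, P.iUnion_boundedSets,
    P.iUnion_ySet_boundedSets, P.iUnion_prod_boundedSets, P.iUnion_range_incl_boundedSets⟩, ?_⟩
  · rintro _ ⟨R, hR, rfl⟩
    exact ⟨P.isFiniteSubcomplex_bounded hR, P.proj_image_bounded,
      P.isClosedEmbedding_incl hR.isCompact hR.isCompact_ySet, P.exists_splitting_of_isBound L hR⟩
  -- Any admissible bound serves here, as every such `V` already projects onto `W`.
  · obtain ⟨R, hR, -⟩ := P.exists_isBound L.toCells 0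
    exact ⟨_, _, P.exists_splitting_of_isBound L hR⟩
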